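/- **Setting.** Let $\mathbb F_q$ be a finite field, $A=\mathbb F_q[\theta]$, and let $\mathbb C_\infty$ be the completion of an algebraic closure of the completion of $\mathbb F_q(\theta)$ at infinity. Let $\mathfrak p$ be a nonzero prime ideal of $A$, with a generator also denoted $\mathfrak p$. An Anderson module of dimension $n$ (with nilpotent operator $N=0$) is $E=\mathbb G_a^n$ over $\mathbb C_\infty$ with an action of $A$ in which $\theta$ acts by $\varphi_T=\theta\cdot 1+\sum_{i\ge1}A_i\tau^i$ (a finite sum, $A_i\in M_n(\mathbb C_\infty)$, $\tau$ the $q$-Frobenius). It has rank $r$ if the $\mathbb C_\infty[T]$-module of $\mathbb F_q$-linear polynomial maps $E\to\mathbb G_a$ is free of finite rank $r$. Morphisms are the $A$-equivariant $\mathbb F_q$-linear polynomial maps, and isogenies are the surjective morphisms with finite kernel. An isogeny is of type $(d_1,\dots,d_r)$ if its kernel is isomorphic to $\prod_i A/(d_i)$. A module $E$ is uniformizable if it has a surjective exponential map $\exp_E:\mathbb C_\infty^n=\mathrm{Lie}(E)\to E(\mathbb C_\infty)$; put $L_E=\ker\exp_E$, so that $E=\mathbb C_\infty^n/L_E$. A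 quasi-isogeny $\iota:E\to E'$ is a $\mathbb C_\infty$-linear isomorphism $\mathrm{Lie}(E)\to\mathrm{Lie}(E')$ such that $c\,\iota$ is the differential of an isogeny for some $0\neq c\in A$. For $0\le j\le r$ and a uniformizable Anderson module $E$ of dimension $n$ and rank $r$, let $T_{\mathfrak p,j}(E)$ (the fibre over $E$ of the Hecke correspondence) be the set of pairs $(E',\iota)$, where $E'$ is a uniformizable Anderson module of dimension $n$ and rank $r$ and $\iota:E\to E'$ is a quasi-isogeny, such that, if $P\in GL_r(\mathbb F_q(\theta))$ expresses an $A$-basis of $\iota(L_E)$ through an $A$-basis of $L_{E'}$, then $$P\in GL_r(A_{\mathfrak p})\,\mathrm{diag}(\underbrace{1,\dots,1}_{r-j},\underbrace{\mathfrak p,\dots,\mathfrak p}_{j})\,GL_r(A_{\mathfrak p})$$ and $P\in GL_r(A_v)$ at every other finite place $v$ (here $A_v$ is the completion of $A$ at $v$). Two pairs $(E',\iota)$ and $(E'',\iota')$ are identified if there is an isomorphism $\beta:E'\to E''$ with $d\beta\circ\iota=\iota'$. **Theorem.** Let $E$ be a uniformizable Anderson module over $\mathbb C_\infty$ of dimension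 $n$ and rank $r$, with lattice $L=L_E$. 1. $L$ is a free $A$-module of rank $r$. The exponential map induces an isomorphism of $A$-modules $\mathfrak p^{-1}L/L\cong E_{\mathfrak p}$ onto the set of $\mathfrak p$-torsion points of $E$, and $E_{\mathfrak p}$ is an $r$-dimensional vector space over $A/\mathfrak p$. Let moreover $0\le j\le r$. 2. Let $E'$ be an Anderson module of dimension $n$ and rank $r$. For a $\mathbb C_\infty$-linear isomorphism $\iota:\mathrm{Lie}(E)\to\mathrm{Lie}(E')$, the pair $(E',\iota)$ belongs to $T_{\mathfrak p,j}(E)$ if and only if $\iota$ is the differential of an isogeny $\alpha:E\to E'$ of type $(1,\dots,1,\mathfrak p,\dots,\mathfrak p)$, with $r-j$ entries $1$ and $j$ entries $\mathfrak p$. Consequently $E'$ occurs in $T_{\mathfrak p,j}(E)$ if and only if an isogeny $E\to E'$ of this type exists; in that case $E'$ is uniformizable. 3. Sending $(E',\iota)$ to the kernel of the corresponding isogeny $\alpha$ is a bijection from $T_{\mathfrak p,j}(E)$ onto the set of $j$-dimensional $A/\mathfrak p$-subspaces of $E_{\mathfrak p}$. If every endomorphism of $E$ is multiplication by an element of $A$,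 then different elements of $T_{\mathfrak p,j}(E)$ have non-isomorphic $E'$, so that the set of isomorphism classes of the modules $E'$ occurring in $T_{\mathfrak p,j}(E)$ is also in bijection with these subspaces. -/

import Mathlib

open Polynomial IsDedekindDomain
open scoped Matrix NNReal

noncomputable section

namespace AndersonHecke

/-! ### The field `C_∞` -/

section Field

variable (Fq : Type*) [Field Fq]

open Classical in
/-- The completion `K_∞` of `F_q(θ)` at the infinite place. The variable `θ` is `RatFunc.X`. -/
abbrev KInfty := RatFunc.CompletionAtInfty Fq

theorem val_theta :
    Valued.v (algebraMap (RatFunc Fq) (KInfty Fq) RatFunc.X) = WithZero.exp (1 : ℤ) := by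
  classical
  let := RatFunc.inftyValued Fq
  refine (Valued.extensionValuation_apply_coe (K := RatFunc Fq) RatFunc.X).trans ?_
  change RatFunc.inftyValuation Fq RatFunc.X = _
  simp

theorem one_lt_card [Fintype Fq] : (1 : ℝ≥0) < (Fintype.card Fq : ℝ≥0) := by
  exact_mod_cast Fintype.one_lt_card

variable [Fintype Fq]

/-- The valuation of `K_∞` has rank one: we use the real absolute value with `|θ| = q`. -/
instance : Valuation.RankOne (Valued.v : Valuation (KInfty Fq) (WithZero (Multiplicative ℤ))) where
  hom' := (WithZeroMulInt.toNNReal (one_lt_card Fq).ne_zero).comp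
    MonoidWithZeroHom.ValueGroup₀.embedding
  strictMono' := (WithZeroMulInt.toNNReal_strictMono (one_lt_card Fq)).comp
    MonoidWithZeroHom.ValueGroup₀.embedding_strictMono
  exists_val_nontrivial := by
    refine ⟨algebraMap (RatFunc Fq) (KInfty Fq) RatFunc.X, ?_, ?_⟩ <;> rw [val_theta]
    · exact WithZero.exp_ne_zero
    · rw [← WithZero.exp_zero]
      exact fun h => by simpa using WithZero.exp_injective h

instance : NontriviallyNormedField (KInfty Fq) :=
  Valued.toNontriviallyNormedField (KInfty Fq) (WithZero (Multiplicative ℤ))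

open scoped Valued in
instance : IsUltrametricDist (KInfty Fq) :=
  inferInstanceAs (@IsUltrametricDist (KInfty Fq)
    (Valued.toNormedField (KInfty Fq) (WithZero (Multiplicative ℤ))).toMetricSpace.toDist)

instance : CompleteSpace (KInfty Fq) := by
  classical
  let := RatFunc.inftyValued Fq
  exact inferInstanceAs (CompleteSpace (UniformSpace.Completion (RatFunc Fq)))

/-- A fixed algebraic closure of `K_∞`. -/
abbrev KInftyAlg := AlgebraicClosure (KInfty Fq)

/-- The absolute value of `K_∞` extends uniquely to its algebraic closure. -/
instance : NormedField (KInftyAlg Fq) := spectralNorm.normedField (KInfty Fq) (KInftyAlg Fq)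

/-- `C_∞`: the completion of an algebraic closure of `K_∞`. -/
def CInfty := UniformSpace.Completion (KInftyAlg Fq)

instance : NormedField (CInfty Fq) :=
  inferInstanceAs (NormedField (UniformSpace.Completion (KInftyAlg Fq)))

instance : CompleteSpace (CInfty Fq) :=
  inferInstanceAs (CompleteSpace (UniformSpace.Completion (KInftyAlg Fq)))

/-- The inclusion `F_q(θ) → C_∞`. -/
def ratFuncToCInfty : RatFunc Fq →+* CInfty Fq :=
  (UniformSpace.Completion.coeRingHom : KInftyAlg Fq →+* UniformSpace.Completion (KInftyAlg Fq)).comp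
    ((algebraMap (KInfty Fq) (KInftyAlg Fq)).comp (algebraMap (RatFunc Fq) (KInfty Fq)))

instance : Algebra (RatFunc Fq) (CInfty Fq) := (ratFuncToCInfty Fq).toAlgebra

/-- `F_q[θ]` acts on `C_∞` through `F_q[θ] ⊆ F_q(θ) ⊆ C_∞`; the variable `X` acts as `θ`. -/
instance : Algebra Fq[X] (CInfty Fq) :=
  ((ratFuncToCInfty Fq).comp (algebraMap Fq[X] (RatFunc Fq))).toAlgebra

instance : Algebra Fq (CInfty Fq) :=
  ((ratFuncToCInfty Fq).comp (algebraMap Fq (RatFunc Fq))).toAlgebra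

instance : IsScalarTower Fq[X] (RatFunc Fq) (CInfty Fq) := .of_algebraMap_eq fun _ => rfl

instance : IsScalarTower Fq (RatFunc Fq) (CInfty Fq) := .of_algebraMap_eq fun _ => rfl

instance : IsScalarTower Fq Fq[X] (CInfty Fq) := .of_algebraMap_eq fun x => by
  change ratFuncToCInfty Fq _ = ratFuncToCInfty Fq _
  rw [← IsScalarTower.algebraMap_apply Fq Fq[X] (RatFunc Fq)]

/-- The element `θ` of `C_∞`. -/
def theta : CInfty Fq := algebraMap Fq[X] (CInfty Fq) X

end Field

/-! ### `F_q`-linear polynomial maps -/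

section Tau

variable (Fq : Type*) [Field Fq] [Fintype Fq]

/-- `τ^i : C_∞^n → C_∞^n`, raising every coordinate to the power `q^i`. -/
def frob {n : ℕ} (i : ℕ) : (Fin n → CInfty Fq) →ₗ[Fq] (Fin n → CInfty Fq) :=
  ((FiniteField.frobeniusAlgHom Fq (CInfty Fq)) ^ i).toLinearMap.compLeft (Fin n)

theorem frob_apply {n : ℕ} (i : ℕ) (z : Fin n → CInfty Fq) (k : Fin n) :
    frob Fq i z k = z k ^ (Fintype.card Fq ^ i) := by
  simp [frob, FiniteField.coe_frobeniusAlgHom, pow_iterate]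

/-- `F_q`-linear polynomial maps `G_a^n → G_a^m` over `C_∞`, i.e. `m × n` matrices over `C_∞{τ}`,
written `∑ P_i τ^i` with finitely many nonzero matrices `P_i`. -/
abbrev TauPoly (m n : ℕ) := ℕ →₀ Matrix (Fin m) (Fin n) (CInfty Fq)

variable {Fq}

/-- The map `z ↦ ∑ P_i z^{(q^i)}` on points. -/
def TauPoly.eval {m n : ℕ} (P : TauPoly Fq m n) :
    (Fin n → CInfty Fq) →ₗ[Fq] (Fin m → CInfty Fq) :=
  ∑ i ∈ P.support, ((P i).mulVecLin.restrictScalars Fq) ∘ₗ frob Fq i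

theorem TauPoly.eval_apply {m n : ℕ} (P : TauPoly Fq m n) (z : Fin n → CInfty Fq) :
    P.eval z = ∑ i ∈ P.support, P i *ᵥ frob Fq i z := by
  simp [TauPoly.eval]

end Tau

/-! ### Anderson modules -/

section Modules

variable (Fq : Type*) [Field Fq] [Fintype Fq]

/-- An Anderson module over `C_∞` of dimension `n`, with nilpotent operator `N = 0`: the group
`G_a^n` with the action `φ_T = ∑ A_i τ^i` of `F_q[T]`, where `A_0 = θ`. -/
structure AndersonModule (n : ℕ) where
  /-- `φ_T`. -/
  phi : TauPoly Fq n n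
  phi_zero : phi 0 = Matrix.scalar (Fin n) (theta Fq)

/-- The tangent space `Lie(E) = C_∞^n` of an Anderson module of dimension `n`. Since `N = 0`, the
ring `F_q[T]` acts on it through `T ↦ θ`, i.e. by the `F_q[θ]`-algebra structure of `C_∞`. -/
abbrev Lie (n : ℕ) := Fin n → CInfty Fq

variable {Fq}

namespace AndersonModule

variable {n : ℕ} (E : AndersonModule Fq n)

/-- `φ_T` as an endomorphism of `E(C_∞) = C_∞^n`. -/
def T : Module.End Fq (Fin n → CInfty Fq) := E.phi.eval

/-- The points `E(C_∞)`: a copy of `C_∞^n` on which the variable of `F_q[X]` acts by `φ_T`. -/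
abbrev Points := Module.AEval' E.T

/-- The identification of `C_∞^n` with the points of `E`. -/
abbrev pt : (Fin n → CInfty Fq) ≃ₗ[Fq] E.Points := Module.AEval'.of E.T

variable (Fq n) in
/-- The `C_∞`-vector space of all `F_q`-linear polynomial maps `G_a^n → G_a`. It is spanned by the
maps `z ↦ z_k^{q^i}`. -/
def motiveSpace : Submodule (CInfty Fq) ((Fin n → CInfty Fq) → CInfty Fq) :=
  Submodule.span (CInfty Fq)
    (Set.range fun p : ℕ × Fin n => fun z : Fin n → CInfty Fq => z p.2 ^ (Fintype.card Fq ^ p.1))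

theorem motiveSpace_comp {f : (Fin n → CInfty Fq) → CInfty Fq} (hf : f ∈ motiveSpace Fq n) :
    LinearMap.funLeft (CInfty Fq) (CInfty Fq) E.T f ∈ motiveSpace Fq n := by
  induction hf using Submodule.span_induction with
  | mem f hf =>
    obtain ⟨⟨i, k⟩, rfl⟩ := hf
    have key : (LinearMap.funLeft (CInfty Fq) (CInfty Fq) E.T
        (fun z : Fin n → CInfty Fq => z k ^ (Fintype.card Fq ^ i))) =
        ∑ j ∈ E.phi.support, ∑ l : Fin n, (E.phi j k l ^ (Fintype.card Fq ^ i)) •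
          (fun z : Fin n → CInfty Fq => z l ^ (Fintype.card Fq ^ (j + i))) := by
      funext z
      have h (x : CInfty Fq) : x ^ (Fintype.card Fq ^ i) =
          ((FiniteField.frobeniusAlgHom Fq (CInfty Fq)) ^ i) x := by
        simp [FiniteField.coe_frobeniusAlgHom, pow_iterate]
      simp only [LinearMap.funLeft_apply, T, TauPoly.eval_apply, Finset.sum_apply, Pi.smul_apply,
        smul_eq_mul]
      rw [h, map_sum]
      refine Finset.sum_congr rfl fun j _ => ?_
      simp only [Matrix.mulVec, dotProduct]
      rw [map_sum]
      refine Finset.sum_congr rfl fun l _ => ?_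
      rw [map_mul, ← h, ← h, frob_apply, ← pow_mul, ← pow_add]
    rw [key]
    exact Submodule.sum_mem _ fun j _ => Submodule.sum_mem _ fun l _ =>
      Submodule.smul_mem _ _ (Submodule.subset_span ⟨(j + i, l), rfl⟩)
  | zero => simp
  | add f g _ _ hf hg => rw [map_add]; exact add_mem hf hg
  | smul c f _ hf => rw [map_smul]; exact Submodule.smul_mem _ _ hf

/-- The t-motive of `E`: the space of `F_q`-linear polynomial maps `E → G_a`, as a module over
`C_∞[T]`, where `T` acts by composition with `φ_T`. -/
abbrev Motive := Module.AEval'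
  ((LinearMap.funLeft (CInfty Fq) (CInfty Fq) E.T).restrict fun _ h => E.motiveSpace_comp h)

/-- `E` is abelian of rank `r`: its t-motive is a free `C_∞[T]`-module of finite rank `r`. -/
structure HasRank (r : ℕ) : Prop where
  finite : Module.Finite (CInfty Fq)[X] E.Motive
  free : Module.Free (CInfty Fq)[X] E.Motive
  finrank_eq : Module.finrank (CInfty Fq)[X] E.Motive = r

/-- `e` is the exponential map of `E`: it is `F_q`-linear with `e(θ z) = φ_T(e(z))`, and it is given
by an everywhere convergent series `z + ∑_{i ≥ 1} B_i z^{(q^i)}`. -/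
def IsExponential (e : Lie Fq n →ₗ[Fq[X]] E.Points) : Prop :=
  ∃ B : ℕ → Matrix (Fin n) (Fin n) (CInfty Fq), B 0 = 1 ∧
    ∀ z : Lie Fq n, HasSum (fun i => B i *ᵥ frob Fq i z) (E.pt.symm (e z))

/-- `e` exhibits `E` as uniformizable, `E = C_∞^n / L` with `L = ker e`: it is the exponential map
of `E` and it is surjective. -/
structure IsUniformization (e : Lie Fq n →ₗ[Fq[X]] E.Points) : Prop where
  isExponential : E.IsExponential e
  surjective : Function.Surjective e

/-- The set `E_𝔭` of `𝔭`-torsion points, a vector space over `F_q[θ]/𝔭`. -/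
abbrev torsion (𝔭 : HeightOneSpectrum Fq[X]) : Submodule Fq[X] E.Points :=
  Submodule.torsionBySet Fq[X] E.Points 𝔭.asIdeal

end AndersonModule

/-! ### Morphisms and isogenies -/

/-- Morphisms of Anderson modules: `F_q`-linear polynomial maps commuting with the action of
`F_q[T]`. -/
structure Hom {m n : ℕ} (E : AndersonModule Fq m) (E' : AndersonModule Fq n) where
  poly : TauPoly Fq n m
  comm : ∀ z, poly.eval (E.T z) = E'.T (poly.eval z)

namespace Hom

variable {m n : ℕ} {E : AndersonModule Fq m} {E' : AndersonModule Fq n}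

/-- A morphism as an `F_q[T]`-linear map on points. -/
def onPoints (α : Hom E E') : E.Points →ₗ[Fq[X]] E'.Points :=
  LinearMap.ofAEval _ (E'.pt.toLinearMap ∘ₗ α.poly.eval) fun z => by
    simp only [LinearMap.comp_apply, LinearEquiv.coe_coe, Module.AEval'.X_smul_of]
    exact congrArg _ (α.comm z)

theorem onPoints_pt (α : Hom E E') (z : Fin m → CInfty Fq) :
    α.onPoints (E.pt z) = E'.pt (α.poly.eval z) := rfl

/-- The differential `Lie(E) → Lie(E')` of a morphism. -/
def differential (α : Hom E E') : Lie Fq m →ₗ[CInfty Fq] Lie Fq n := (α.poly 0).mulVecLin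

/-- An isogeny: a surjective morphism with finite kernel. -/
structure IsIsogeny (α : Hom E E') : Prop where
  surjective : Function.Surjective α.onPoints
  finite_ker : Finite (LinearMap.ker α.onPoints)

/-- `α` is of type `(d_1, …, d_r)`: its kernel is isomorphic to `∏ F_q[θ]/(d_i)`. -/
def HasType (α : Hom E E') {r : ℕ} (d : Fin r → Fq[X]) : Prop :=
  Nonempty (LinearMap.ker α.onPoints ≃ₗ[Fq[X]] (Π i, Fq[X] ⧸ Ideal.span {d i}))

/-- `α` is an isomorphism of Anderson modules. -/
def IsIso (α : Hom E E') : Prop :=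
  ∃ β : Hom E' E, (∀ z, β.onPoints (α.onPoints z) = z) ∧ ∀ z, α.onPoints (β.onPoints z) = z

end Hom

/-! ### Hecke correspondences -/

/-- The vector `(1, …, 1, ϖ, …, ϖ)` with `r - j` entries `1` and `j` entries `ϖ`. -/
def typeVec (r j : ℕ) (ϖ : Fq[X]) : Fin r → Fq[X] := fun i => if (i : ℕ) < r - j then 1 else ϖ

/-- The double coset `K_v D K_v` with `K_v = GL_r(O_v)`, inside the `r × r` matrices over the
completion `F_q(θ)_v`; here `O_v` is the completion of `F_q[θ]` at the prime `v`. -/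
def doubleCoset {r : ℕ} (v : HeightOneSpectrum Fq[X])
    (D : Matrix (Fin r) (Fin r) (v.adicCompletion (RatFunc Fq))) :
    Set (Matrix (Fin r) (Fin r) (v.adicCompletion (RatFunc Fq))) :=
  {M | ∃ U V : GL (Fin r) (v.adicCompletionIntegers (RatFunc Fq)),
    M = U.1.map (algebraMap _ _) * D * V.1.map (algebraMap _ _)}

open Classical in
/-- The relative position of `F_q[θ]`-lattices `L`, `L'` of rank `r` that defines the Hecke
correspondence `T_{𝔭,j}`: in terms of bases, `L = P L'` with `P` in the double coset of
`diag(1, …, 1, ϖ, …, ϖ)` at the place `𝔭`, and `P` in `GL_r(O_v)` at all other finite places `v`. -/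
def HeckeRelated (r : ℕ) (𝔭 : HeightOneSpectrum Fq[X]) (ϖ : Fq[X]) (j : ℕ) {n : ℕ}
    (L L' : Submodule Fq[X] (Lie Fq n)) : Prop :=
  ∃ (b : Module.Basis (Fin r) Fq[X] L) (b' : Module.Basis (Fin r) Fq[X] L')
    (P : Matrix (Fin r) (Fin r) (RatFunc Fq)),
    (∀ i, (b i : Lie Fq n) = ∑ k, P k i • (b' k : Lie Fq n)) ∧
    ∀ v : HeightOneSpectrum Fq[X],
      P.map (algebraMap (RatFunc Fq) (v.adicCompletion (RatFunc Fq))) ∈ doubleCoset v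
        (if v = 𝔭 then
          Matrix.diagonal fun i => algebraMap Fq[X] (v.adicCompletion (RatFunc Fq)) (typeVec r j ϖ i)
        else 1)

/-- `ι : Lie(E) ≃ Lie(E')` is (the differential of) a quasi-isogeny `E → E'`, that is, some nonzero
multiple `c ι` with `c ∈ F_q[θ]` is the differential of an isogeny. -/
def IsQuasiIsogeny {n : ℕ} (E E' : AndersonModule Fq n) (ι : Lie Fq n ≃ₗ[CInfty Fq] Lie Fq n) :
    Prop :=
  ∃ (c : Fq[X]) (β : Hom E E'), c ≠ 0 ∧ β.IsIsogeny ∧ ∀ z, β.differential z = c • ι z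

/-- The pair `(E', ι)` of an Anderson module and a quasi-isogeny `ι` from `E` to it lies in
`T_{𝔭,j}(E)`: both modules are uniformizable, and the period lattices `ι(L)` and `L'` are in
the relative position prescribed by the double coset. -/
def IsHeckePoint {n : ℕ} (r : ℕ) (𝔭 : HeightOneSpectrum Fq[X]) (ϖ : Fq[X]) (j : ℕ)
    (E E' : AndersonModule Fq n) (ι : Lie Fq n ≃ₗ[CInfty Fq] Lie Fq n) : Prop :=
  IsQuasiIsogeny E E' ι ∧
  ∃ (e : Lie Fq n →ₗ[Fq[X]] E.Points) (e' : Lie Fq n →ₗ[Fq[X]] E'.Points),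
    E.IsUniformization e ∧ E'.IsUniformization e' ∧
    HeckeRelated r 𝔭 ϖ j
      ((LinearMap.ker e).map (ι.toLinearMap.restrictScalars Fq[X])) (LinearMap.ker e')

/-- Representatives of the points of the fibre `T_{𝔭,j}(E)`. -/
structure HeckePoint {n : ℕ} (r : ℕ) (𝔭 : HeightOneSpectrum Fq[X]) (ϖ : Fq[X]) (j : ℕ)
    (E : AndersonModule Fq n) where
  target : AndersonModule Fq n
  hasRank : target.HasRank r
  marking : Lie Fq n ≃ₗ[CInfty Fq] Lie Fq n
  isHeckePoint : IsHeckePoint r 𝔭 ϖ j E target marking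

/-- Two representatives define the same point if there is an isomorphism of the targets that is
compatible with the quasi-isogenies. -/
def HeckePoint.Equiv {n r : ℕ} {𝔭 : HeightOneSpectrum Fq[X]} {ϖ : Fq[X]} {j : ℕ}
    {E : AndersonModule Fq n} (x y : HeckePoint r 𝔭 ϖ j E) : Prop :=
  ∃ β : Hom x.target y.target, β.IsIso ∧ ∀ z, β.differential (x.marking z) = y.marking z

/-- The set `T_{𝔭,j}(E)`: the fibre over `E` of the Hecke correspondence. -/
def HeckeFibre {n : ℕ} (r : ℕ) (𝔭 : HeightOneSpectrum Fq[X]) (ϖ : Fq[X]) (j : ℕ)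
    (E : AndersonModule Fq n) :=
  Quot (HeckePoint.Equiv (r := r) (𝔭 := 𝔭) (ϖ := ϖ) (j := j) (E := E))

/-- `𝔭⁻¹ L`. -/
def divLattice (𝔭 : HeightOneSpectrum Fq[X]) {n : ℕ} (L : Submodule Fq[X] (Lie Fq n)) :
    Submodule Fq[X] (Lie Fq n) where
  carrier := {z | ∀ a ∈ 𝔭.asIdeal, a • z ∈ L}
  add_mem' hx hy a ha := by rw [smul_add]; exact add_mem (hx a ha) (hy a ha)
  zero_mem' a _ := by rw [smul_zero]; exact zero_mem L
  smul_mem' c x hx a ha := by rw [smul_comm]; exact L.smul_mem c (hx a ha)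

end Modules

end AndersonHecke

end

/-! The exponential is the identity to first order and turns multiplication by θ into φ_T. Because
|θ| > 1, a map with this equivariance that vanishes to second order at 0 is zero: replacing z by
θ^{-k} z shrinks its value like |θ|^{-2k}, while applying φ_T k times to come back expands only a
little faster than |θ|^k (`eq_zero_of_theta_equivariant`). Hence exponentials are functorial, a
morphism out of a uniformizable module is determined by its differential, and an isogeny α : E → E'
of uniformizable modules with differential ι has kernel L'/ι(L).

The size of the torsion comes from the motive M. The differential of φ_a is the scalar a, so φ_a is
separable for a ≠ 0, and a Nullstellensatz for additive polynomials (`mem_of_vanishes`) identifies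
aM with the functions vanishing on E[a]. Thus E[a] is dual to M/aM and has F_q-dimension r deg a.
The lattice L is discrete, so its intersection with any finite-dimensional F_q(θ)-space spanned by
lattice points is finitely generated; L/θL embeds in E[θ], and onto it because the exponential is
surjective. So L is free of rank r.

The Hecke condition says that P and ϖP⁻¹ are integral at all finite places, hence polynomial, so
that ϖL' ⊆ ι(L) ⊆ L', and that det P has 𝔭-valuation j. By the Smith normal form this means that
L'/ι(L) is a j-dimensional space over A/𝔭. Algebraicity of ι needs no comparison theorem: cι is the
differential of some isogeny β, the inclusion ι(L) ⊆ L' makes β vanish on E[c], and the same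
Nullstellensatz divides β by φ_c.

For the bijection, separable isogenies with equal kernels differ by an isomorphism, and every finite
submodule is a kernel since the quotient of G_a^n by a finite F_q-space is again G_a^n; the rank
survives because the two motives embed in each other. If End(E) = A, an isomorphism γ of targets
gives an endomorphism δγα = a with δβ = ϖ. Whether ϖ divides a decides which kernel contains the
other, and the dimensions agree. -/

noncomputable section

/-! ### Algebraic closedness and absolute value of C_∞ -/

/-- A complete normed field that contains a dense algebraically closed field is algebraically
closed. -/
theorem IsAlgClosed.of_dense_normedField {K L : Type*} [Field K] [IsAlgClosed K] [NormedField L]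
    [CompleteSpace L] (i : K →+* L) (hi : DenseRange i) : IsAlgClosed L := by
  refine IsAlgClosed.of_exists_root _ fun f hf hirr => ?_
  set N := f.natDegree with hN
  have hNpos : 0 < N := hirr.natDegree_pos
  -- Approximate the coefficients within δ/B. On the ball of radius R the N error terms are each at
  -- most (δ/B)(max 1 R)^N; the summand 1 in B makes the final inequality strict.
  have approx (R δ : ℝ) (hδ : 0 < δ) : ∃ g : K[X], g.Monic ∧ g.natDegree = N ∧
      ∀ y : L, ‖y‖ ≤ R → ‖(g.map i).eval y - f.eval y‖ < δ := by
    set B : ℝ := N * (max 1 R) ^ N + 1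
    have hB : 0 < B := by positivity
    have hc (j : ℕ) : ∃ a : K, ‖i a - f.coeff j‖ < δ / B := by
      obtain ⟨a, ha⟩ := hi.exists_dist_lt (f.coeff j) (div_pos hδ hB)
      exact ⟨a, by rwa [dist_comm, dist_eq_norm] at ha⟩
    choose a ha using hc
    refine ⟨X ^ N + ∑ j ∈ Finset.range N, C (a j) * X ^ j, ?_, ?_, fun y hy => ?_⟩
    · refine monic_X_pow_add ((degree_sum_le _ _).trans_lt ?_)
      refine (Finset.sup_lt_iff (WithBot.bot_lt_coe _)).2 fun j hj => ?_
      exact (degree_C_mul_X_pow_le _ _).trans_lt (by exact_mod_cast Finset.mem_range.1 hj)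
    · refine natDegree_eq_of_degree_eq_some ?_
      rw [degree_add_eq_left_of_degree_lt, degree_X_pow]
      rw [degree_X_pow]
      refine (degree_sum_le _ _).trans_lt ((Finset.sup_lt_iff (WithBot.bot_lt_coe _)).2 fun j hj => ?_)
      exact (degree_C_mul_X_pow_le _ _).trans_lt (by exact_mod_cast Finset.mem_range.1 hj)
    · have h1 : f.eval y = y ^ N + ∑ j ∈ Finset.range N, f.coeff j * y ^ j := by
        rw [eval_eq_sum_range, Finset.sum_range_succ, hf.coeff_natDegree, one_mul, add_comm]
      have h2 : ((X ^ N + ∑ j ∈ Finset.range N, C (a j) * X ^ j : K[X]).map i).eval y - f.eval y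
          = ∑ j ∈ Finset.range N, (i (a j) - f.coeff j) * y ^ j := by
        rw [h1]
        simp [Polynomial.map_sum, eval_finsetSum, sub_mul, Finset.sum_sub_distrib]
      rw [h2]
      calc _ ≤ ∑ j ∈ Finset.range N, δ / B * (max 1 R) ^ N := by
            refine norm_sum_le_of_le _ fun j hj => ?_
            rw [norm_mul, norm_pow]
            gcongr
            · exact (ha j).le
            · calc ‖y‖ ^ j ≤ (max 1 R) ^ j := by gcongr; exact hy.trans (le_max_right _ _)
                _ ≤ _ := pow_le_pow_right₀ (le_max_left _ _) (Finset.mem_range.1 hj).le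
        _ = δ / B * (N * (max 1 R) ^ N) := by simp; ring
        _ < δ / B * B := by
            have := div_pos hδ hB
            gcongr
            simp [B]
        _ = δ := by field_simp
  -- An approximating monic g splits, so |g(x)| is a product of N distances to roots; if it is below
  -- ε^N, some root lies within ε of x. At that root g vanishes, so f is small. The second entry of
  -- the minimum keeps |g(x)| below ε^N.
  have step (x : L) (ε η : ℝ) (hη : 0 < η) (hx : ‖f.eval x‖ < ε ^ N) (hε : 0 < ε) :
      ∃ y, ‖y - x‖ < ε ∧ ‖f.eval y‖ < η := by
    obtain ⟨g, hg, hgN, hgy⟩ := approx (‖x‖ + ε) (min η (ε ^ N - ‖f.eval x‖))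
      (lt_min hη (sub_pos.2 hx))
    have hs := IsAlgClosed.splits g
    have hprod := hs.eq_prod_roots_of_monic hg
    have hcard : g.roots.card = N := hgN ▸ hs.natDegree_eq_card_roots.symm
    have hev (x : L) : (g.map i).eval x = (g.roots.map fun a => x - i a).prod := by
      conv_lhs => rw [hprod]
      rw [Polynomial.map_multiset_prod, eval_multiset_prod]
      simp
    have hgx : ‖(g.map i).eval x‖ < ε ^ N := by
      have h1 := hgy x (by linarith)
      have h2 := norm_add_le ((g.map i).eval x - f.eval x) (f.eval x)
      rw [sub_add_cancel] at h2
      have := min_le_right η (ε ^ N - ‖f.eval x‖)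
      linarith
    have : ∃ a ∈ g.roots, ‖x - i a‖ < ε := by
      by_contra! hcon
      refine hgx.not_ge ?_
      rw [hev]
      have : (∀ s : Multiset K, (∀ a ∈ s, ε ≤ ‖x - i a‖) →
          ε ^ s.card ≤ ‖(s.map fun a => x - i a).prod‖) := by
        intro s
        induction s using Multiset.induction with
        | empty => simp
        | cons a s ih =>
          intro h
          rw [Multiset.map_cons, Multiset.prod_cons, norm_mul, Multiset.card_cons, pow_succ']
          gcongr
          · exact h a (Multiset.mem_cons_self _ _)
          · exact ih fun b hb => h b (Multiset.mem_cons_of_mem hb)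
      exact hcard ▸ this _ hcon
    obtain ⟨a, ha, hax⟩ := this
    refine ⟨i a, by rwa [norm_sub_rev], ?_⟩
    have h0 : (g.map i).eval (i a) = 0 := by
      rw [eval_map, eval₂_at_apply, (mem_roots'.1 ha).2.eq_zero, map_zero]
    have h1 := hgy (i a) (by
      have := norm_sub_norm_le (i a) x
      rw [norm_sub_rev] at this
      linarith)
    rw [h0, zero_sub, norm_neg] at h1
    exact h1.trans_le (min_le_left _ _)
  -- One application of `step` with a large radius provides a start for the iteration with ε =
  -- 2^{-n}.
  have h0 : ∃ x₀ : L, ‖f.eval x₀‖ < ((1 / 2 : ℝ) ^ 0) ^ N := by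
    have h1 : ‖f.eval 0‖ < (‖f.eval 0‖ + 1) ^ N :=
      (lt_add_one _).trans_le (le_self_pow₀ (by linarith [norm_nonneg (f.eval 0)]) hNpos.ne')
    obtain ⟨y, -, hy⟩ := step 0 (‖f.eval 0‖ + 1) 1 one_pos h1 (by positivity)
    exact ⟨y, by simpa using hy⟩
  obtain ⟨x₀, hx₀⟩ := h0
  have step' (n : ℕ) (x : {x : L // ‖f.eval x‖ < ((1 / 2 : ℝ) ^ n) ^ N}) :
      ∃ y : {x : L // ‖f.eval x‖ < ((1 / 2 : ℝ) ^ (n + 1)) ^ N}, ‖y.1 - x.1‖ < (1 / 2) ^ n := by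
    obtain ⟨y, hy, hy'⟩ := step x.1 ((1 / 2) ^ n) (((1 / 2) ^ (n + 1)) ^ N) (by positivity) x.2
      (by positivity)
    exact ⟨⟨y, hy'⟩, hy⟩
  choose next hnext using step'
  let u : (n : ℕ) → {x : L // ‖f.eval x‖ < ((1 / 2 : ℝ) ^ n) ^ N} :=
    fun n => Nat.rec ⟨x₀, hx₀⟩ (fun n x => next n x) n
  have hu (n : ℕ) : dist (u n).1 (u (n + 1)).1 ≤ 1 * (1 / 2) ^ n := by
    rw [dist_comm, dist_eq_norm, one_mul]
    exact (hnext n (u n)).le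
  obtain ⟨x, hx⟩ := cauchySeq_tendsto_of_complete
    (cauchySeq_of_le_geometric (1 / 2 : ℝ) 1 (by norm_num) hu)
  refine ⟨x, tendsto_nhds_unique ((f.continuous.tendsto x).comp hx) ?_⟩
  refine squeeze_zero_norm (fun n => (u n).2.le) ?_
  simp_rw [← pow_mul, mul_comm _ N, pow_mul]
  exact tendsto_pow_atTop_nhds_zero_of_lt_one (by positivity)
    (pow_lt_one₀ (by norm_num) (by norm_num) hNpos.ne')

namespace AndersonHecke

section Norm

variable (Fq : Type*) [Field Fq] [Fintype Fq]

instance : IsAlgClosed (CInfty Fq) :=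
  IsAlgClosed.of_dense_normedField
    (UniformSpace.Completion.coeRingHom : KInftyAlg Fq →+* UniformSpace.Completion (KInftyAlg Fq))
    UniformSpace.Completion.denseRange_coe

theorem norm_algebraMap_ratFunc (x : RatFunc Fq) :
    ‖algebraMap (RatFunc Fq) (CInfty Fq) x‖ = ‖algebraMap (RatFunc Fq) (KInfty Fq) x‖ :=
  (UniformSpace.Completion.norm_coe (E := KInftyAlg Fq) _).trans
    (spectralNorm_extends (K := KInfty Fq) (L := KInftyAlg Fq) _)

omit [Fintype Fq] in
open Classical in
theorem val_algebraMap_ratFunc (x : RatFunc Fq) :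
    Valued.v (algebraMap (RatFunc Fq) (KInfty Fq) x) = RatFunc.inftyValuation Fq x := by
  let := RatFunc.inftyValued Fq
  refine (Valued.extensionValuation_apply_coe (K := RatFunc Fq) x).trans ?_
  rfl

theorem one_lt_norm_theta : 1 < ‖theta Fq‖ := by
  have : theta Fq = algebraMap (RatFunc Fq) (CInfty Fq) RatFunc.X := by
    rw [theta, IsScalarTower.algebraMap_apply Fq[X] (RatFunc Fq), RatFunc.algebraMap_X]
  rw [this, norm_algebraMap_ratFunc]
  refine (Valued.toNormedField.one_lt_norm_iff (L := KInfty Fq)).2 ?_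
  rw [val_theta, ← WithZero.exp_zero, WithZero.exp_lt_exp]
  exact one_pos

/-- At infinity the size of a rational function is governed by its degree. The bound makes the
remainders left after removing polynomial parts act without increasing norms. -/
theorem norm_le_one_of_intDegree_le {x : RatFunc Fq} (hx : x.intDegree ≤ 0) :
    ‖algebraMap (RatFunc Fq) (CInfty Fq) x‖ ≤ 1 := by
  classical
  rcases eq_or_ne x 0 with rfl | h0
  · simp
  rw [norm_algebraMap_ratFunc]
  refine (Valued.toNormedField.norm_le_one_iff (L := KInfty Fq)).2 ?_
  rw [val_algebraMap_ratFunc, RatFunc.inftyValuation_apply, RatFunc.inftyValuation_of_nonzero _ h0,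
    ← WithZero.exp_zero, WithZero.exp_le_exp]
  exact hx

end Norm
end AndersonHecke
end

noncomputable section
namespace AndersonHecke

/-! ### F_q-linear polynomial maps and their first-order behaviour -/

section TauPoly

variable {Fq : Type*} [Field Fq] [Fintype Fq]

theorem one_lt_card_nat : 1 < Fintype.card Fq := Fintype.one_lt_card

namespace TauPoly

variable {l m n : ℕ}

theorem eval_eq_sum (P : TauPoly Fq m n) :
    P.eval = P.sum fun i A => (A.mulVecLin.restrictScalars Fq) ∘ₗ frob Fq i := rfl

@[simp] theorem eval_zero : (0 : TauPoly Fq m n).eval = 0 := by simp [eval_eq_sum]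

theorem eval_add (P Q : TauPoly Fq m n) :
    eval (P + Q) = P.eval + Q.eval := by
  simp only [eval_eq_sum]
  refine Finsupp.sum_add_index' (fun i => ?_) fun i A B => ?_ <;> refine LinearMap.ext fun z => ?_
  · simp
  · simp

theorem eval_single (i : ℕ) (A : Matrix (Fin m) (Fin n) (CInfty Fq)) (z : Fin n → CInfty Fq) :
    eval (Finsupp.single i A) z = A *ᵥ frob Fq i z := by
  rw [eval_eq_sum, Finsupp.sum_single_index]
  · rfl
  · ext; simp

theorem eval_finsetSum {ι : Type*} (s : Finset ι) (P : ι → TauPoly Fq m n) :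
    eval (∑ i ∈ s, P i) = ∑ i ∈ s, (P i).eval := by
  classical
  induction s using Finset.induction with
  | empty => simp
  | insert a s ha ih => rw [Finset.sum_insert ha, Finset.sum_insert ha, eval_add, ih]

/-- Composition of polynomial maps. -/
def comp (P : TauPoly Fq l m) (Q : TauPoly Fq m n) : TauPoly Fq l n :=
  P.sum fun i A => Q.sum fun j B =>
    Finsupp.single (i + j) (A * B.map (· ^ (Fintype.card Fq ^ i)))

theorem frob_mulVec (i : ℕ) (A : Matrix (Fin m) (Fin n) (CInfty Fq)) (z : Fin n → CInfty Fq) :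
    frob Fq i (A *ᵥ z) = A.map (· ^ (Fintype.card Fq ^ i)) *ᵥ frob Fq i z := by
  have h (x : CInfty Fq) : x ^ (Fintype.card Fq ^ i) =
      ((FiniteField.frobeniusAlgHom Fq (CInfty Fq)) ^ i) x := by
    simp [FiniteField.coe_frobeniusAlgHom, pow_iterate]
  ext k
  simp only [frob_apply, Matrix.mulVec, dotProduct, Matrix.map_apply, ← mul_pow]
  simp only [h, map_sum]

theorem frob_frob (i j : ℕ) (z : Fin n → CInfty Fq) :
    frob Fq i (frob Fq j z) = frob Fq (i + j) z := by
  ext k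
  simp only [frob_apply, ← pow_mul, ← pow_add, add_comm]

@[simp] theorem frob_zero (z : Fin n → CInfty Fq) : frob Fq 0 z = z := by
  ext k; simp [frob_apply]

theorem eval_comp (P : TauPoly Fq l m) (Q : TauPoly Fq m n) (z : Fin n → CInfty Fq) :
    (P.comp Q).eval z = P.eval (Q.eval z) := by
  simp only [comp, Finsupp.sum, eval_finsetSum, LinearMap.sum_apply, eval_single]
  rw [eval_apply P]
  refine Finset.sum_congr rfl fun i _ => ?_
  rw [eval_apply Q, map_sum, Matrix.mulVec_sum]
  refine Finset.sum_congr rfl fun j _ => ?_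
  rw [frob_mulVec, frob_frob, Matrix.mulVec_mulVec]

/-- Degrees in τ add, so only the two constant terms contribute, and τ^0 does not twist. This is the
chain rule for differentials. -/
theorem comp_apply_zero (P : TauPoly Fq l m) (Q : TauPoly Fq m n) :
    P.comp Q 0 = P 0 * Q 0 := by
  classical
  rw [comp, Finsupp.sum, Finsupp.finsetSum_apply, Finset.sum_eq_single 0]
  · rw [Finsupp.sum, Finsupp.finsetSum_apply, Finset.sum_eq_single 0]
    · simp
    · intro j _ hj
      rw [Finsupp.single_eq_of_ne (by omega)]
    · intro h
      simp [Finsupp.notMem_support_iff.1 h]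
  · intro i _ hi
    rw [Finsupp.sum, Finsupp.finsetSum_apply]
    refine Finset.sum_eq_zero fun j _ => ?_
    rw [Finsupp.single_eq_of_ne (by omega)]
  · intro h
    simp [Finsupp.notMem_support_iff.1 h]

theorem eval_mem_motiveSpace (P : TauPoly Fq m n) (k : Fin m) :
    (fun z => P.eval z k) ∈ AndersonModule.motiveSpace Fq n := by
  have : (fun z => P.eval z k) = ∑ i ∈ P.support, ∑ l : Fin n,
      P i k l • fun z : Fin n → CInfty Fq => z l ^ (Fintype.card Fq ^ i) := by
    ext z
    simp [eval_apply, Matrix.mulVec, dotProduct, frob_apply]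
  rw [this]
  exact Submodule.sum_mem _ fun i _ => Submodule.sum_mem _ fun l _ =>
    Submodule.smul_mem _ _ (Submodule.subset_span ⟨(i, l), rfl⟩)

/-- The factorization arguments produce functions, whereas morphisms carry coefficients; this passes
from the former to the latter. -/
theorem exists_eval_eq {f : Fin m → (Fin n → CInfty Fq) → CInfty Fq}
    (hf : ∀ k, f k ∈ AndersonModule.motiveSpace Fq n) :
    ∃ P : TauPoly Fq m n, ∀ z k, P.eval z k = f k z := by
  have key (k : Fin m) (g) (hg : g ∈ AndersonModule.motiveSpace Fq n) :
      ∃ P : TauPoly Fq m n, ∀ z, P.eval z = Pi.single k (g z) := by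
    induction hg using Submodule.span_induction with
    | mem g hg =>
      obtain ⟨⟨i, l⟩, rfl⟩ := hg
      exact ⟨Finsupp.single i (Matrix.single k l 1), fun z => by
        ext k'
        by_cases h : k' = k
        · subst h; simp [eval_single, frob_apply, Matrix.mulVec, dotProduct, Matrix.single_apply]
        · simp [eval_single, Matrix.mulVec, dotProduct, h, Matrix.single_apply_of_row_ne (Ne.symm h)]⟩
    | zero => exact ⟨0, fun z => by simp⟩
    | add f g _ _ hf hg =>
      obtain ⟨P, hP⟩ := hf
      obtain ⟨Q, hQ⟩ := hg
      exact ⟨P + Q, fun z => by simp [eval_add, hP, hQ, Pi.single_add]⟩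
    | smul c f _ hf =>
      obtain ⟨P, hP⟩ := hf
      refine ⟨comp (Finsupp.single 0 (Matrix.scalar _ c)) P, fun z => ?_⟩
      rw [eval_comp, eval_single, hP, frob_zero]
      ext k'
      by_cases h : k' = k
      · subst h; simp
      · simp [h]
  choose P hP using fun k => key k (f k) (hf k)
  refine ⟨∑ k, P k, fun z k => ?_⟩
  simp [eval_finsetSum, hP]

theorem norm_frob_le (i : ℕ) (z : Fin n → CInfty Fq) :
    ‖frob Fq i z‖ ≤ ‖z‖ ^ (Fintype.card Fq ^ i) := by
  refine (pi_norm_le_iff_of_nonneg (by positivity)).2 fun k => ?_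
  rw [frob_apply, norm_pow]
  gcongr
  exact norm_le_pi_norm z k

theorem exists_norm_mulVec_le (A : Matrix (Fin m) (Fin n) (CInfty Fq)) :
    ∃ K : ℝ, 0 ≤ K ∧ ∀ z, ‖A *ᵥ z‖ ≤ K * ‖z‖ := by
  refine ⟨∑ k, ∑ l, ‖A k l‖, Finset.sum_nonneg fun _ _ => Finset.sum_nonneg fun _ _ => norm_nonneg _, fun z => ?_⟩
  refine (pi_norm_le_iff_of_nonneg (mul_nonneg (Finset.sum_nonneg fun _ _ =>
    Finset.sum_nonneg fun _ _ => norm_nonneg _) (norm_nonneg z))).2 fun k => ?_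
  calc ‖(A *ᵥ z) k‖ ≤ ∑ l, ‖A k l‖ * ‖z‖ := by
        change ‖∑ l, A k l * z l‖ ≤ _
        refine norm_sum_le_of_le Finset.univ fun l _ => ?_
        rw [norm_mul]
        gcongr
        exact norm_le_pi_norm z l
    _ = (∑ l, ‖A k l‖) * ‖z‖ := by rw [Finset.sum_mul]
    _ ≤ _ := by
        gcongr
        exact Finset.single_le_sum (f := fun k => ∑ l, ‖A k l‖)
          (fun _ _ => by positivity) (Finset.mem_univ k)

theorem pow_card_pow_le_sq {x : ℝ} (hx : 0 ≤ x) (hx1 : x ≤ 1) {i : ℕ} (hi : i ≠ 0) :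
    x ^ (Fintype.card Fq ^ i) ≤ x ^ 2 := by
  refine pow_le_pow_of_le_one hx hx1 ?_
  have := one_lt_card_nat (Fq := Fq)
  exact le_trans (by omega) (Nat.le_self_pow hi (Fintype.card Fq))

/-- Every term with i ≥ 1 has degree q^i ≥ 2, hence is quadratically small on the unit ball. -/
theorem exists_norm_eval_sub_le (P : TauPoly Fq m n) :
    ∃ K : ℝ, 0 ≤ K ∧ ∀ z, ‖z‖ ≤ 1 → ‖P.eval z - P 0 *ᵥ z‖ ≤ K * ‖z‖ ^ 2 := by
  induction P using Finsupp.induction_linear with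
  | zero => exact ⟨0, le_rfl, by simp⟩
  | add P Q hP hQ =>
    obtain ⟨K, hK, h⟩ := hP
    obtain ⟨K', hK', h'⟩ := hQ
    refine ⟨K + K', by positivity, fun z hz => ?_⟩
    rw [eval_add, Finsupp.add_apply, Matrix.add_mulVec, LinearMap.add_apply, add_sub_add_comm,
      add_mul]
    exact norm_add_le_of_le (h z hz) (h' z hz)
  | single i A =>
    by_cases hi : i = 0
    · subst hi
      exact ⟨0, le_rfl, fun z _ => by simp [eval_single]⟩
    · obtain ⟨K, hK, h⟩ := exists_norm_mulVec_le (Fq := Fq) A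
      refine ⟨K, hK, fun z hz => ?_⟩
      rw [Finsupp.single_eq_of_ne (Ne.symm hi), Matrix.zero_mulVec, sub_zero, eval_single]
      refine (h _).trans ?_
      gcongr
      exact (norm_frob_le i z).trans (pow_card_pow_le_sq (Fq := Fq) (norm_nonneg z) hz hi)

end TauPoly

/-- An element of `C_∞` that can be used to scale vectors towards `0`. -/
theorem tendsto_theta_inv_pow : Filter.Tendsto (fun k : ℕ => ‖theta Fq‖⁻¹ ^ k) Filter.atTop
    (nhds 0) :=
  tendsto_pow_atTop_nhds_zero_of_lt_one (by positivity)
    (inv_lt_one_of_one_lt₀ (one_lt_norm_theta Fq))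

theorem theta_ne_zero : theta Fq ≠ 0 := by
  rw [← norm_pos_iff]
  exact one_pos.trans (one_lt_norm_theta Fq)

variable {m n : ℕ}

/-- Scale z by θ^{-k}: the left side shrinks linearly and the right side quadratically. -/
theorem mulVec_eq_zero_of_norm_le_sq {D : Matrix (Fin m) (Fin n) (CInfty Fq)} {K : ℝ}
    (h : ∀ z, ‖z‖ ≤ 1 → ‖D *ᵥ z‖ ≤ K * ‖z‖ ^ 2) (z : Fin n → CInfty Fq) : D *ᵥ z = 0 := by
  have hth := one_lt_norm_theta Fq
  have h1 : Filter.Tendsto (fun k : ℕ => ‖theta Fq‖⁻¹ ^ k * (K * ‖z‖ ^ 2)) Filter.atTop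
      (nhds 0) := by
    simpa using tendsto_theta_inv_pow.mul_const (K * ‖z‖ ^ 2)
  have h2 : ∀ᶠ k : ℕ in Filter.atTop, ‖theta Fq‖⁻¹ ^ k * ‖z‖ ≤ 1 := by
    have : Filter.Tendsto (fun k : ℕ => ‖theta Fq‖⁻¹ ^ k * ‖z‖) Filter.atTop (nhds 0) := by
      simpa using (tendsto_theta_inv_pow (Fq := Fq)).mul_const ‖z‖
    exact (this.eventually (gt_mem_nhds one_pos)).mono fun _ h => h.le
  have h3 : ‖D *ᵥ z‖ ≤ 0 := by
    refine ge_of_tendsto h1 (h2.mono fun k hk => ?_)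
    have h4 := h ((theta Fq)⁻¹ ^ k • z) (by rwa [norm_smul, norm_pow, norm_inv])
    rw [Matrix.mulVec_smul, norm_smul, norm_smul, norm_pow, norm_inv, mul_pow] at h4
    have h5 : 0 < ‖theta Fq‖⁻¹ ^ k := by positivity
    refine le_of_mul_le_mul_left (h4.trans_eq ?_) h5
    ring
  exact norm_le_zero_iff.1 h3

/-- The constant coefficient is the derivative at 0, so it can be read off from the map on points.
This makes the differential independent of the chosen coefficients. -/
theorem TauPoly.apply_zero_eq_of_eval_eq {P Q : TauPoly Fq m n} (h : ∀ z, P.eval z = Q.eval z) :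
    P 0 = Q 0 := by
  obtain ⟨K, -, hP⟩ := P.exists_norm_eval_sub_le
  obtain ⟨K', -, hQ⟩ := Q.exists_norm_eval_sub_le
  have h1 (z) : (P 0 - Q 0) *ᵥ z = 0 := by
    refine mulVec_eq_zero_of_norm_le_sq (K := K + K') (fun z hz => ?_) z
    have : (P 0 - Q 0) *ᵥ z = (Q.eval z - Q 0 *ᵥ z) - (P.eval z - P 0 *ᵥ z) := by
      rw [h, Matrix.sub_mulVec]; abel
    rw [this, add_mul, add_comm]
    exact norm_sub_le_of_le (hQ z hz) (hP z hz)
  rw [← sub_eq_zero]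
  ext i j
  simpa using congrFun (h1 (Pi.single j 1)) i

end TauPoly
end AndersonHecke
end

noncomputable section
namespace AndersonHecke

set_option linter.unusedSectionVars false

/-! ### Additive polynomials in one variable -/

section AdditivePolynomials

variable (Fq : Type*) [Field Fq] [Fintype Fq] {K : Type*} [Field K] [Algebra Fq K]

local notation "q" => Fintype.card Fq

theorem add_pow_card' {R : Type*} [CommRing R] [Algebra Fq R] (x y : R) :
    (x + y) ^ q = x ^ q + y ^ q := by
  simpa [FiniteField.coe_frobeniusAlgHom] using map_add (FiniteField.frobeniusAlgHom Fq R) x y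

theorem add_pow_card_pow' {R : Type*} [CommRing R] [Algebra Fq R] (x y : R) (i : ℕ) :
    (x + y) ^ (q ^ i) = x ^ (q ^ i) + y ^ (q ^ i) := by
  induction i with
  | zero => simp
  | succ i ih => rw [pow_succ, pow_mul, ih, add_pow_card', pow_mul, pow_mul]

theorem pow_card_mem_of_mem_span {R : Type*} [CommRing R] [Algebra Fq R] [Algebra K R]
    {G : Set R} {W : Submodule K R} (hG : ∀ g ∈ G, g ^ q ∈ W) {v : R}
    (hv : v ∈ Submodule.span K G) : v ^ q ∈ W := by
  induction hv using Submodule.span_induction with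
  | mem x hx => exact hG x hx
  | zero => rw [zero_pow Fintype.card_ne_zero]; exact zero_mem W
  | add x y _ _ hx hy => rw [add_pow_card']; exact add_mem hx hy
  | smul c x _ hx => rw [_root_.smul_pow]; exact W.smul_mem _ hx

variable (K) in
/-- Additive polynomials over `K` of `τ`-degree less than `m`. -/
def additivePolyLT (m : ℕ) : Submodule K K[X] :=
  Submodule.span K ((fun i : ℕ => (X : K[X]) ^ (q ^ i)) '' Set.Iio m)

variable (K) in
/-- Additive polynomials over `K`. -/
def additivePoly : Submodule K K[X] :=
  Submodule.span K (Set.range fun i : ℕ => (X : K[X]) ^ (q ^ i))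

variable {Fq}

theorem additivePolyLT_le (m : ℕ) : additivePolyLT Fq K m ≤ additivePoly Fq K :=
  Submodule.span_mono (Set.image_subset_range _ _)

theorem additivePolyLT_mono {m m' : ℕ} (h : m ≤ m') :
    additivePolyLT Fq K m ≤ additivePolyLT Fq K m' :=
  Submodule.span_mono (Set.image_mono (Set.Iio_subset_Iio h))

theorem X_pow_mem_additivePolyLT {i m : ℕ} (h : i < m) :
    (X : K[X]) ^ (q ^ i) ∈ additivePolyLT Fq K m :=
  Submodule.subset_span ⟨i, h, rfl⟩

theorem X_pow_mem_additivePoly (i : ℕ) : (X : K[X]) ^ (q ^ i) ∈ additivePoly Fq K :=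
  Submodule.subset_span ⟨i, rfl⟩

theorem exists_mem_additivePolyLT {p : K[X]} (hp : p ∈ additivePoly Fq K) :
    ∃ m, p ∈ additivePolyLT Fq K m := by
  induction hp using Submodule.span_induction with
  | mem x hx =>
    obtain ⟨i, rfl⟩ := hx
    exact ⟨i + 1, X_pow_mem_additivePolyLT (Nat.lt_succ_self i)⟩
  | zero => exact ⟨0, zero_mem _⟩
  | add x y _ _ hx hy =>
    obtain ⟨m, hm⟩ := hx
    obtain ⟨m', hm'⟩ := hy
    exact ⟨max m m', add_mem (additivePolyLT_mono (le_max_left _ _) hm)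
      (additivePolyLT_mono (le_max_right _ _) hm')⟩
  | smul c x _ hx =>
    obtain ⟨m, hm⟩ := hx
    exact ⟨m, Submodule.smul_mem _ _ hm⟩

theorem pow_card_mem_additivePolyLT {m : ℕ} {p : K[X]} (hp : p ∈ additivePolyLT Fq K m) :
    p ^ q ∈ additivePolyLT Fq K (m + 1) := by
  refine pow_card_mem_of_mem_span Fq ?_ hp
  rintro _ ⟨i, hi, rfl⟩
  rw [← pow_mul, ← pow_succ]
  exact X_pow_mem_additivePolyLT (Nat.succ_lt_succ hi)

theorem pow_card_mem_additivePoly {p : K[X]} (hp : p ∈ additivePoly Fq K) :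
    p ^ q ∈ additivePoly Fq K := by
  obtain ⟨m, hm⟩ := exists_mem_additivePolyLT hp
  exact additivePolyLT_le _ (pow_card_mem_additivePolyLT hm)

theorem mem_additivePolyLT_succ {m : ℕ} {p : K[X]} (hp : p ∈ additivePolyLT Fq K (m + 1)) :
    ∃ c : K, ∃ r ∈ additivePolyLT Fq K m, p = c • X ^ (q ^ m) + r := by
  rw [additivePolyLT, show Set.Iio (m + 1) = insert m (Set.Iio m) by ext; simp,
    Set.image_insert_eq, Submodule.mem_span_insert] at hp
  exact hp

theorem exists_eq_smul_monic {m : ℕ} {p : K[X]} (hp : p ∈ additivePolyLT Fq K m) (h0 : p ≠ 0) :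
    ∃ k < m, ∃ c : K, c ≠ 0 ∧ ∃ r ∈ additivePolyLT Fq K k, p = c • (X ^ (q ^ k) + r) := by
  induction m generalizing p with
  | zero => simp [additivePolyLT] at hp; exact absurd hp h0
  | succ m ih =>
    obtain ⟨c, r, hr, rfl⟩ := mem_additivePolyLT_succ hp
    by_cases hc : c = 0
    · subst hc
      rw [zero_smul, zero_add] at h0
      rw [zero_smul, zero_add]
      obtain ⟨k, hk, h⟩ := ih hr h0
      exact ⟨k, by omega, h⟩
    · refine ⟨m, Nat.lt_succ_self m, c, hc, c⁻¹ • r, Submodule.smul_mem _ _ hr, ?_⟩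
      rw [smul_add, smul_inv_smul₀ hc]

theorem degree_lt_of_mem_additivePolyLT {m : ℕ} {p : K[X]} (hp : p ∈ additivePolyLT Fq K m) :
    p.degree < (q ^ m : ℕ) := by
  rw [← mem_degreeLT]
  refine Submodule.span_le.2 ?_ hp
  rintro _ ⟨i, hi, rfl⟩
  rw [SetLike.mem_coe, mem_degreeLT, degree_X_pow]
  exact_mod_cast Nat.pow_lt_pow_right Fintype.one_lt_card hi

theorem cast_card_eq_zero : (q : K) = 0 := by
  rw [← map_natCast (algebraMap Fq K), Nat.cast_card_eq_zero, map_zero]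

/-- As q = 0 in K, only the term X survives differentiation. An additive polynomial with nonzero
linear coefficient is therefore separable. -/
theorem derivative_eq_of_mem_additivePoly {p : K[X]} (hp : p ∈ additivePoly Fq K) :
    derivative p = C (p.coeff 1) := by
  induction hp using Submodule.span_induction with
  | mem x hx =>
    obtain ⟨i, rfl⟩ := hx
    rcases i with _ | i
    · simp
    · have h1 : 1 ≠ q ^ (i + 1) := by
        have := Nat.one_lt_pow (Nat.succ_ne_zero i) (Fintype.one_lt_card (α := Fq))
        exact this.ne
      rw [coeff_X_pow, if_neg h1, derivative_X_pow, Nat.cast_pow,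
        cast_card_eq_zero (Fq := Fq) (K := K)]
      simp
  | zero => simp
  | add x y _ _ hx hy => simp [hx, hy]
  | smul c x _ hx => simp [hx, smul_eq_C_mul]

theorem coeff_one_pow_card {p : K[X]} (hp : p ∈ additivePoly Fq K) : (p ^ q).coeff 1 = 0 := by
  have h := derivative_eq_of_mem_additivePoly (pow_card_mem_additivePoly hp)
  rw [derivative_pow, cast_card_eq_zero (Fq := Fq) (K := K)] at h
  simpa using h.symm

section Monic

variable {m : ℕ} {r : K[X]} (hr : r ∈ additivePolyLT Fq K m)
include hr

theorem degree_X_pow_add_of_mem : (X ^ (q ^ m) + r : K[X]).degree = (q ^ m : ℕ) := by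
  rw [degree_add_eq_left_of_degree_lt, degree_X_pow]
  rw [degree_X_pow]
  exact degree_lt_of_mem_additivePolyLT hr

theorem X_pow_add_mem : X ^ (q ^ m) + r ∈ additivePoly Fq K :=
  add_mem (X_pow_mem_additivePoly _) (additivePolyLT_le _ hr)

theorem exists_eval_eq_of_monic [IsAlgClosed K] (c : K) : ∃ x, (X ^ (q ^ m) + r).eval x = c := by
  obtain ⟨x, hx⟩ := IsAlgClosed.exists_root (X ^ (q ^ m) + r - C c) (by
    rw [degree_sub_C, degree_X_pow_add_of_mem hr]
    · exact_mod_cast (Nat.pos_of_ne_zero (by simp)).ne'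
    · rw [degree_X_pow_add_of_mem hr]
      exact_mod_cast (Nat.pos_of_ne_zero (by simp)))
  exact ⟨x, by simpa [sub_eq_zero] using hx⟩

/-- Separability gives the monic polynomial q^m distinct roots, more than a nonzero polynomial of
degree below q^m can have. -/
theorem eq_zero_of_forall_root [IsAlgClosed K] (h1 : (X ^ (q ^ m) + r).coeff 1 ≠ 0) {f : K[X]}
    (hf : f ∈ additivePolyLT Fq K m)
    (h : ∀ x, (X ^ (q ^ m) + r).eval x = 0 → f.eval x = 0) : f = 0 := by
  classical
  set d := X ^ (q ^ m) + r with hd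
  have hdeg : d.degree = (q ^ m : ℕ) := degree_X_pow_add_of_mem hr
  have hsep : d.Separable := by
    rw [Polynomial.Separable, derivative_eq_of_mem_additivePoly (X_pow_add_mem hr)]
    exact ⟨0, C (d.coeff 1)⁻¹, by rw [zero_mul, zero_add, ← C_mul, inv_mul_cancel₀ h1, C_1]⟩
  have hcard : d.roots.toFinset.card = q ^ m := by
    rw [Multiset.toFinset_card_of_nodup (nodup_roots hsep),
      ← (IsAlgClosed.splits d).natDegree_eq_card_roots, natDegree_eq_of_degree_eq_some hdeg]
  refine eq_zero_of_degree_lt_of_eval_finset_eq_zero d.roots.toFinset ?_ fun x hx => ?_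
  · rw [hcard]
    exact degree_lt_of_mem_additivePolyLT hf
  · exact h x (by simpa using (mem_roots'.1 (Multiset.mem_toFinset.1 hx)).2)

/-- Division with remainder of additive polynomials. -/
theorem exists_mem_span_sub_mem {f : K[X]} (hf : f ∈ additivePoly Fq K) :
    ∃ g ∈ Submodule.span K (Set.range fun k : ℕ => (X ^ (q ^ m) + r : K[X]) ^ (q ^ k)),
      f - g ∈ additivePolyLT Fq K m := by
  set D := Submodule.span K (Set.range fun k : ℕ => (X ^ (q ^ m) + r : K[X]) ^ (q ^ k))
  have hd : X ^ (q ^ m) + r ∈ D := Submodule.subset_span ⟨0, by simp⟩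
  have hD {g : K[X]} (hg : g ∈ D) : g ^ q ∈ D := by
    refine pow_card_mem_of_mem_span Fq ?_ hg
    rintro _ ⟨k, rfl⟩
    exact Submodule.subset_span ⟨k + 1, by simp only; rw [pow_succ, pow_mul]⟩
  -- One division step: trade the top term c X^{q^m} for c times the divisor minus c r.
  have hle : additivePolyLT Fq K (m + 1) ≤ D ⊔ additivePolyLT Fq K m := by
    intro p hp
    obtain ⟨c, s, hs, rfl⟩ := mem_additivePolyLT_succ hp
    refine Submodule.mem_sup.2 ⟨c • (X ^ (q ^ m) + r), D.smul_mem c hd, s - c • r,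
      sub_mem hs (Submodule.smul_mem _ _ hr), ?_⟩
    rw [smul_add]; abel
  -- Raising to the q-th power keeps the multiples of the divisor and raises the τ-degree of the
  -- remainder by at most one, so a single division step repairs it.
  have hX (i : ℕ) : (X : K[X]) ^ (q ^ i) ∈ D ⊔ additivePolyLT Fq K m := by
    induction i with
    | zero =>
      exact hle (X_pow_mem_additivePolyLT (Nat.succ_pos m))
    | succ i ih =>
      obtain ⟨g, hg, s, hs, h⟩ := Submodule.mem_sup.1 ih
      rw [pow_succ, pow_mul, ← h, add_pow_card']
      exact add_mem (Submodule.mem_sup_left (hD hg)) (hle (pow_card_mem_additivePolyLT hs))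
  have : f ∈ D ⊔ additivePolyLT Fq K m := by
    refine Submodule.span_le.2 ?_ hf
    rintro _ ⟨i, rfl⟩
    exact hX i
  obtain ⟨g, hg, s, hs, rfl⟩ := Submodule.mem_sup.1 this
  exact ⟨g, hg, by simpa using hs⟩

end Monic

end AdditivePolynomials

/-! ### A Nullstellensatz for additive polynomials in several variables -/

section Nullstellensatz

variable (Fq : Type*) [Field Fq] [Fintype Fq] (K : Type*) [Field K] [Algebra Fq K]
  {ι : Type*} [DecidableEq ι]

local notation "q" => Fintype.card Fq

/-- The monomial functions `z ↦ z_k^{q^i}` with `k ∈ s` and `i ≥ i₀`, and their span. -/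
def additiveFun (s : Finset ι) (i₀ : ℕ) : Submodule K ((ι → K) → K) :=
  Submodule.span K {f | ∃ k ∈ s, ∃ i ≥ i₀, f = fun z => z k ^ (q ^ i)}

variable {Fq K}

theorem mem_additiveFun {s : Finset ι} {i₀ i : ℕ} {k : ι} (hk : k ∈ s) (hi : i₀ ≤ i) :
    (fun z : ι → K => z k ^ (q ^ i)) ∈ additiveFun Fq K s i₀ :=
  Submodule.subset_span ⟨k, hk, i, hi, rfl⟩

theorem additiveFun_anti (s : Finset ι) {i₀ i₁ : ℕ} (h : i₀ ≤ i₁) :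
    additiveFun Fq K s i₁ ≤ additiveFun Fq K s i₀ := by
  refine Submodule.span_mono ?_
  rintro _ ⟨k, hk, i, hi, rfl⟩
  exact ⟨k, hk, i, h.trans hi, rfl⟩

theorem pow_card_mem_additiveFun {s : Finset ι} {i₀ : ℕ} {f : (ι → K) → K}
    (hf : f ∈ additiveFun Fq K s i₀) : f ^ q ∈ additiveFun Fq K s (i₀ + 1) := by
  refine pow_card_mem_of_mem_span Fq ?_ hf
  rintro _ ⟨k, hk, i, hi, rfl⟩
  have : (fun z : ι → K => z k ^ (q ^ i)) ^ q = fun z => z k ^ (q ^ (i + 1)) := by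
    ext z
    simp [pow_succ, pow_mul]
  rw [this]
  exact mem_additiveFun hk (Nat.succ_le_succ hi)

theorem additiveFun_congr {s : Finset ι} {i₀ : ℕ} {f : (ι → K) → K}
    (hf : f ∈ additiveFun Fq K s i₀) {z z' : ι → K} (h : ∀ k ∈ s, z k = z' k) : f z = f z' := by
  induction hf using Submodule.span_induction with
  | mem f hf =>
    obtain ⟨k, hk, i, -, rfl⟩ := hf
    simp [h k hk]
  | zero => rfl
  | add f g _ _ hf hg => simp [hf, hg]
  | smul c f _ hf => simp [hf]

theorem additiveFun_apply_eq_zero {s : Finset ι} {i₀ : ℕ} {f : (ι → K) → K}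
    (hf : f ∈ additiveFun Fq K s i₀) {z : ι → K} (h : ∀ k ∈ s, z k = 0) : f z = 0 := by
  rw [additiveFun_congr hf (z' := 0) (by simpa using h)]
  induction hf using Submodule.span_induction with
  | mem f hf =>
    obtain ⟨k, hk, i, -, rfl⟩ := hf
    simp
  | zero => rfl
  | add f g _ _ hf hg => simp [hf, hg]
  | smul c f _ hf => simp [hf]

variable (K) in
/-- A polynomial in the coordinate `a`, as a function. -/
def coordEval (a : ι) : K[X] →ₗ[K] ((ι → K) → K) where
  toFun p := fun z => p.eval (z a)
  map_add' p p' := by ext; simp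
  map_smul' c p := by ext; simp

omit [DecidableEq ι] in
theorem coordEval_apply (a : ι) (p : K[X]) (z : ι → K) : coordEval K a p z = p.eval (z a) := rfl

omit [DecidableEq ι] in
theorem coordEval_pow (a : ι) (p : K[X]) (k : ℕ) :
    coordEval K a (p ^ k) = coordEval K a p ^ k := by
  ext z; simp [coordEval_apply]

/-- Separating the coordinate a prepares the elimination below. The clause on the linear coefficient
lets the tangent condition pass to the part in that coordinate. -/
theorem exists_coordEval_add {a : ι} {s : Finset ι} {i₀ : ℕ} {f : (ι → K) → K}
    (hf : f ∈ additiveFun Fq K (insert a s) i₀) :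
    ∃ p ∈ additivePoly Fq K, (1 ≤ i₀ → p.coeff 1 = 0) ∧ ∃ h ∈ additiveFun Fq K s i₀,
      f = coordEval K a p + h := by
  induction hf using Submodule.span_induction with
  | mem f hf =>
    obtain ⟨k, hk, i, hi, rfl⟩ := hf
    rcases Finset.mem_insert.1 hk with rfl | hk
    · refine ⟨X ^ (q ^ i), X_pow_mem_additivePoly _, fun h => ?_, 0, zero_mem _, ?_⟩
      · have := Nat.one_lt_pow (show i ≠ 0 by omega) (Fintype.one_lt_card (α := Fq))
        rw [coeff_X_pow, if_neg this.ne]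
      · ext z; simp [coordEval_apply]
    · exact ⟨0, zero_mem _, by simp, _, mem_additiveFun hk hi, by simp⟩
  | zero => exact ⟨0, zero_mem _, by simp, 0, zero_mem _, by simp⟩
  | add f g _ _ hf hg =>
    obtain ⟨p, hp, hp1, h, hh, rfl⟩ := hf
    obtain ⟨p', hp', hp1', h', hh', rfl⟩ := hg
    refine ⟨p + p', add_mem hp hp', fun hi => ?_, h + h', add_mem hh hh', ?_⟩
    · rw [coeff_add, hp1 hi, hp1' hi, add_zero]
    · rw [map_add]; abel
  | smul c f _ hf =>
    obtain ⟨p, hp, hp1, h, hh, rfl⟩ := hf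
    refine ⟨c • p, Submodule.smul_mem _ _ hp, fun hi => ?_, c • h, Submodule.smul_mem _ _ hh, ?_⟩
    · rw [coeff_smul, hp1 hi, smul_zero]
    · rw [map_smul, smul_add]

/-- A Nullstellensatz for `F_q`-linear polynomials: a Frobenius-stable space of such polynomials
that contains every linear form up to higher terms contains all those vanishing on its zeros. -/
theorem mem_of_vanishes [IsAlgClosed K] (s : Finset ι) (S : Submodule K ((ι → K) → K))
    (hS : S ≤ additiveFun Fq K s 0) (hSq : ∀ f ∈ S, f ^ q ∈ S)
    (hlie : ∀ k ∈ s, ∃ f ∈ S, (f - fun z => z k) ∈ additiveFun Fq K s 1)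
    {f : (ι → K) → K} (hf : f ∈ additiveFun Fq K s 0)
    (hzero : ∀ z, (∀ g ∈ S, g z = 0) → f z = 0) : f ∈ S := by
  induction s using Finset.induction generalizing S f with
  | empty =>
    have : f = 0 := by simpa [additiveFun] using hf
    rw [this]
    exact zero_mem S
  | insert a s ha ih =>
    -- The elimination module: the parts in the coordinate a of elements of S.
    let J : Submodule K K[X] :=
      { carrier := {p | p ∈ additivePoly Fq K ∧ ∃ h ∈ additiveFun Fq K s 0,
          coordEval K a p + h ∈ S}
        zero_mem' := ⟨zero_mem _, 0, zero_mem _, by simp⟩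
        add_mem' := by
          rintro p p' ⟨hp, h, hh, hS⟩ ⟨hp', h', hh', hS'⟩
          refine ⟨add_mem hp hp', h + h', add_mem hh hh', ?_⟩
          rw [map_add, add_add_add_comm]
          exact add_mem hS hS'
        smul_mem' := by
          rintro c p ⟨hp, h, hh, hS⟩
          refine ⟨Submodule.smul_mem _ _ hp, c • h, Submodule.smul_mem _ _ hh, ?_⟩
          rw [map_smul, ← smul_add]
          exact S.smul_mem c hS }
    have hdecomp {u : (ι → K) → K} (hu : u ∈ S) : ∃ p ∈ J, ∃ h ∈ additiveFun Fq K s 0,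
        u = coordEval K a p + h := by
      obtain ⟨p, hp, -, h, hh, rfl⟩ := exists_coordEval_add (hS hu)
      exact ⟨p, ⟨hp, h, hh, hu⟩, h, hh, rfl⟩
    obtain ⟨p₁, hp₁J, hp₁⟩ : ∃ p ∈ J, p.coeff 1 = 1 := by
      obtain ⟨u, hu, hu'⟩ := hlie a (Finset.mem_insert_self a s)
      obtain ⟨p, hp, hp1, h, hh, heq⟩ := exists_coordEval_add hu'
      have hX : (X : K[X]) ∈ additivePoly Fq K := by
        simpa using X_pow_mem_additivePoly (Fq := Fq) (K := K) 0
      refine ⟨X + p, ⟨add_mem hX hp, h, additiveFun_anti s zero_le_one hh, ?_⟩, ?_⟩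
      · have : coordEval K a (X + p) + h = u := by
          rw [map_add, add_assoc, ← heq]
          ext z; simp [coordEval_apply]
        rwa [this]
      · rw [coeff_add, hp1 le_rfl]; simp
    have hex {M : ℕ} {p : K[X]} (hp : p ∈ additivePolyLT Fq K M) (hpJ : p ∈ J) (h0 : p ≠ 0) :
        ∃ k < M, ∃ r ∈ additivePolyLT Fq K k, X ^ (q ^ k) + r ∈ J := by
      obtain ⟨k, hk, c, hc, r, hr, rfl⟩ := exists_eq_smul_monic hp h0
      exact ⟨k, hk, r, hr, (Submodule.smul_mem_iff _ hc).1 hpJ⟩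
    have hex' : ∃ k, ∃ r ∈ additivePolyLT Fq K k, X ^ (q ^ k) + r ∈ J := by
      obtain ⟨M, hM⟩ := exists_mem_additivePolyLT hp₁J.1
      obtain ⟨k, -, h⟩ := hex hM hp₁J (by rintro rfl; simp at hp₁)
      exact ⟨k, h⟩
    classical
    -- A monic d in J of least τ-degree; by division it generates J under Frobenius powers and
    -- K-combinations.
    obtain ⟨m, ⟨r, hr, hdJ⟩, hmin⟩ : ∃ m, (∃ r ∈ additivePolyLT Fq K m, X ^ (q ^ m) + r ∈ J) ∧
        ∀ k < m, ¬ ∃ r ∈ additivePolyLT Fq K k, X ^ (q ^ k) + r ∈ J :=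
      ⟨Nat.find hex', Nat.find_spec hex', fun k hk => Nat.find_min hex' hk⟩
    have hJm {p : K[X]} (hp : p ∈ additivePolyLT Fq K m) (hpJ : p ∈ J) : p = 0 := by
      by_contra h0
      obtain ⟨k, hk, h⟩ := hex hp hpJ h0
      exact hmin k hk h
    set d : K[X] := X ^ (q ^ m) + r with hd
    obtain ⟨hdA, h₁, hh₁, hs₁⟩ := hdJ
    set s₁ := coordEval K a d + h₁ with hs₁def
    have hs₁pow (k : ℕ) : s₁ ^ (q ^ k) ∈ S := by
      induction k with
      | zero => simpa using hs₁
      | succ k ihk => rw [pow_succ, pow_mul]; exact hSq _ ihk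
    have hh₁pow (k : ℕ) : h₁ ^ (q ^ k) ∈ additiveFun Fq K s k := by
      induction k with
      | zero => simpa using hh₁
      | succ k ihk => rw [pow_succ, pow_mul]; exact pow_card_mem_additiveFun ihk
    have hs₁eq (k : ℕ) : s₁ ^ (q ^ k) - coordEval K a (d ^ (q ^ k)) = h₁ ^ (q ^ k) := by
      rw [hs₁def, add_pow_card_pow', coordEval_pow, add_sub_cancel_left]
    -- every element of the span of the powers of `d` lifts to the span of the powers of `s₁`
    have hlift (k₀ : ℕ) {p : K[X]}
        (hp : p ∈ Submodule.span K ((fun k : ℕ => d ^ (q ^ k)) '' Set.Ici k₀)) :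
        ∃ t ∈ S, t - coordEval K a p ∈ additiveFun Fq K s k₀ ∧ ∀ z, s₁ z = 0 → t z = 0 := by
      induction hp using Submodule.span_induction with
      | mem p hp =>
        obtain ⟨k, hk, rfl⟩ := hp
        refine ⟨_, hs₁pow k, ?_, fun z hz => by simp [hz]⟩
        rw [hs₁eq]
        exact additiveFun_anti s hk (hh₁pow k)
      | zero => exact ⟨0, zero_mem _, by simp, by simp⟩
      | add p p' _ _ hp hp' =>
        obtain ⟨t, ht, h, hz⟩ := hp
        obtain ⟨t', ht', h', hz'⟩ := hp'
        refine ⟨t + t', add_mem ht ht', ?_, fun z h => by simp [hz z h, hz' z h]⟩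
        rw [map_add, add_sub_add_comm]
        exact add_mem h h'
      | smul c p _ hp =>
        obtain ⟨t, ht, h, hz⟩ := hp
        refine ⟨c • t, S.smul_mem c ht, ?_, fun z h => by simp [hz z h]⟩
        rw [map_smul, ← smul_sub]
        exact Submodule.smul_mem _ _ h
    have hIci : (fun k : ℕ => d ^ (q ^ k)) '' Set.Ici 0 = Set.range fun k : ℕ => d ^ (q ^ k) := by
      rw [← Set.image_univ]; congr 1; ext; simp
    have hJD {p : K[X]} (hp : p ∈ J) :
        p ∈ Submodule.span K ((fun k : ℕ => d ^ (q ^ k)) '' Set.Ici 0) := by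
      obtain ⟨g, hg, hpg⟩ := exists_mem_span_sub_mem hr hp.1
      rw [← hIci] at hg
      obtain ⟨t, ht, h, -⟩ := hlift 0 hg
      have hgJ : p - g ∈ J := by
        refine J.sub_mem hp ⟨?_, t - coordEval K a g, h, by simpa using ht⟩
        have := sub_mem hp.1 (additivePolyLT_le _ hpg)
        simpa using this
      have := hJm hpg hgJ
      rw [sub_eq_zero] at this
      rwa [this]
    have hpow0 (k : ℕ) : (d ^ (q ^ (k + 1))).coeff 1 = 0 := by
      rw [pow_succ', pow_mul]
      clear_value d
      have hA (k : ℕ) : ((d ^ q) ^ (q ^ k)).coeff 1 = 0 := by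
        have hk (k : ℕ) : d ^ (q ^ k) ∈ additivePoly Fq K := by
          induction k with
          | zero => simpa using hdA
          | succ k ihk => rw [pow_succ, pow_mul]; exact pow_card_mem_additivePoly ihk
        rw [← pow_mul, mul_comm, pow_mul]
        exact coeff_one_pow_card (hk k)
      exact hA k
    have hD0 {p : K[X]} (hp : p ∈ Submodule.span K ((fun k : ℕ => d ^ (q ^ k)) '' Set.Ici 0)) :
        ∃ c : K, ∃ p' ∈ Submodule.span K ((fun k : ℕ => d ^ (q ^ k)) '' Set.Ici 1),
          p = c • d + p' ∧ p.coeff 1 = c * d.coeff 1 := by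
      have : (fun k : ℕ => d ^ (q ^ k)) '' Set.Ici 0 =
          insert d ((fun k : ℕ => d ^ (q ^ k)) '' Set.Ici 1) := by
        rw [show Set.Ici 0 = insert 0 (Set.Ici 1) by ext k; simp; omega, Set.image_insert_eq]
        simp
      rw [this] at hp
      obtain ⟨c, p', hp', rfl⟩ := Submodule.mem_span_insert.1 hp
      refine ⟨c, p', hp', rfl, ?_⟩
      have h0 : p'.coeff 1 = 0 := by
        have hle : Submodule.span K ((fun k : ℕ => d ^ (q ^ k)) '' Set.Ici 1) ≤
            LinearMap.ker (lcoeff K 1) := by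
          refine Submodule.span_le.2 ?_
          rintro _ ⟨k, hk, rfl⟩
          obtain ⟨k, rfl⟩ := Nat.exists_eq_add_of_le' (Set.mem_Ici.1 hk)
          exact hpow0 k
        exact hle hp'
      rw [coeff_add, coeff_smul, h0, add_zero, smul_eq_mul]
    -- The q-power twists of d have no linear term. If d had none either, no element of J would,
    -- contrary to p₁, which the tangent condition provides.
    have hd1 : d.coeff 1 ≠ 0 := by
      intro h0
      obtain ⟨c, -, -, -, hc⟩ := hD0 (hJD hp₁J)
      rw [hp₁, h0, mul_zero] at hc
      exact one_ne_zero hc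
    have hroot {p : K[X]} (hp : p ∈ J) {x : K} (hx : d.eval x = 0) : p.eval x = 0 := by
      have : ∀ p ∈ Submodule.span K ((fun k : ℕ => d ^ (q ^ k)) '' Set.Ici 0), p.eval x = 0 := by
        intro p hp
        induction hp using Submodule.span_induction with
        | mem p hp => obtain ⟨k, -, rfl⟩ := hp; simp [hx]
        | zero => simp
        | add p p' _ _ hp hp' => simp [hp, hp']
        | smul c p _ hp => simp [hp]
      exact this p (hJD hp)
    -- reduce `f` to a function of the remaining coordinates
    obtain ⟨p, hp, -, h, hh, rfl⟩ := exists_coordEval_add hf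
    obtain ⟨g, hg, hpg⟩ := exists_mem_span_sub_mem hr hp
    rw [← hIci] at hg
    obtain ⟨t, ht, hth, -⟩ := hlift 0 hg
    have hsub : coordEval K a p + h - t =
        coordEval K a (p - g) + (h - (t - coordEval K a g)) := by
      rw [map_sub]; abel
    have hh' : h - (t - coordEval K a g) ∈ additiveFun Fq K s 0 := sub_mem hh hth
    have hzero' (z : ι → K) (hz : ∀ g ∈ S, g z = 0) :
        (coordEval K a (p - g) + (h - (t - coordEval K a g))) z = 0 := by
      rw [← hsub, Pi.sub_apply, hzero z hz, hz t ht, sub_zero]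
    -- For a root x of d, the point with a-coordinate x and all others 0 is a zero of S. The
    -- remainder of f thus vanishes at all roots of the separable d, while its degree is too small
    -- for that.
    have hpg0 : p - g = 0 := by
      refine eq_zero_of_forall_root hr hd1 hpg fun x hx => ?_
      have hsz : ∀ k ∈ s, (Pi.single a x : ι → K) k = 0 := fun k hk => by
        have hka : k ≠ a := fun h => ha (h ▸ hk)
        simp [hka]
      have := hzero' (Pi.single a x) fun u hu => by
        obtain ⟨p', hp', h', hh', rfl⟩ := hdecomp hu
        rw [Pi.add_apply, coordEval_apply, Pi.single_eq_same, hroot hp' hx,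
          additiveFun_apply_eq_zero hh' hsz, add_zero]
      rwa [Pi.add_apply, additiveFun_apply_eq_zero hh' hsz, add_zero, coordEval_apply,
        Pi.single_eq_same] at this
    rw [hpg0, map_zero, zero_add] at hsub hzero'
    -- Induction applies to the elements of S that do not involve the coordinate a.
    have hmem : h - (t - coordEval K a g) ∈ S ⊓ additiveFun Fq K s 0 := by
      refine ih (S ⊓ additiveFun Fq K s 0) inf_le_right (fun u hu => ⟨hSq u hu.1,
        additiveFun_anti s (Nat.zero_le 1) (pow_card_mem_additiveFun hu.2)⟩) ?_ hh' ?_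
      · intro k hk
        obtain ⟨u, hu, hu'⟩ := hlie k (Finset.mem_insert_of_mem hk)
        obtain ⟨p', hp', hp1, h', hh', heq⟩ := exists_coordEval_add hu'
        have hkmem : (fun z : ι → K => z k) ∈ additiveFun Fq K s 0 := by
          simpa using mem_additiveFun (Fq := Fq) (K := K) (i₀ := 0) (i := 0) hk le_rfl
        have hu_eq : u = coordEval K a p' + (h' + fun z => z k) := by
          rw [← add_assoc, ← heq, sub_add_cancel]
        have hp'J : p' ∈ J := ⟨hp', _, add_mem (additiveFun_anti s zero_le_one hh') hkmem,
          by rwa [← hu_eq]⟩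
        -- The a-part of u has no linear term, so it is a combination of d^{q^k} with k ≥ 1. Its
        -- lift can be subtracted without changing the linear form in the other coordinates.
        obtain ⟨c, p'', hp'', hpe, hc⟩ := hD0 (hJD hp'J)
        rw [hp1 le_rfl, eq_comm, mul_eq_zero, or_iff_left hd1] at hc
        rw [hc, zero_smul, zero_add] at hpe
        rw [← hpe] at hp''
        obtain ⟨t', ht', hth', -⟩ := hlift 1 hp''
        have e1 : u - t' - (fun z => z k) = h' - (t' - coordEval K a p') := by
          rw [hu_eq]; abel
        have e2 : u - t' - (fun z => z k) ∈ additiveFun Fq K s 1 := e1 ▸ sub_mem hh' hth'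
        refine ⟨u - t', ⟨sub_mem hu ht', ?_⟩, e2⟩
        have := add_mem (additiveFun_anti s zero_le_one e2) hkmem
        rwa [sub_add_cancel] at this
      · intro z hz
        -- Extension of zeros: with d(x) = -h₁(z) the point with new a-coordinate x kills s₁. Any u
        -- in S differs from some t' killed along with s₁ by an element free of the coordinate a,
        -- which vanishes by hypothesis.
        obtain ⟨x, hx⟩ := exists_eval_eq_of_monic hr (-h₁ z)
        have hag : ∀ k ∈ s, Function.update z a x k = z k := fun k hk =>
          Function.update_of_ne (show k ≠ a from fun h => ha (h ▸ hk)) _ _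
        have hs₁z : s₁ (Function.update z a x) = 0 := by
          rw [hs₁def, Pi.add_apply, coordEval_apply, Function.update_self, hx,
            additiveFun_congr hh₁ hag, neg_add_cancel]
        rw [← additiveFun_congr hh' hag]
        refine hzero' _ fun u hu => ?_
        obtain ⟨p', hp', h', hh', rfl⟩ := hdecomp hu
        obtain ⟨t', ht', hth', htz⟩ := hlift 0 (hJD hp')
        have e1 : coordEval K a p' + h' - t' = h' - (t' - coordEval K a p') := by abel
        have e2 : coordEval K a p' + h' - t' ∈ additiveFun Fq K s 0 := e1 ▸ sub_mem hh' hth'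
        have e3 := hz _ ⟨sub_mem hu ht', e2⟩
        rw [← additiveFun_congr e2 hag, Pi.sub_apply, htz _ hs₁z, sub_zero] at e3
        exact e3
    have := add_mem (hsub ▸ hmem.1) ht
    rwa [sub_add_cancel] at this

end Nullstellensatz

end AndersonHecke
end

noncomputable section
namespace AndersonHecke

/-! ### Factorization through separable maps, and finite quotients of G_a^n -/

section Factorization

variable {Fq : Type*} [Field Fq] [Fintype Fq] {m n : ℕ}

open AndersonModule

theorem motiveSpace_eq_additiveFun :
    motiveSpace Fq n = additiveFun Fq (CInfty Fq) (Finset.univ : Finset (Fin n)) 0 := by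
  rw [motiveSpace, additiveFun]
  congr 1
  ext f
  constructor
  · rintro ⟨⟨i, k⟩, rfl⟩
    exact ⟨k, Finset.mem_univ k, i, Nat.zero_le i, rfl⟩
  · rintro ⟨k, -, i, -, rfl⟩
    exact ⟨(i, k), rfl⟩

theorem TauPoly.eval_sub_mem_additiveFun (P : TauPoly Fq m n) (k : Fin m) :
    (fun z => P.eval z k - (P 0 *ᵥ z) k) ∈
      additiveFun Fq (CInfty Fq) (Finset.univ : Finset (Fin n)) 1 := by
  induction P using Finsupp.induction_linear with
  | zero =>
    have : (fun z => eval (0 : TauPoly Fq m n) z k - ((0 : TauPoly Fq m n) 0 *ᵥ z) k) = 0 := by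
      ext z; simp
    rw [this]
    exact zero_mem _
  | add P Q hP hQ =>
    convert add_mem hP hQ using 1
    ext z
    simp only [eval_add, Finsupp.add_apply, Matrix.add_mulVec, LinearMap.add_apply, Pi.add_apply]
    ring
  | single i A =>
    by_cases hi : i = 0
    · subst hi
      have : (fun z => eval (Finsupp.single 0 A) z k - (Finsupp.single 0 A 0 *ᵥ z) k) = 0 := by
        ext z; simp [eval_single]
      rw [this]
      exact zero_mem _
    · have : (fun z => eval (Finsupp.single i A) z k - (Finsupp.single i A 0 *ᵥ z) k) =
          ∑ l, A k l • fun z : Fin n → CInfty Fq => z l ^ (Fintype.card Fq ^ i) := by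
        ext z
        rw [Finsupp.single_eq_of_ne (Ne.symm hi)]
        simp [eval_single, Matrix.mulVec, dotProduct, frob_apply]
      rw [this]
      exact Submodule.sum_mem _ fun l _ => Submodule.smul_mem _ _
        (mem_additiveFun (Finset.mem_univ l) (Nat.one_le_iff_ne_zero.2 hi))

theorem TauPoly.comp_mem_motiveSpace (ψ : TauPoly Fq m n)
    {f : (Fin m → CInfty Fq) → CInfty Fq} (hf : f ∈ motiveSpace Fq m) :
    (fun z => f (ψ.eval z)) ∈ motiveSpace Fq n := by
  obtain ⟨P, hP⟩ := TauPoly.exists_eval_eq (m := 1) (f := fun _ => f) fun _ => hf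
  convert (TauPoly.comp P ψ).eval_mem_motiveSpace 0 using 1
  ext z
  rw [eval_comp, hP]

/-- A polynomial function vanishing on the kernel of a separable map factors through that map. -/
theorem exists_motiveSpace_factor (ψ : TauPoly Fq n n) (hψ : IsUnit (ψ 0))
    {f : (Fin n → CInfty Fq) → CInfty Fq} (hf : f ∈ motiveSpace Fq n)
    (h : ∀ z, ψ.eval z = 0 → f z = 0) :
    ∃ g ∈ motiveSpace Fq n, ∀ z, f z = g (ψ.eval z) := by
  -- The functions factoring through ψ. Composing ψ with the inverse of its linear part puts every
  -- coordinate in S up to higher terms, which is the tangent condition.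
  let S := (motiveSpace Fq n).map (LinearMap.funLeft (CInfty Fq) (CInfty Fq) ψ.eval)
  have hfS : f ∈ S := by
    refine mem_of_vanishes (Fq := Fq) Finset.univ S ?_ ?_ ?_
      (by rwa [← motiveSpace_eq_additiveFun]) fun z hz => h z ?_
    · rintro _ ⟨g, hg, rfl⟩
      rw [← motiveSpace_eq_additiveFun]
      exact ψ.comp_mem_motiveSpace hg
    · rintro _ ⟨g, hg, rfl⟩
      refine ⟨g ^ Fintype.card Fq, ?_, rfl⟩
      rw [SetLike.mem_coe, motiveSpace_eq_additiveFun] at hg ⊢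
      exact additiveFun_anti _ (Nat.zero_le 1) (pow_card_mem_additiveFun hg)
    · intro k _
      let P : TauPoly Fq n n := Finsupp.single 0 (ψ 0)⁻¹
      refine ⟨fun z => P.eval (ψ.eval z) k, ⟨_, P.eval_mem_motiveSpace k, rfl⟩, ?_⟩
      convert (TauPoly.comp P ψ).eval_sub_mem_additiveFun k using 1
      ext z
      rw [TauPoly.eval_comp, TauPoly.comp_apply_zero, Finsupp.single_eq_same,
        Matrix.nonsing_inv_mul _ ((Matrix.isUnit_iff_isUnit_det _).1 hψ), Matrix.one_mulVec]
      rfl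
    · ext k
      refine hz _ ⟨fun z => z k, ?_, rfl⟩
      exact Submodule.subset_span ⟨(0, k), by simp⟩
  obtain ⟨g, hg, rfl⟩ := hfS
  exact ⟨g, hg, fun z => rfl⟩

theorem exists_tauPoly_factor (ψ : TauPoly Fq n n) (hψ : IsUnit (ψ 0)) (f : TauPoly Fq m n)
    (h : ∀ z, ψ.eval z = 0 → f.eval z = 0) :
    ∃ g : TauPoly Fq m n, ∀ z, f.eval z = g.eval (ψ.eval z) := by
  choose g hg hgf using fun k => exists_motiveSpace_factor ψ hψ (f.eval_mem_motiveSpace k)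
    fun z hz => by rw [h z hz]; rfl
  obtain ⟨P, hP⟩ := TauPoly.exists_eval_eq hg
  refine ⟨P, fun z => ?_⟩
  ext k
  rw [hP, ← hgf]

/-- X^q - X already splits over F_q with the elements of F_q as roots, so no further roots appear in
C_∞. -/
theorem exists_algebraMap_eq_of_pow_card_eq {t : CInfty Fq} (ht : t ^ Fintype.card Fq = t) :
    ∃ a : Fq, algebraMap Fq (CInfty Fq) a = t := by
  have hroots := FiniteField.roots_X_pow_card_sub_X Fq
  have hdeg := FiniteField.X_pow_card_sub_X_natDegree_eq Fq (Fintype.one_lt_card (α := Fq))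
  have hprod := prod_multiset_X_sub_C_of_monic_of_roots_card_eq
    (p := (X ^ Fintype.card Fq - X : Fq[X]))
    (monic_X_pow_sub ((degree_X_le).trans_lt (by exact_mod_cast Fintype.one_lt_card (α := Fq))))
    (by rw [hroots, hdeg]; rfl)
  rw [hroots] at hprod
  change ∏ a : Fq, (X - C a) = X ^ Fintype.card Fq - X at hprod
  have h := congrArg (fun p : Fq[X] => (p.map (algebraMap Fq (CInfty Fq))).eval t) hprod
  simp only [Polynomial.map_prod, eval_prod, Polynomial.map_sub, map_X, map_C, eval_sub, eval_X,
    eval_C, Polynomial.map_pow, eval_pow, ht, sub_self] at h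
  obtain ⟨a, -, ha⟩ := Finset.prod_eq_zero_iff.1 h
  exact ⟨a, (sub_eq_zero.1 ha).symm⟩

/-- The quotient of `G_a^n` by an `F_q`-line is again `G_a^n`. -/
theorem exists_tauPoly_ker_eq_span_singleton {u : Fin n → CInfty Fq} (hu : u ≠ 0) :
    ∃ ρ : TauPoly Fq n n, ρ 0 = 1 ∧ LinearMap.ker ρ.eval = Submodule.span Fq {u} ∧
      Function.Surjective ρ.eval := by
  obtain ⟨k, hk⟩ : ∃ k, u k ≠ 0 := Function.ne_iff.1 hu
  have huq : u k ^ Fintype.card Fq ≠ 0 := pow_ne_zero _ hk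
  -- The map is z ↦ z - (z_k/u_k)^q u. A point of the kernel is t u with t = z_k/u_k and t^q = t,
  -- that is, an F_q-multiple of u.
  let A : Matrix (Fin n) (Fin n) (CInfty Fq) :=
    Matrix.of fun i l => if l = k then - u i / u k ^ Fintype.card Fq else 0
  have hA (z) : (Finsupp.single 0 1 + Finsupp.single 1 A : TauPoly Fq n n).eval z =
      z - (z k / u k) ^ Fintype.card Fq • u := by
    rw [TauPoly.eval_add, LinearMap.add_apply, TauPoly.eval_single, TauPoly.eval_single]
    ext i
    simp [A, Matrix.mulVec, dotProduct, frob_apply]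
    rw [div_pow]
    ring
  refine ⟨Finsupp.single 0 1 + Finsupp.single 1 A, by simp, ?_, fun c => ?_⟩
  · ext z
    rw [LinearMap.mem_ker, hA, sub_eq_zero, Submodule.mem_span_singleton]
    constructor
    · intro h
      have h1 : (z k / u k) ^ Fintype.card Fq = z k / u k := by
        have := congrFun h k
        rw [Pi.smul_apply, smul_eq_mul] at this
        rw [eq_div_iff hk, ← this]
      obtain ⟨a, ha⟩ := exists_algebraMap_eq_of_pow_card_eq h1
      refine ⟨a, ?_⟩
      rw [h, h1, ← ha, algebraMap_smul]
    · rintro ⟨a, rfl⟩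
      rw [Pi.smul_apply, Algebra.smul_def (a : Fq) (u k), mul_div_cancel_right₀ _ hk, ← map_pow,
        FiniteField.pow_card, algebraMap_smul]
  · obtain ⟨t, ht⟩ := IsAlgClosed.exists_root
      (X ^ Fintype.card Fq - X + C (c k / u k) : (CInfty Fq)[X]) (by
        have h2 : (X ^ Fintype.card Fq - X + C (c k / u k) : (CInfty Fq)[X]).degree =
            (Fintype.card Fq : ℕ) := by
          rw [sub_add, degree_sub_eq_left_of_degree_lt] <;> rw [degree_X_pow]
          rw [degree_X_sub_C]
          exact_mod_cast Fintype.one_lt_card (α := Fq)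
        rw [h2]
        exact_mod_cast Fintype.card_ne_zero)
    have ht' : t ^ Fintype.card Fq + c k / u k = t := by
      simp only [IsRoot, eval_add, eval_sub, eval_pow, eval_X, eval_C] at ht
      linear_combination ht
    refine ⟨c + t ^ Fintype.card Fq • u, ?_⟩
    rw [hA]
    have h3 : (c + t ^ Fintype.card Fq • u) k / u k = t := by
      rw [Pi.add_apply, Pi.smul_apply, smul_eq_mul, add_div, mul_div_cancel_right₀ _ hk, add_comm,
        ht']
    rw [h3, add_sub_cancel_right]

/-- The quotient of `G_a^n` by a finite `F_q`-subspace is again `G_a^n`. -/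
theorem exists_tauPoly_ker_eq (W : Submodule Fq (Fin n → CInfty Fq)) [Finite W] :
    ∃ π : TauPoly Fq n n, π 0 = 1 ∧ LinearMap.ker π.eval = W ∧ Function.Surjective π.eval := by
  have key (s : Finset (Fin n → CInfty Fq)) : ∃ π : TauPoly Fq n n, π 0 = 1 ∧
      LinearMap.ker π.eval = Submodule.span Fq s ∧ Function.Surjective π.eval := by
    classical
    induction s using Finset.induction with
    | empty =>
      have h : TauPoly.eval (Finsupp.single 0 1 : TauPoly Fq n n) = LinearMap.id :=
        LinearMap.ext fun z => by simp [TauPoly.eval_single]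
      refine ⟨Finsupp.single 0 1, by simp, ?_, ?_⟩
      · rw [h]; simp
      · rw [h]; exact Function.surjective_id
    | insert w s _ ih =>
      obtain ⟨π, hπ0, hker, hsurj⟩ := ih
      by_cases hw : π.eval w = 0
      · refine ⟨π, hπ0, ?_, hsurj⟩
        rw [Finset.coe_insert, Submodule.span_insert, ← hker, eq_comm, sup_eq_right]
        rwa [Submodule.span_singleton_le_iff_mem]
      -- Dividing further by the line through π(w) enlarges the kernel to the preimage of that line,
      -- which is the old kernel plus the span of w.
      · obtain ⟨ρ, hρ0, hρker, hρsurj⟩ := exists_tauPoly_ker_eq_span_singleton hw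
        have hc : (TauPoly.comp ρ π).eval = ρ.eval ∘ₗ π.eval :=
          LinearMap.ext fun z => TauPoly.eval_comp ρ π z
        refine ⟨TauPoly.comp ρ π, ?_, ?_, ?_⟩
        · rw [TauPoly.comp_apply_zero, hρ0, hπ0, one_mul]
        · rw [hc, LinearMap.ker_comp, hρker, Finset.coe_insert, Submodule.span_insert, ← hker,
            ← Set.image_singleton, ← Submodule.map_span, Submodule.comap_map_eq]
        · rw [hc]
          exact hρsurj.comp hsurj
  have hfin : (W : Set (Fin n → CInfty Fq)).Finite := Set.toFinite _
  obtain ⟨π, h⟩ := key hfin.toFinset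
  refine ⟨π, ?_⟩
  simpa using h

end Factorization
end AndersonHecke
end

noncomputable section
namespace AndersonHecke

/-! ### The polynomial maps φ_a -/

section Action

variable {Fq : Type*} [Field Fq] [Fintype Fq] {n : ℕ}

theorem algebraMap_injective' : Function.Injective (algebraMap Fq[X] (CInfty Fq)) := by
  rw [IsScalarTower.algebraMap_eq Fq[X] (RatFunc Fq) (CInfty Fq)]
  exact (algebraMap (RatFunc Fq) (CInfty Fq)).injective.comp
    (IsFractionRing.injective Fq[X] (RatFunc Fq))

namespace AndersonModule

variable (E : AndersonModule Fq n)

theorem smul_pt (a : Fq[X]) (z : Fin n → CInfty Fq) :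
    a • E.pt z = E.pt (aeval E.T a z) :=
  (Module.AEval.of_aeval_smul _ _ _).symm

/-- Constant terms multiply under composition, so the differential of φ_a is the scalar a. This
makes φ_a separable for every a ≠ 0. -/
theorem exists_action (a : Fq[X]) : ∃ P : TauPoly Fq n n, P.eval = aeval E.T a ∧
    P 0 = Matrix.scalar (Fin n) (algebraMap Fq[X] (CInfty Fq) a) := by
  induction a using Polynomial.induction_on with
  | C c =>
    refine ⟨Finsupp.single 0 (Matrix.scalar _ (algebraMap Fq (CInfty Fq) c)),
      LinearMap.ext fun z => ?_, ?_⟩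
    · ext k
      simp [TauPoly.eval_single, Algebra.smul_def]
    · rw [Finsupp.single_eq_same, ← Polynomial.algebraMap_eq, ← IsScalarTower.algebraMap_apply]
  | add p p' hp hp' =>
    obtain ⟨P, hP, hP0⟩ := hp
    obtain ⟨P', hP', hP0'⟩ := hp'
    refine ⟨P + P', by rw [TauPoly.eval_add, hP, hP', map_add], ?_⟩
    rw [Finsupp.add_apply, hP0, hP0', map_add, map_add]
  | monomial k c h =>
    obtain ⟨P, hP, hP0⟩ := h
    refine ⟨TauPoly.comp P E.phi, LinearMap.ext fun z => ?_, ?_⟩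
    · rw [TauPoly.eval_comp, hP, pow_succ, ← mul_assoc, map_mul _ _ X, aeval_X]
      rfl
    · rw [TauPoly.comp_apply_zero, hP0, E.phi_zero, ← map_mul, pow_succ, ← mul_assoc,
        map_mul _ _ X]
      rfl

/-- `φ_a` as a polynomial map. -/
def action (a : Fq[X]) : TauPoly Fq n n := (E.exists_action a).choose

theorem eval_action (a : Fq[X]) : (E.action a).eval = aeval E.T a := (E.exists_action a).choose_spec.1

theorem action_zero (a : Fq[X]) :
    E.action a 0 = Matrix.scalar (Fin n) (algebraMap Fq[X] (CInfty Fq) a) :=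
  (E.exists_action a).choose_spec.2

theorem smul_pt' (a : Fq[X]) (z : Fin n → CInfty Fq) : a • E.pt z = E.pt ((E.action a).eval z) := by
  rw [smul_pt, eval_action]

theorem isUnit_action_zero {a : Fq[X]} (ha : a ≠ 0) : IsUnit (E.action a 0) := by
  rw [action_zero]
  exact (Ne.isUnit ((map_ne_zero_iff _ algebraMap_injective').2 ha)).map (Matrix.scalar (Fin n))

end AndersonModule

end Action

/-! ### Dimension counts for M/aM -/

section FreeModules

variable {K M : Type*} [Field K] [AddCommGroup M] [Module K[X] M] [Module K M]
  [IsScalarTower K K[X] M] [Module.Finite K[X] M] [Module.Free K[X] M]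

omit [Module K M] [IsScalarTower K K[X] M] in
/-- `M / aM` for a free `K[X]`-module `M`, as a power of `K[X]/(a)`. -/
theorem exists_quotient_equiv (a : K[X]) :
    Nonempty ((M ⧸ LinearMap.range (LinearMap.lsmul K[X] M a)) ≃ₗ[K[X]]
      (Fin (Module.finrank K[X] M) → K[X] ⧸ Ideal.span {a})) := by
  let b := Module.finBasis K[X] M
  have h : (LinearMap.range (LinearMap.lsmul K[X] M a)).map b.equivFun.toLinearMap =
      Submodule.pi Set.univ fun _ => Ideal.span {a} := by
    ext x
    simp only [Submodule.mem_map, LinearMap.mem_range, Submodule.mem_pi, Set.mem_univ,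
      forall_true_left, Ideal.mem_span_singleton]
    constructor
    · rintro ⟨_, ⟨m, rfl⟩, rfl⟩ i
      exact ⟨b.equivFun m i, by simp⟩
    · intro hx
      choose y hy using hx
      refine ⟨_, ⟨b.equivFun.symm y, rfl⟩, ?_⟩
      ext1 i
      change b.equivFun (a • b.equivFun.symm y) i = x i
      rw [map_smul, LinearEquiv.apply_symm_apply, hy]
      rfl
  exact ⟨(Submodule.Quotient.equiv _ _ b.equivFun h).trans (Submodule.quotientPi _)⟩

theorem finrank_quotient_range_lsmul {a : K[X]} (ha : a ≠ 0) :
    Module.Finite K (M ⧸ LinearMap.range (LinearMap.lsmul K[X] M a)) ∧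
    Module.finrank K (M ⧸ LinearMap.range (LinearMap.lsmul K[X] M a)) =
      Module.finrank K[X] M * a.natDegree := by
  obtain ⟨e⟩ := exists_quotient_equiv (M := M) a
  have hfin : Module.Finite K (K[X] ⧸ Ideal.span {a}) :=
    (AdjoinRoot.powerBasis ha).finite
  refine ⟨Module.Finite.equiv (e.restrictScalars K).symm, ?_⟩
  rw [(e.restrictScalars K).finrank_eq, Module.finrank_pi_fintype]
  simp [finrank_quotient_span_eq_natDegree]

/-- The map factors through M/aM, whose K-dimension is the rank times deg a. It is applied to
evaluation of functions at independent torsion points. -/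
theorem le_finrank_mul_natDegree {a : K[X]} (ha : a ≠ 0) {d : ℕ} {f : M →ₗ[K] (Fin d → K)}
    (hf : Function.Surjective f) (h : ∀ x, f (a • x) = 0) :
    d ≤ Module.finrank K[X] M * a.natDegree := by
  obtain ⟨hfin, hdim⟩ := finrank_quotient_range_lsmul (K := K) (M := M) ha
  let N := (LinearMap.range (LinearMap.lsmul K[X] M a)).restrictScalars K
  have e : (M ⧸ N) ≃ₗ[K] (M ⧸ LinearMap.range (LinearMap.lsmul K[X] M a)) :=
    Submodule.Quotient.restrictScalarsEquiv _ _
  have : Module.Finite K (M ⧸ N) := Module.Finite.equiv e.symm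
  have hN : N ≤ LinearMap.ker f := by
    rintro _ ⟨x, rfl⟩
    exact h x
  have hsurj : Function.Surjective (N.liftQ f hN) := fun c => by
    obtain ⟨x, hx⟩ := hf c
    exact ⟨Submodule.Quotient.mk x, hx⟩
  have := LinearMap.finrank_le_finrank_of_surjective hsurj
  rwa [Module.finrank_fin_fun, e.finrank_eq, hdim] at this

theorem eq_finrank_mul_natDegree {a : K[X]} (ha : a ≠ 0) {d : ℕ} {f : M →ₗ[K] (Fin d → K)}
    (hf : Function.Surjective f) (h : ∀ x, f x = 0 ↔ ∃ y, a • y = x) :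
    d = Module.finrank K[X] M * a.natDegree := by
  obtain ⟨hfin, hdim⟩ := finrank_quotient_range_lsmul (K := K) (M := M) ha
  let N := (LinearMap.range (LinearMap.lsmul K[X] M a)).restrictScalars K
  have e : (M ⧸ N) ≃ₗ[K] (M ⧸ LinearMap.range (LinearMap.lsmul K[X] M a)) :=
    Submodule.Quotient.restrictScalarsEquiv _ _
  have hN : LinearMap.ker f = N := Submodule.ext h
  have := ((Submodule.quotEquivOfEq _ _ hN).symm.trans
    (f.quotKerEquivOfSurjective hf)).finrank_eq
  rw [Module.finrank_fin_fun, e.finrank_eq, hdim] at this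
  exact this.symm

end FreeModules

/-! ### Duality between the a-torsion and M/aM -/

section Torsion

variable {Fq : Type*} [Field Fq] [Fintype Fq] {m n : ℕ}

open AndersonModule

/-- Coordinate-like polynomial functions on linearly independent points. -/
theorem exists_motiveSpace_dual {ι : Type*} [Finite ι] {v : ι → Fin n → CInfty Fq}
    (hv : LinearIndependent Fq v) (i : ι) :
    ∃ f ∈ motiveSpace Fq n, f (v i) = 1 ∧ ∀ j ≠ i, f (v j) = 0 := by
  -- Divide by the span of the other points: some coordinate of the quotient map is nonzero at v_i
  -- and zero at the rest, and is then rescaled.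
  let W := Submodule.span Fq (v '' {j | j ≠ i})
  have : Module.Finite Fq W := Module.Finite.span_of_finite Fq (Set.toFinite _)
  have : Finite W := Module.finite_of_finite Fq
  obtain ⟨π, -, hker, -⟩ := exists_tauPoly_ker_eq W
  have hi : π.eval (v i) ≠ 0 := by
    intro h
    rw [← LinearMap.mem_ker, hker] at h
    exact hv.notMem_span_image (s := {j | j ≠ i}) (by simp) h
  obtain ⟨k, hk⟩ := Function.ne_iff.1 hi
  refine ⟨(π.eval (v i) k)⁻¹ • fun z => π.eval z k,
    Submodule.smul_mem _ _ (π.eval_mem_motiveSpace k), inv_mul_cancel₀ hk, fun j hj => ?_⟩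
  have : π.eval (v j) = 0 := by
    rw [← LinearMap.mem_ker, hker]
    exact Submodule.subset_span ⟨j, hj, rfl⟩
  simp [this]

theorem motiveSpace_map_add {f : (Fin n → CInfty Fq) → CInfty Fq} (hf : f ∈ motiveSpace Fq n) :
    ∃ g : (Fin n → CInfty Fq) →ₗ[Fq] CInfty Fq, ∀ z, f z = g z := by
  obtain ⟨P, hP⟩ := TauPoly.exists_eval_eq (m := 1) (f := fun _ => f) fun _ => hf
  exact ⟨LinearMap.proj 0 ∘ₗ P.eval, fun z => (hP z 0).symm⟩

variable (E : AndersonModule Fq n)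

/-- The polynomial function underlying an element of the motive. -/
def Motive.toFun : E.Motive ≃ₗ[CInfty Fq] motiveSpace Fq n := (Module.AEval'.of _).symm

theorem Motive.toFun_smul (a : Fq[X]) (μ : E.Motive) (z : Fin n → CInfty Fq) :
    (Motive.toFun E ((a.map (algebraMap Fq (CInfty Fq))) • μ)).1 z =
      (Motive.toFun E μ).1 ((E.action a).eval z) := by
  rw [eval_action]
  induction a using Polynomial.induction_on generalizing μ with
  | C c =>
    rw [map_C, Module.AEval.C_smul, map_smul, aeval_C]
    obtain ⟨g, hg⟩ := motiveSpace_map_add (Motive.toFun E μ).2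
    rw [hg, Module.algebraMap_end_apply, map_smul, ← hg, Algebra.smul_def]
    rfl
  | add p p' hp hp' =>
    obtain ⟨g, hg⟩ := motiveSpace_map_add (Motive.toFun E μ).2
    rw [Polynomial.map_add, add_smul, map_add, map_add, LinearMap.add_apply, hg, map_add, ← hg,
      ← hg, ← hp, ← hp']
    rfl
  | monomial k c h =>
    rw [pow_succ, ← mul_assoc, Polynomial.map_mul, mul_smul, map_X, mul_comm _ X, map_mul, aeval_X,
      h, Module.End.mul_apply]
    have hX : Motive.toFun E (X • μ) = ((LinearMap.funLeft (CInfty Fq) (CInfty Fq) E.T).restrict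
        fun _ h => E.motiveSpace_comp h) (Motive.toFun E μ) := Module.AEval'.of_symm_X_smul _ _
    rw [hX]
    rfl

/-- Multiplication by a on the motive is composition with φ_a. Since φ_a is separable, vanishing on
its kernel suffices for factoring through it. -/
theorem Motive.exists_smul_eq_iff {a : Fq[X]} (ha : a ≠ 0) (μ : E.Motive) :
    (∃ ν : E.Motive, a.map (algebraMap Fq (CInfty Fq)) • ν = μ) ↔
      ∀ z, (E.action a).eval z = 0 → (Motive.toFun E μ).1 z = 0 := by
  constructor
  · rintro ⟨ν, rfl⟩ z hz
    obtain ⟨g, hg⟩ := motiveSpace_map_add (Motive.toFun E ν).2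
    rw [Motive.toFun_smul, hz, hg, map_zero]
  · intro h
    obtain ⟨g, hg, hgf⟩ := exists_motiveSpace_factor (E.action a) (E.isUnit_action_zero ha)
      (Motive.toFun E μ).2 h
    refine ⟨(Motive.toFun E).symm ⟨g, hg⟩, (Motive.toFun E).injective (Subtype.ext ?_)⟩
    ext z
    rw [Motive.toFun_smul, LinearEquiv.apply_symm_apply, hgf]

variable (Fq) in
/-- Evaluation of polynomial functions at finitely many points. -/
def evalAt {ι : Type*} (v : ι → Fin n → CInfty Fq) :
    motiveSpace Fq n →ₗ[CInfty Fq] (ι → CInfty Fq) :=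
  LinearMap.pi fun i => LinearMap.proj (v i) ∘ₗ (motiveSpace Fq n).subtype

theorem evalAt_apply {ι : Type*} (v : ι → Fin n → CInfty Fq) (f : motiveSpace Fq n) (i : ι) :
    evalAt Fq v f i = f.1 (v i) := rfl

theorem evalAt_surjective {ι : Type*} [Finite ι] {v : ι → Fin n → CInfty Fq}
    (hv : LinearIndependent Fq v) : Function.Surjective (evalAt Fq v) := by
  classical
  have := Fintype.ofFinite ι
  choose f hf hf1 hf0 using exists_motiveSpace_dual hv
  intro c
  refine ⟨∑ i, c i • ⟨f i, hf i⟩, ?_⟩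
  ext j
  rw [map_sum, Finset.sum_apply, Finset.sum_eq_single j]
  · rw [map_smul, Pi.smul_apply, evalAt_apply]
    exact (congrArg (c j * ·) (hf1 j)).trans (mul_one _)
  · intro i _ hij
    rw [map_smul, Pi.smul_apply, evalAt_apply]
    exact (congrArg _ (hf0 _ _ hij.symm)).trans (mul_zero _)
  · simp

/-- The `a`-torsion of an Anderson module of rank `r` has dimension `r deg a` over `F_q`. -/
theorem HasRank.finrank_ker_action {r : ℕ} (hr : E.HasRank r) {a : Fq[X]} (ha : a ≠ 0) :
    Module.Finite Fq (LinearMap.ker (E.action a).eval) ∧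
      Module.finrank Fq (LinearMap.ker (E.action a).eval) = r * a.natDegree := by
  have := hr.finite
  have := hr.free
  set a' := a.map (algebraMap Fq (CInfty Fq)) with ha'
  have ha0 : a' ≠ 0 := (Polynomial.map_ne_zero_iff (algebraMap Fq (CInfty Fq)).injective).2 ha
  have hmem (μ : E.Motive) : (∃ ν, a' • ν = μ) ↔
      ∀ z, (E.action a).eval z = 0 → (Motive.toFun E μ).1 z = 0 :=
    Motive.exists_smul_eq_iff E ha μ
  let ev {ι : Type} (v : ι → LinearMap.ker (E.action a).eval) :
      E.Motive →ₗ[CInfty Fq] (ι → CInfty Fq) :=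
    evalAt Fq (fun i => (v i).1) ∘ₗ (Motive.toFun E).toLinearMap
  have hev {ι : Type} [Finite ι] {v : ι → LinearMap.ker (E.action a).eval}
      (hv : LinearIndependent Fq v) : Function.Surjective (ev v) :=
    (evalAt_surjective (hv.map' (LinearMap.ker (E.action a).eval).subtype
      (Submodule.ker_subtype _))).comp (Motive.toFun E).surjective
  have hle {ι : Type} (v : ι → LinearMap.ker (E.action a).eval) (μ : E.Motive) :
      ev v (a' • μ) = 0 := by
    ext i
    exact (hmem _).1 ⟨μ, rfl⟩ _ (v i).2
  -- Finiteness of the torsion is not yet known, so the cardinal rank is bounded through finite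
  -- independent subsets.
  have hrank : Module.rank Fq (LinearMap.ker (E.action a).eval) ≤ (r * a.natDegree : ℕ) := by
    refine rank_le fun s hs => ?_
    have hs' : LinearIndependent Fq fun i : Fin s.card => (s.equivFin.symm i).1 :=
      hs.comp _ s.equivFin.symm.injective
    refine (le_finrank_mul_natDegree (M := E.Motive) ha0 (f := ev _) (hev hs') (hle _)).trans_eq ?_
    rw [ha', natDegree_map]
    exact congrArg (· * _) hr.finrank_eq
  have hK : Module.Finite Fq (LinearMap.ker (E.action a).eval) :=
    Module.rank_lt_aleph0_iff.1 (hrank.trans_lt (Cardinal.natCast_lt_aleph0))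
  refine ⟨hK, ?_⟩
  let b := Module.finBasis Fq (LinearMap.ker (E.action a).eval)
  -- Polynomial functions here are F_q-linear, so vanishing on a basis of E[a] is vanishing on E[a].
  -- Evaluation therefore has kernel exactly aM, which turns the bound into an equality.
  have hker (μ : E.Motive) : ev b μ = 0 ↔ ∃ ν, a' • ν = μ := by
    refine ⟨fun hμ => (hmem μ).2 fun z hz => ?_, ?_⟩
    · obtain ⟨g, hg⟩ := motiveSpace_map_add (Motive.toFun E μ).2
      rw [hg]
      have h0 : g ∘ₗ (LinearMap.ker (E.action a).eval).subtype = 0 := by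
        refine b.ext fun i => ?_
        rw [LinearMap.comp_apply, Submodule.subtype_apply, ← hg]
        exact congrFun hμ i
      exact LinearMap.congr_fun h0 ⟨z, hz⟩
    · rintro ⟨ν, rfl⟩
      exact hle b ν
  have := eq_finrank_mul_natDegree (M := E.Motive) ha0 (f := ev b) (hev b.linearIndependent) hker
  rw [this, ha', natDegree_map]
  exact congrArg (· * _) hr.finrank_eq

end Torsion
end AndersonHecke
end

noncomputable section
namespace AndersonHecke

/-! ### Estimates for exponential maps -/

section Exponential

variable {Fq : Type*} [Field Fq] [Fintype Fq] {m n : ℕ}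

open AndersonModule Filter Topology

theorem X_smul_lie (z : Lie Fq n) : (X : Fq[X]) • z = theta Fq • z := by
  ext k
  rw [Pi.smul_apply, Pi.smul_apply, Algebra.smul_def]
  rfl

theorem algebraMap_smul_lie (a : Fq[X]) (z : Lie Fq n) :
    algebraMap Fq[X] (CInfty Fq) a • z = a • z := by
  ext k
  rw [Pi.smul_apply, Pi.smul_apply, Algebra.smul_def a, smul_eq_mul]

variable {E : AndersonModule Fq n}

/-- Convergence at the unit vectors bounds the coefficients B_i uniformly. For ‖z‖ ≤ 1/2 the tail is
then dominated by ‖z‖² times a geometric series, because q^{i+1} ≥ i + 2. -/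
theorem AndersonModule.IsExponential.exists_norm_sub_le {e : Lie Fq n →ₗ[Fq[X]] E.Points}
    (he : E.IsExponential e) :
    ∃ K : ℝ, 0 ≤ K ∧ ∀ z, ‖z‖ ≤ 1 / 2 → ‖E.pt.symm (e z) - z‖ ≤ K * ‖z‖ ^ 2 := by
  obtain ⟨B, hB0, hB⟩ := he
  have h1 (k : Fin n) : ∃ K : ℝ, ∀ i l, ‖B i l k‖ ≤ K := by
    have ht := (hB (Pi.single k 1)).summable.tendsto_atTop_zero
    obtain ⟨K, hK⟩ := (Metric.isBounded_range_of_tendsto _ ht).exists_norm_le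
    refine ⟨K, fun i l => ?_⟩
    have h := (norm_le_pi_norm _ l).trans (hK _ ⟨i, rfl⟩)
    have h' : frob Fq i (Pi.single k 1 : Fin n → CInfty Fq) = Pi.single k 1 := by
      ext l'
      by_cases hl : l' = k
      · subst hl; simp [frob_apply]
      · simp [frob_apply, hl]
    simp only [h'] at h
    simpa using h
  choose K hK using h1
  have hmul (i : ℕ) (w : Fin n → CInfty Fq) : ‖B i *ᵥ w‖ ≤ (∑ k, |K k|) * ‖w‖ := by
    refine (pi_norm_le_iff_of_nonneg (by positivity)).2 fun l => ?_
    change ‖∑ k, B i l k * w k‖ ≤ _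
    rw [Finset.sum_mul]
    refine norm_sum_le_of_le Finset.univ fun k _ => ?_
    rw [norm_mul]
    gcongr
    · exact (hK k i l).trans (le_abs_self _)
    · exact norm_le_pi_norm w k
  refine ⟨(∑ k, |K k|) * 2, by positivity, fun z hz => ?_⟩
  have hs : HasSum (fun i => B (i + 1) *ᵥ frob Fq (i + 1) z) (E.pt.symm (e z) - z) := by
    have := (hasSum_nat_add_iff' 1).2 (hB z)
    simpa [hB0] using this
  have hg : HasSum (fun i : ℕ => (∑ k, |K k|) * ‖z‖ ^ 2 * (1 / 2 : ℝ) ^ i)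
      ((∑ k, |K k|) * ‖z‖ ^ 2 * 2) := hasSum_geometric_two.mul_left _
  have := hs.norm_le_of_bounded hg fun i => by
    refine (hmul _ _).trans ?_
    rw [mul_assoc]
    gcongr
    refine (TauPoly.norm_frob_le _ _).trans ?_
    have h1 : 1 < Fintype.card Fq := Fintype.one_lt_card
    have h2 : i + 2 ≤ Fintype.card Fq ^ (i + 1) := Nat.lt_pow_self h1
    calc ‖z‖ ^ (Fintype.card Fq ^ (i + 1)) ≤ ‖z‖ ^ (i + 2) :=
          pow_le_pow_of_le_one (norm_nonneg z) (hz.trans (by norm_num)) h2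
      _ = ‖z‖ ^ 2 * ‖z‖ ^ i := by rw [pow_add, mul_comm]
      _ ≤ ‖z‖ ^ 2 * (1 / 2) ^ i := by gcongr
  calc _ ≤ _ := this
    _ = _ := by ring

theorem symm_X_smul_pt (w : E.Points) : E.pt.symm ((X : Fq[X]) • w) = E.T (E.pt.symm w) :=
  Module.AEval'.of_symm_X_smul _ _

theorem exp_theta_smul (e : Lie Fq n →ₗ[Fq[X]] E.Points) (z : Lie Fq n) :
    E.pt.symm (e (theta Fq • z)) = E.T (E.pt.symm (e z)) := by
  rw [← X_smul_lie, map_smul, symm_X_smul_pt]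

theorem exists_norm_T_le (E : AndersonModule Fq n) {σ : ℝ} (hσ : ‖theta Fq‖ < σ) :
    ∃ η > 0, ∀ w, ‖w‖ ≤ η → ‖E.T w‖ ≤ σ * ‖w‖ := by
  obtain ⟨K, hK, h⟩ := E.phi.exists_norm_eval_sub_le
  refine ⟨min 1 ((σ - ‖theta Fq‖) / (K + 1)),
    lt_min one_pos (div_pos (sub_pos.2 hσ) (by positivity)), fun w hw => ?_⟩
  have h1 := h w (hw.trans (min_le_left _ _))
  have h2 : E.phi 0 *ᵥ w = theta Fq • w := by
    rw [E.phi_zero]; ext; simp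
  rw [h2] at h1
  have h3 : ‖w‖ * (K + 1) ≤ σ - ‖theta Fq‖ :=
    (le_div_iff₀ (by positivity)).1 (hw.trans (min_le_right _ _))
  calc ‖E.T w‖ ≤ ‖E.phi.eval w - theta Fq • w‖ + ‖theta Fq • w‖ := by
        have := norm_add_le (E.phi.eval w - theta Fq • w) (theta Fq • w)
        rwa [sub_add_cancel] at this
    _ ≤ K * ‖w‖ ^ 2 + ‖theta Fq‖ * ‖w‖ := by rw [norm_smul]; gcongr
    _ = (K * ‖w‖ + ‖theta Fq‖) * ‖w‖ := by ring
    _ ≤ σ * ‖w‖ := by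
        gcongr
        nlinarith [norm_nonneg w]

/-- A sequence of successive `T`-division points that decreases like `θ^{-2k}` vanishes. -/
theorem eq_zero_of_division_sequence (E : AndersonModule Fq n) {w : ℕ → Fin n → CInfty Fq}
    (hw : ∀ k, E.T (w (k + 1)) = w k) {K : ℝ}
    (hK : ∀ᶠ k in atTop, ‖w k‖ ≤ K * (‖theta Fq‖⁻¹ ^ k) ^ 2) : w 0 = 0 := by
  have hρ := one_lt_norm_theta Fq
  set ρ := ‖theta Fq‖ with hρdef
  -- Near 0 the map φ_T expands by at most σ, and σ < ρ² means that the decay ρ^{-2k} wins over σ^k.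
  obtain ⟨σ, hσ1, hσ2⟩ : ∃ σ, ρ < σ ∧ σ < ρ ^ 2 := exists_between (by nlinarith)
  obtain ⟨η, hη, hT⟩ := exists_norm_T_le E hσ1
  have hlim : Tendsto (fun k : ℕ => K * (ρ⁻¹ ^ k) ^ 2) atTop (𝓝 0) := by
    simpa using ((tendsto_theta_inv_pow (Fq := Fq)).pow 2).const_mul K
  obtain ⟨k₀, hk₀⟩ := eventually_atTop.1 (hK.and (hlim.eventually (gt_mem_nhds hη)))
  have hstep (j : ℕ) : ‖w k₀‖ ≤ σ ^ j * ‖w (k₀ + j)‖ := by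
    induction j with
    | zero => simp
    | succ j ih =>
      refine ih.trans ?_
      obtain ⟨h1, h2⟩ := hk₀ (k₀ + j + 1) (by omega)
      have h3 := hT _ (h1.trans h2.le)
      rw [hw] at h3
      rw [pow_succ, mul_assoc]
      have : 0 ≤ σ := by linarith
      gcongr
      exact h3
  have hlim2 : Tendsto (fun j : ℕ => K * (ρ⁻¹ ^ k₀) ^ 2 * (σ / ρ ^ 2) ^ j) atTop (𝓝 0) := by
    have h0 : 0 ≤ σ / ρ ^ 2 := div_nonneg (by linarith) (by positivity)
    have h1 : σ / ρ ^ 2 < 1 := (div_lt_one (by positivity)).2 hσ2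
    simpa only [mul_zero] using
      (tendsto_pow_atTop_nhds_zero_of_lt_one h0 h1).const_mul (K * (ρ⁻¹ ^ k₀) ^ 2)
  have hzero : ‖w k₀‖ ≤ 0 := by
    refine ge_of_tendsto' hlim2 fun j => (hstep j).trans ?_
    have : 0 ≤ σ := by linarith
    calc σ ^ j * ‖w (k₀ + j)‖ ≤ σ ^ j * (K * (ρ⁻¹ ^ (k₀ + j)) ^ 2) := by
          gcongr
          exact (hk₀ (k₀ + j) (by omega)).1
      _ = _ := by
          rw [pow_add, div_pow, ← pow_mul, ← pow_mul, mul_pow, ← pow_mul, ← pow_mul, inv_pow ρ (j * 2),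
            mul_comm 2 j]
          field_simp
  have hk : w k₀ = 0 := norm_le_zero_iff.1 hzero
  have hdown (j : ℕ) (hj : w j = 0) : w 0 = 0 := by
    induction j with
    | zero => exact hj
    | succ j ih => exact ih (by rw [← hw, hj, map_zero])
  exact hdown k₀ hk

/-- A map commuting with `θ` and vanishing to second order at `0` vanishes. -/
theorem eq_zero_of_theta_equivariant (E : AndersonModule Fq n) {G : (Fin m → CInfty Fq) → Fin n → CInfty Fq}
    {z : Fin m → CInfty Fq} (hG : ∀ c : CInfty Fq, E.T (G (c • z)) = G (theta Fq • c • z))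
    {K δ : ℝ} (hδ : 0 < δ) (hK : ∀ c : CInfty Fq, ‖c • z‖ ≤ δ → ‖G (c • z)‖ ≤ K * ‖c • z‖ ^ 2) :
    G z = 0 := by
  have hth := theta_ne_zero (Fq := Fq)
  -- The values G(θ^{-k} z) form a sequence of division points, quadratically small in θ^{-k}.
  have h := eq_zero_of_division_sequence E (w := fun k => G ((theta Fq)⁻¹ ^ k • z))
    (K := K * ‖z‖ ^ 2) (fun k => by
      rw [hG, smul_smul, pow_succ', mul_inv_cancel_left₀ hth]) ?_
  · simpa using h
  · have : Tendsto (fun k : ℕ => ‖theta Fq‖⁻¹ ^ k * ‖z‖) atTop (𝓝 0) := by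
      simpa using (tendsto_theta_inv_pow (Fq := Fq)).mul_const ‖z‖
    filter_upwards [this.eventually (gt_mem_nhds hδ)] with k hk
    have h1 : ‖(theta Fq)⁻¹ ^ k • z‖ = ‖theta Fq‖⁻¹ ^ k * ‖z‖ := by
      rw [norm_smul, norm_pow, norm_inv]
    refine (hK _ (h1.trans_le hk.le)).trans_eq ?_
    rw [h1]
    ring

theorem TauPoly.exists_norm_eval_exp_sub_le (P : TauPoly Fq m n) {e : Lie Fq n →ₗ[Fq[X]] E.Points}
    (he : E.IsExponential e) : ∃ δ > 0, ∃ K : ℝ, 0 ≤ K ∧ ∀ z, ‖z‖ ≤ δ →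
      ‖P.eval (E.pt.symm (e z)) - P 0 *ᵥ z‖ ≤ K * ‖z‖ ^ 2 := by
  obtain ⟨K₁, hK₁, h₁⟩ := he.exists_norm_sub_le
  obtain ⟨K₂, hK₂, h₂⟩ := P.exists_norm_eval_sub_le
  obtain ⟨K₃, hK₃, h₃⟩ := TauPoly.exists_norm_mulVec_le (P 0)
  refine ⟨min (1 / 2) (1 / (1 + K₁)), lt_min (by norm_num) (by positivity),
    K₂ * (1 + K₁) ^ 2 + K₃ * K₁, by positivity, fun z hz => ?_⟩
  have hz1 : ‖z‖ ≤ 1 / 2 := hz.trans (min_le_left _ _)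
  have hz2 : ‖z‖ * (1 + K₁) ≤ 1 := (le_div_iff₀ (by positivity)).1 (hz.trans (min_le_right _ _))
  set w := E.pt.symm (e z)
  have hw : ‖w - z‖ ≤ K₁ * ‖z‖ ^ 2 := h₁ z hz1
  have hw' : ‖w‖ ≤ (1 + K₁) * ‖z‖ := by
    have h4 := norm_add_le (w - z) z
    rw [sub_add_cancel] at h4
    have : K₁ * ‖z‖ ^ 2 ≤ K₁ * ‖z‖ := by
      gcongr
      nlinarith [norm_nonneg z]
    linarith
  have hsplit : P.eval w - P 0 *ᵥ z = (P.eval w - P 0 *ᵥ w) + P 0 *ᵥ (w - z) := by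
    rw [Matrix.mulVec_sub]; abel
  rw [hsplit]
  calc _ ≤ K₂ * ‖w‖ ^ 2 + K₃ * ‖w - z‖ :=
        norm_add_le_of_le (h₂ w (hw'.trans (by linarith))) (h₃ _)
    _ ≤ K₂ * ((1 + K₁) * ‖z‖) ^ 2 + K₃ * (K₁ * ‖z‖ ^ 2) := by gcongr
    _ = _ := by ring

end Exponential

/-! ### Functoriality of the exponential and rigidity of morphisms -/

section Rigidity

open AndersonModule Filter Topology

variable {Fq : Type*} [Field Fq] [Fintype Fq] {n : ℕ} {E E' : AndersonModule Fq n}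
  {e : Lie Fq n →ₗ[Fq[X]] E.Points}

theorem Hom.differential_apply (α : Hom E E') (z : Lie Fq n) :
    α.differential z = α.poly 0 *ᵥ z := rfl

theorem Hom.eval_exp_theta_smul (α : Hom E E') (e : Lie Fq n →ₗ[Fq[X]] E.Points) (z : Lie Fq n) :
    α.poly.eval (E.pt.symm (e (theta Fq • z))) = E'.T (α.poly.eval (E.pt.symm (e z))) := by
  rw [exp_theta_smul, α.comm]

theorem Hom.onPoints_apply (α : Hom E E') (w : E.Points) :
    α.onPoints w = E'.pt (α.poly.eval (E.pt.symm w)) := by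
  conv_lhs => rw [← E.pt.apply_symm_apply w]
  exact α.onPoints_pt _

/-- Functoriality of the exponential map. -/
theorem Hom.onPoints_exp (α : Hom E E') (he : E.IsExponential e)
    {e' : Lie Fq n →ₗ[Fq[X]] E'.Points} (he' : E'.IsExponential e') (z : Lie Fq n) :
    α.onPoints (e z) = e' (α.differential z) := by
  obtain ⟨δ, hδ, K, hK, h⟩ := α.poly.exists_norm_eval_exp_sub_le he
  obtain ⟨K₁, hK₁, h₁⟩ := he'.exists_norm_sub_le
  obtain ⟨K₂, hK₂, h₂⟩ := TauPoly.exists_norm_mulVec_le (α.poly 0)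
  -- Both sides have the same linear term, so their difference is quadratically small and commutes
  -- with θ.
  have := eq_zero_of_theta_equivariant E' (z := z)
    (G := fun z => α.poly.eval (E.pt.symm (e z)) - E'.pt.symm (e' (α.poly 0 *ᵥ z)))
    (fun c => by
      rw [α.eval_exp_theta_smul, map_sub, Matrix.mulVec_smul _ (theta Fq), exp_theta_smul])
    (K := K + K₁ * K₂ ^ 2) (δ := min δ (1 / 2 / (K₂ + 1))) (lt_min hδ (by positivity))
    (fun c hc => by
      have hz := (le_div_iff₀ (by positivity)).1 (hc.trans (min_le_right _ _))
      set z' := c • z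
      have h3 : ‖α.poly 0 *ᵥ z'‖ ≤ 1 / 2 := (h₂ z').trans (by nlinarith [norm_nonneg z'])
      have h4 : α.poly.eval (E.pt.symm (e z')) - E'.pt.symm (e' (α.poly 0 *ᵥ z')) =
        (α.poly.eval (E.pt.symm (e z')) - α.poly 0 *ᵥ z') -
          (E'.pt.symm (e' (α.poly 0 *ᵥ z')) - α.poly 0 *ᵥ z') := by abel
      rw [h4]
      calc _ ≤ K * ‖z'‖ ^ 2 + K₁ * ‖α.poly 0 *ᵥ z'‖ ^ 2 :=
            norm_sub_le_of_le (h z' (hc.trans (min_le_left _ _))) (h₁ _ h3)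
        _ ≤ K * ‖z'‖ ^ 2 + K₁ * (K₂ * ‖z'‖) ^ 2 := by gcongr; exact h₂ z'
        _ = _ := by ring)
  rw [α.onPoints_apply, sub_eq_zero.1 this, LinearEquiv.apply_symm_apply]
  rfl

/-- The scaling argument only uses multiples of z, so agreement on one line is enough. This form
also applies to a line in the kernel of a differential. -/
theorem Hom.onPoints_exp_eq_of_differential_eq (α β : Hom E E') (he : E.IsExponential e)
    {z : Lie Fq n} (h : ∀ c : CInfty Fq, α.differential (c • z) = β.differential (c • z)) :
    α.onPoints (e z) = β.onPoints (e z) := by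
  obtain ⟨δ, hδ, K, hK, h₁⟩ := α.poly.exists_norm_eval_exp_sub_le he
  obtain ⟨δ', hδ', K', hK', h₂⟩ := β.poly.exists_norm_eval_exp_sub_le he
  have := eq_zero_of_theta_equivariant E' (z := z)
    (G := fun z => α.poly.eval (E.pt.symm (e z)) - β.poly.eval (E.pt.symm (e z)))
    (fun c => by
      rw [α.eval_exp_theta_smul, β.eval_exp_theta_smul, map_sub])
    (K := K + K') (δ := min δ δ') (lt_min hδ hδ')
    (fun c hc => by
      have h3 := norm_sub_le_of_le (h₁ (c • z) (hc.trans (min_le_left _ _)))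
        (h₂ (c • z) (hc.trans (min_le_right _ _)))
      have h4 : α.poly 0 *ᵥ (c • z) = β.poly 0 *ᵥ (c • z) := h c
      rw [h4, sub_sub_sub_cancel_right, ← add_mul] at h3
      exact h3)
  rw [α.onPoints_apply, β.onPoints_apply, sub_eq_zero.1 this]

/-- A morphism out of a uniformizable module is determined by its differential. -/
theorem Hom.onPoints_eq_of_differential_eq {α β : Hom E E'} (he : E.IsUniformization e)
    (h : α.differential = β.differential) : α.onPoints = β.onPoints := by
  ext w
  obtain ⟨z, rfl⟩ := he.surjective w
  exact α.onPoints_exp_eq_of_differential_eq β he.isExponential fun c => by rw [h]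

theorem Hom.differential_eq_of_onPoints_eq {α β : Hom E E'} (h : α.onPoints = β.onPoints) :
    α.differential = β.differential := by
  have : α.poly 0 = β.poly 0 := TauPoly.apply_zero_eq_of_eval_eq fun z => by
    have := LinearMap.congr_fun h (E.pt z)
    rw [α.onPoints_pt, β.onPoints_pt] at this
    exact E'.pt.injective this
  rw [differential, this, differential]

/-- The zero morphism. -/
def Hom.zero (E E' : AndersonModule Fq n) : Hom E E' := ⟨0, fun z => by simp⟩

/-- For a nonzero small z the quadratic error is smaller than z itself, so the exponential cannot
vanish there. -/
theorem AndersonModule.IsExponential.discrete (he : E.IsExponential e) :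
    ∃ δ > 0, ∀ z, e z = 0 → ‖z‖ < δ → z = 0 := by
  obtain ⟨K, hK, h⟩ := he.exists_norm_sub_le
  refine ⟨min (1 / 2) (1 / (K + 1)), lt_min (by norm_num) (by positivity), fun z hz hzd => ?_⟩
  have h1 := h z (hzd.le.trans (min_le_left _ _))
  rw [hz, map_zero, zero_sub, norm_neg] at h1
  have h2 := (lt_div_iff₀ (by positivity)).1 (hzd.trans_le (min_le_right _ _))
  by_contra h0
  have h3 : 0 < ‖z‖ := norm_pos_iff.2 h0
  nlinarith

/-- An isogeny out of a uniformizable module has an injective differential. -/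
theorem Hom.IsIsogeny.differential_injective {α : Hom E E'} (hα : α.IsIsogeny)
    (he : E.IsExponential e) : Function.Injective α.differential := by
  rw [← LinearMap.ker_eq_bot, LinearMap.ker_eq_bot']
  intro v hv
  by_contra hv0
  obtain ⟨δ, hδ, hd⟩ := he.discrete
  -- Compared with the zero morphism, α kills the image of the whole line through v.
  have hker (c : CInfty Fq) : e (c • v) ∈ LinearMap.ker α.onPoints := by
    rw [LinearMap.mem_ker, α.onPoints_exp_eq_of_differential_eq (Hom.zero E E') he fun c' => ?_]
    · rw [Hom.onPoints_apply]; simp [Hom.zero]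
    · rw [map_smul, map_smul, hv, Hom.differential_apply]; simp [Hom.zero]
  have hth := one_lt_norm_theta Fq
  have hlim : Tendsto (fun k : ℕ => ‖theta Fq‖⁻¹ ^ k * ‖v‖) atTop (𝓝 0) := by
    simpa using (tendsto_theta_inv_pow (Fq := Fq)).mul_const ‖v‖
  obtain ⟨k₀, hk₀⟩ := eventually_atTop.1 (hlim.eventually (gt_mem_nhds (half_pos hδ)))
  have := hα.finite_ker
  -- Infinitely many small points θ^{-k} v land in a finite kernel. Two of them coincide, and their
  -- difference is a period too short to be nonzero.
  obtain ⟨k, l, hkl, heq⟩ := Finite.exists_ne_map_eq_of_infinite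
    fun k : ℕ => (⟨_, hker ((theta Fq)⁻¹ ^ (k₀ + k))⟩ : LinearMap.ker α.onPoints)
  have heq' : e ((theta Fq)⁻¹ ^ (k₀ + k) • v - (theta Fq)⁻¹ ^ (k₀ + l) • v) = 0 := by
    rw [map_sub, sub_eq_zero]
    exact congrArg Subtype.val heq
  have hnorm (k : ℕ) : ‖(theta Fq)⁻¹ ^ (k₀ + k) • v‖ < δ / 2 := by
    rw [norm_smul, norm_pow, norm_inv]
    exact hk₀ _ (by omega)
  have h0 := hd _ heq' ((norm_sub_le _ _).trans_lt (by linarith [hnorm k, hnorm l]))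
  rw [← sub_smul, smul_eq_zero, or_iff_left hv0, sub_eq_zero] at h0
  have h1 := congrArg norm h0
  rw [norm_pow, norm_pow, norm_inv] at h1
  have := pow_right_injective₀ (by positivity) (inv_lt_one_of_one_lt₀ hth).ne h1
  omega

end Rigidity
end AndersonHecke
end

noncomputable section
namespace AndersonHecke

/-! ### Finite generation and rank of the period lattice -/

section FreeModules

variable {K M : Type*} [Field K] [AddCommGroup M] [Module K[X] M] [Module K M]
  [IsScalarTower K K[X] M] [Module.Finite K[X] M] [Module.Free K[X] M]

theorem finrank_range_eq_finrank_mul_natDegree {a : K[X]} (ha : a ≠ 0) {W : Type*} [AddCommGroup W]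
    [Module K W] [Module.Finite K W] {f : M →ₗ[K] W} (h : ∀ x, f x = 0 ↔ ∃ y, a • y = x) :
    Module.finrank K (LinearMap.range f) = Module.finrank K[X] M * a.natDegree := by
  let b := Module.finBasis K (LinearMap.range f)
  refine eq_finrank_mul_natDegree ha (f := b.equivFun.toLinearMap ∘ₗ f.rangeRestrict)
    (b.equivFun.surjective.comp f.surjective_rangeRestrict) fun x => ?_
  rw [← h, LinearMap.comp_apply, LinearEquiv.coe_coe, LinearEquiv.map_eq_zero_iff]
  simp [Subtype.ext_iff]

end FreeModules

section Floor

variable {Fq : Type*} [Field Fq] [Fintype Fq]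

-- The quotient of numerator by denominator is the polynomial part. The degree bound is what leaves
-- finitely many polynomial parts over a finite field.
omit [Fintype Fq] in
theorem exists_floor (x : RatFunc Fq) : ∃ p : Fq[X], (p.natDegree : ℤ) ≤ max 0 x.intDegree ∧
    (x - algebraMap Fq[X] (RatFunc Fq) p).intDegree ≤ 0 := by
  have hd := x.monic_denom
  refine ⟨x.num /ₘ x.denom, ?_, ?_⟩
  · rw [natDegree_divByMonic _ hd, RatFunc.intDegree]
    omega
  · have h : x - algebraMap Fq[X] (RatFunc Fq) (x.num /ₘ x.denom) =
        algebraMap Fq[X] (RatFunc Fq) (x.num %ₘ x.denom) / algebraMap _ _ x.denom := by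
      have h0 : algebraMap Fq[X] (RatFunc Fq) x.denom ≠ 0 :=
        RatFunc.algebraMap_ne_zero x.denom_ne_zero
      rw [eq_div_iff h0]
      nth_rewrite 1 [← RatFunc.num_div_denom x]
      rw [sub_mul, div_mul_cancel₀ _ h0, ← map_mul, ← map_sub]
      congr 1
      linear_combination -(modByMonic_add_div x.num x.denom)
    rw [h]
    by_cases h0 : x.num %ₘ x.denom = 0
    · simp [h0]
    · rw [RatFunc.intDegree_div (RatFunc.algebraMap_ne_zero h0)
        (RatFunc.algebraMap_ne_zero x.denom_ne_zero), RatFunc.intDegree_polynomial,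
        RatFunc.intDegree_polynomial]
      have := natDegree_le_natDegree (degree_modByMonic_lt x.num hd).le
      omega

end Floor

section Lattice

open AndersonModule Filter Topology

variable {Fq : Type*} [Field Fq] [Fintype Fq] {n : ℕ}

instance : Module.IsTorsionFree Fq[X] (CInfty Fq) := by
  rw [Module.isTorsionFree_iff_algebraMap_injective]
  exact algebraMap_injective'

theorem norm_ratFunc_smul_apply_le (x : RatFunc Fq) (hx : x.intDegree ≤ 0) (y : CInfty Fq) :
    ‖x • y‖ ≤ ‖y‖ := by
  rw [Algebra.smul_def, norm_mul]
  exact mul_le_of_le_one_left (norm_nonneg y) (norm_le_one_of_intDegree_le Fq hx)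

theorem norm_ratFunc_smul_le {x : RatFunc Fq} (hx : x.intDegree ≤ 0) (z : Lie Fq n) :
    ‖x • z‖ ≤ ‖z‖ :=
  (pi_norm_le_iff_of_nonneg (norm_nonneg z)).2 fun k =>
    (norm_ratFunc_smul_apply_le x hx (z k)).trans (norm_le_pi_norm z k)

theorem X_pow_ratFunc_smul (N : ℕ) (z : Lie Fq n) :
    (RatFunc.X ^ N : RatFunc Fq) • z = theta Fq ^ N • z := by
  ext k
  rw [Pi.smul_apply, Pi.smul_apply, Algebra.smul_def, map_pow, smul_eq_mul]
  rw [theta, IsScalarTower.algebraMap_apply Fq[X] (RatFunc Fq), RatFunc.algebraMap_X]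

/-- A discrete `F_q[θ]`-module inside a finite dimensional `F_q(θ)`-space is finitely generated. -/
theorem fg_of_discrete {L : Submodule Fq[X] (Lie Fq n)} {δ : ℝ} (hδ : 0 < δ)
    (hd : ∀ z ∈ L, ‖z‖ < δ → z = 0) (s : Finset (Lie Fq n)) (hs : ∀ z ∈ s, z ∈ L) :
    (L ⊓ (Submodule.span (RatFunc Fq) (s : Set (Lie Fq n))).restrictScalars Fq[X]).FG := by
  classical
  have hs' (z) (hz : z ∈ s) :
      z ∈ L ⊓ (Submodule.span (RatFunc Fq) (s : Set (Lie Fq n))).restrictScalars Fq[X] :=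
    ⟨hs z hz, Submodule.subset_span hz⟩
  -- The lattice points with coefficients of degree at most 0, a kind of fundamental domain.
  -- Together with s they generate, by subtracting polynomial parts of coefficients.
  let X₀ : Set (Lie Fq n) := {z | z ∈ L ∧ ∃ f : s → RatFunc Fq, (∀ i, (f i).intDegree ≤ 0) ∧
    z = ∑ i, f i • (i : Lie Fq n)}
  have hX₀fin : X₀.Finite := by
    -- If the polynomial parts of θ^N f_i agree for two points, θ^N times their difference has norm
    -- at most ∑ 2‖s_i‖. The choice of N then makes the difference shorter than δ, hence zero.
    obtain ⟨N, hN⟩ : ∃ N : ℕ, ‖theta Fq‖⁻¹ ^ N * (∑ i : s, 2 * ‖(i : Lie Fq n)‖) < δ := by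
      have : Tendsto (fun k : ℕ => ‖theta Fq‖⁻¹ ^ k * (∑ i : s, 2 * ‖(i : Lie Fq n)‖)) atTop
          (𝓝 0) := by
        simpa using (tendsto_theta_inv_pow (Fq := Fq)).mul_const (∑ i : s, 2 * ‖(i : Lie Fq n)‖)
      exact (this.eventually (gt_mem_nhds hδ)).exists
    have hfl (z : X₀) : ∃ f : s → RatFunc Fq, ∃ p : s → degreeLT Fq (N + 1),
        z.1 = ∑ i, f i • (i : Lie Fq n) ∧
        ∀ i, (RatFunc.X ^ N * f i - algebraMap Fq[X] (RatFunc Fq) (p i)).intDegree ≤ 0 := by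
      obtain ⟨-, f, hf, hz⟩ := z.2
      choose p hp hp' using fun i => exists_floor (RatFunc.X ^ N * f i)
      have hpN (i) : p i ∈ degreeLT Fq (N + 1) := by
        rw [mem_degreeLT]
        have h1 : (RatFunc.X ^ N * f i).intDegree ≤ (N : ℤ) := by
          by_cases h0 : f i = 0
          · simp [h0]
          · rw [RatFunc.intDegree_mul (pow_ne_zero _ RatFunc.X_ne_zero) h0, ← RatFunc.algebraMap_X,
              ← map_pow, RatFunc.intDegree_polynomial, natDegree_X_pow]
            linarith [hf i]
        have h2 := hp i
        have h3 : (p i).natDegree < N + 1 := by omega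
        exact degree_le_natDegree.trans_lt (by exact_mod_cast h3)
      exact ⟨f, fun i => ⟨p i, hpN i⟩, hz, hp'⟩
    choose f p hz hp using hfl
    have : Finite (degreeLT Fq (N + 1)) := Module.finite_of_finite Fq
    refine Set.finite_coe_iff.1 (Finite.of_injective p fun z z' hzz' => Subtype.ext ?_)
    rw [← sub_eq_zero]
    refine hd _ (sub_mem z.2.1 z'.2.1) ?_
    have hscale : theta Fq ^ N • (z.1 - z'.1) =
        ∑ i : s, ((RatFunc.X ^ N * f z i - algebraMap Fq[X] (RatFunc Fq) (p z i)) • (i : Lie Fq n) -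
          (RatFunc.X ^ N * f z' i - algebraMap Fq[X] (RatFunc Fq) (p z i)) • (i : Lie Fq n)) := by
      rw [← X_pow_ratFunc_smul, hz z, hz z', ← Finset.sum_sub_distrib, Finset.smul_sum]
      refine Finset.sum_congr rfl fun i _ => ?_
      rw [sub_smul, sub_smul, sub_sub_sub_cancel_right, mul_smul, mul_smul, smul_sub]
    have hle : ‖theta Fq ^ N • (z.1 - z'.1)‖ ≤ ∑ i : s, 2 * ‖(i : Lie Fq n)‖ := by
      rw [hscale]
      refine norm_sum_le_of_le _ fun i _ => ?_
      rw [two_mul]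
      refine norm_sub_le_of_le (norm_ratFunc_smul_le (hp z i) _) (norm_ratFunc_smul_le ?_ _)
      rw [hzz']
      exact hp z' i
    rw [norm_smul, norm_pow] at hle
    have hpos : 0 < ‖theta Fq‖ ^ N := pow_pos (one_pos.trans (one_lt_norm_theta Fq)) N
    calc ‖z.1 - z'.1‖ = ‖theta Fq‖⁻¹ ^ N * (‖theta Fq‖ ^ N * ‖z.1 - z'.1‖) := by
          rw [inv_pow, inv_mul_cancel_left₀ hpos.ne']
      _ ≤ ‖theta Fq‖⁻¹ ^ N * (∑ i : s, 2 * ‖(i : Lie Fq n)‖) := by gcongr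
      _ < δ := hN
  refine Submodule.fg_def.2 ⟨s ∪ X₀, s.finite_toSet.union hX₀fin, le_antisymm ?_ ?_⟩
  · rw [Submodule.span_le]
    rintro z (hz | ⟨hzL, f, -, hz⟩)
    · exact hs' z hz
    · refine ⟨hzL, ?_⟩
      rw [hz]
      exact (Submodule.span (RatFunc Fq) (s : Set (Lie Fq n))).sum_mem fun i _ =>
        (Submodule.span (RatFunc Fq) (s : Set (Lie Fq n))).smul_mem _ (Submodule.subset_span i.2)
  · rintro z ⟨hzL, hz⟩
    rw [SetLike.mem_coe, Submodule.restrictScalars_mem] at hz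
    obtain ⟨c, hc⟩ := Submodule.mem_span_finset'.1 hz
    choose p _ hp using fun i => exists_floor (c i)
    have hmem : ∑ i : s, p i • (i : Lie Fq n) ∈ Submodule.span Fq[X] (s : Set (Lie Fq n)) :=
      Submodule.sum_mem _ fun i _ => Submodule.smul_mem _ _ (Submodule.subset_span i.2)
    have hmemL : ∑ i : s, p i • (i : Lie Fq n) ∈ L :=
      Submodule.sum_mem _ fun i _ => Submodule.smul_mem _ _ (hs _ i.2)
    have hrest : z - ∑ i : s, p i • (i : Lie Fq n) ∈ X₀ := by
      refine ⟨sub_mem hzL hmemL, _, hp, ?_⟩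
      rw [← hc, ← Finset.sum_sub_distrib]
      refine Finset.sum_congr rfl fun i _ => ?_
      rw [sub_smul, algebraMap_smul]
    have := add_mem (Submodule.span_mono Set.subset_union_left hmem)
      (Submodule.subset_span (Set.mem_union_right (s : Set (Lie Fq n)) hrest) :
        _ ∈ Submodule.span Fq[X] ((s : Set (Lie Fq n)) ∪ X₀))
    rwa [add_sub_cancel] at this

variable {E : AndersonModule Fq n} {e : Lie Fq n →ₗ[Fq[X]] E.Points}

theorem exp_smul (a : Fq[X]) (z : Lie Fq n) :
    E.pt.symm (e (a • z)) = (E.action a).eval (E.pt.symm (e z)) := by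
  rw [map_smul]
  apply E.pt.injective
  rw [LinearEquiv.apply_symm_apply, ← E.smul_pt', LinearEquiv.apply_symm_apply]

/-- Division by `a` followed by the exponential map. -/
def divExp (e : Lie Fq n →ₗ[Fq[X]] E.Points) (a : Fq[X]) : Lie Fq n →ₗ[Fq] (Fin n → CInfty Fq) :=
  E.pt.symm.toLinearMap ∘ₗ e.restrictScalars Fq ∘ₗ
    (LinearMap.lsmul (CInfty Fq) (Lie Fq n) (algebraMap Fq[X] (CInfty Fq) a)⁻¹).restrictScalars Fq

theorem smul_inv_smul_lie {a : Fq[X]} (ha : a ≠ 0) (z : Lie Fq n) :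
    a • (algebraMap Fq[X] (CInfty Fq) a)⁻¹ • z = z := by
  rw [← algebraMap_smul_lie, smul_inv_smul₀ ((map_ne_zero_iff _ algebraMap_injective').2 ha)]

theorem inv_smul_smul_lie {a : Fq[X]} (ha : a ≠ 0) (z : Lie Fq n) :
    (algebraMap Fq[X] (CInfty Fq) a)⁻¹ • a • z = z := by
  rw [← algebraMap_smul_lie, inv_smul_smul₀ ((map_ne_zero_iff _ algebraMap_injective').2 ha)]

theorem divExp_apply (a : Fq[X]) (z : Lie Fq n) :
    divExp e a z = E.pt.symm (e ((algebraMap Fq[X] (CInfty Fq) a)⁻¹ • z)) := rfl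

theorem divExp_mem_ker {a : Fq[X]} (ha : a ≠ 0) {z : Lie Fq n} (hz : e z = 0) :
    divExp e a z ∈ LinearMap.ker (E.action a).eval := by
  rw [LinearMap.mem_ker, divExp_apply, ← exp_smul, smul_inv_smul_lie ha, hz, map_zero]

/-- The division map on a saturated submodule of the period lattice. -/
def divExpOn (ha : (a : Fq[X]) ≠ 0) {L : Submodule Fq[X] (Lie Fq n)} (hL : L ≤ LinearMap.ker e) :
    L →ₗ[Fq] LinearMap.ker (E.action a).eval :=
  (divExp e a ∘ₗ L.subtype.restrictScalars Fq).codRestrict _ fun z => divExp_mem_ker ha (hL z.2)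

/-- A lattice vector killed by z ↦ exp(z/a) is a times a period, and saturation puts that period
back into L. So L/aL embeds in E[a]. -/
theorem divExpOn_eq_zero_iff {a : Fq[X]} (ha : a ≠ 0) {L : Submodule Fq[X] (Lie Fq n)}
    (hL : L ≤ LinearMap.ker e) (hsat : ∀ z ∈ LinearMap.ker e, a • z ∈ L → z ∈ L) (z : L) :
    divExpOn ha hL z = 0 ↔ ∃ y, a • y = z := by
  have h0 : divExpOn ha hL z = 0 ↔ divExp e a z.1 = 0 := by
    rw [← ZeroMemClass.coe_eq_zero]
    rfl
  rw [h0, divExp_apply, LinearEquiv.map_eq_zero_iff]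
  constructor
  · intro h
    exact ⟨⟨_, hsat _ h (by rw [smul_inv_smul_lie ha]; exact z.2)⟩,
      Subtype.ext (smul_inv_smul_lie ha z.1)⟩
  · rintro ⟨y, rfl⟩
    rw [Submodule.coe_smul, inv_smul_smul_lie ha]
    exact hL y.2

/-- The period lattice of a uniformizable module of rank `r` is free of rank `r`. -/
theorem AndersonModule.HasRank.periodLattice {r : ℕ} (hr : E.HasRank r) (he : E.IsUniformization e) :
    Module.Finite Fq[X] (LinearMap.ker e) ∧ Module.Free Fq[X] (LinearMap.ker e) ∧
      Module.finrank Fq[X] (LinearMap.ker e) = r := by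
  classical
  set L := LinearMap.ker e with hL
  obtain ⟨δ, hδ, hd⟩ := he.isExponential.discrete
  obtain ⟨hKfin, hKrank⟩ := HasRank.finrank_ker_action E hr (a := X) X_ne_zero
  rw [natDegree_X, mul_one] at hKrank
  -- The lattice points in the F_q(θ)-span of s form a finitely generated saturated L₁, and L₁/θL₁
  -- embeds in E[θ]. The element θ has degree 1, so dimensions there are ranks.
  have hbound (s : Finset (Lie Fq n)) (hs : ∀ z ∈ s, z ∈ L)
      (hli : LinearIndependent (RatFunc Fq) fun z : s => (z : Lie Fq n)) : s.card ≤ r := by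
    have hfg := fg_of_discrete hδ hd s hs
    set L₁ := L ⊓ (Submodule.span (RatFunc Fq) (s : Set (Lie Fq n))).restrictScalars Fq[X]
    have : Module.Finite Fq[X] L₁ := Module.Finite.iff_fg.2 hfg
    have h1 := finrank_range_eq_finrank_mul_natDegree X_ne_zero
      (divExpOn_eq_zero_iff (e := e) (a := X) X_ne_zero (L := L₁) inf_le_left (fun z hz hz' =>
        ⟨hz, by
          have := Submodule.smul_mem _ (RatFunc.X : RatFunc Fq)⁻¹ hz'.2
          rwa [← algebraMap_smul (RatFunc Fq) (X : Fq[X]) z, RatFunc.algebraMap_X, smul_smul,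
            inv_mul_cancel₀ RatFunc.X_ne_zero, one_smul] at this⟩))
    rw [natDegree_X, mul_one] at h1
    have h2 := Submodule.finrank_le (LinearMap.range
      (divExpOn (e := e) (a := X) X_ne_zero (L := L₁) inf_le_left))
    rw [h1, hKrank] at h2
    have hli' : LinearIndependent Fq[X]
        (fun z : s => (⟨z, hs z z.2, Submodule.subset_span z.2⟩ : L₁)) :=
      LinearIndependent.of_comp L₁.subtype (hli.restrict_scalars' Fq[X])
    exact (by simpa using hli'.fintype_card_le_finrank : s.card ≤ _).trans h2
  obtain ⟨b, hbL, hbspan, hbli⟩ := exists_linearIndependent (RatFunc Fq) (L : Set (Lie Fq n))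
  have hbfin : b.Finite := by
    by_contra hinf
    obtain ⟨t, htb, htcard⟩ := Set.Infinite.exists_subset_card_eq hinf (r + 1)
    have := hbound t (fun z hz => hbL (htb hz)) 
      (hbli.comp (fun z : t => ⟨z.1, htb z.2⟩) fun x y h => Subtype.ext (congrArg (fun z => z.1) h))
    omega
  have hfg := fg_of_discrete hδ hd hbfin.toFinset fun z hz => hbL (hbfin.mem_toFinset.1 hz)
  have hLeq : L ⊓ (Submodule.span (RatFunc Fq) (hbfin.toFinset : Set (Lie Fq n))).restrictScalars
      Fq[X] = L := by
    rw [inf_eq_left, Set.Finite.coe_toFinset, hbspan]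
    exact Submodule.subset_span
  have hLfg : L.FG := by
    have h : (L ⊓ (Submodule.span (RatFunc Fq)
      (hbfin.toFinset : Set (Lie Fq n))).restrictScalars Fq[X]).FG := hfg
    rwa [hLeq] at h
  have : Module.Finite Fq[X] L := Module.Finite.iff_fg.2 hLfg
  refine ⟨this, inferInstance, ?_⟩
  have h1 := finrank_range_eq_finrank_mul_natDegree X_ne_zero
    (divExpOn_eq_zero_iff (e := e) (a := X) X_ne_zero (L := L) le_rfl fun z hz _ => hz)
  -- Lifting a θ-torsion point through the exponential gives z with θz in L, whose class maps to
  -- that point.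
  have hsurj : LinearMap.range (divExpOn (e := e) (a := X) X_ne_zero (L := L) le_rfl) = ⊤ := by
    rw [LinearMap.range_eq_top]
    rintro ⟨w, hw⟩
    obtain ⟨z, hz⟩ := he.surjective (E.pt w)
    refine ⟨⟨(X : Fq[X]) • z, ?_⟩, Subtype.ext ?_⟩
    · rw [hL, LinearMap.mem_ker, map_smul, hz, E.smul_pt', LinearMap.mem_ker.1 hw, map_zero]
    · change divExp e X ((X : Fq[X]) • z) = w
      rw [divExp_apply, inv_smul_smul_lie X_ne_zero, hz, LinearEquiv.symm_apply_apply]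
  rw [hsurj, finrank_top, hKrank, natDegree_X, mul_one] at h1
  exact h1.symm

end Lattice
end AndersonHecke
end

noncomputable section
namespace AndersonHecke

/-! ### Modules killed by 𝔭 and the type (1, …, 1, 𝔭, …, 𝔭) -/

section Types

variable {K : Type*} [Field K] (𝔭 : HeightOneSpectrum K[X]) {ϖ : K[X]}

variable {𝔭} in
theorem uniformizer_ne_zero (hϖ : 𝔭.asIdeal = Ideal.span {ϖ}) : ϖ ≠ 0 := by
  rintro rfl
  exact 𝔭.ne_bot (by rw [hϖ]; simp)

variable {𝔭} in
theorem irreducible_uniformizer (hϖ : 𝔭.asIdeal = Ideal.span {ϖ}) : Irreducible ϖ := by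
  have h := 𝔭.isPrime
  rw [hϖ, Ideal.span_singleton_prime (uniformizer_ne_zero hϖ)] at h
  exact h.irreducible

variable {𝔭} in
theorem natDegree_uniformizer_pos (hϖ : 𝔭.asIdeal = Ideal.span {ϖ}) : 0 < ϖ.natDegree :=
  (irreducible_uniformizer hϖ).natDegree_pos

theorem finrank_residueField (hϖ : 𝔭.asIdeal = Ideal.span {ϖ}) :
    Module.finrank K (K[X] ⧸ 𝔭.asIdeal) = ϖ.natDegree := by
  rw [hϖ, finrank_quotient_span_eq_natDegree]

theorem finite_quotient {a : K[X]} (ha : a ≠ 0) : Module.Finite K (K[X] ⧸ Ideal.span {a}) :=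
  (AdjoinRoot.powerBasis ha).finite

/-- Dimension over the residue field from the dimension over the constants. -/
theorem finrank_eq_mul_finrank (hϖ : 𝔭.asIdeal = Ideal.span {ϖ}) {V : Type*} [AddCommGroup V]
    [Module K V] [Module (K[X] ⧸ 𝔭.asIdeal) V] [IsScalarTower K (K[X] ⧸ 𝔭.asIdeal) V] :
    Module.finrank K V = Module.finrank (K[X] ⧸ 𝔭.asIdeal) V * ϖ.natDegree := by
  have := 𝔭.isMaximal
  let : Field (K[X] ⧸ 𝔭.asIdeal) := Ideal.Quotient.field _
  rw [← Module.finrank_mul_finrank K (K[X] ⧸ 𝔭.asIdeal) V, finrank_residueField 𝔭 hϖ, mul_comm]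

/-- Modules killed by a prime are classified by their dimension. -/
theorem nonempty_linearEquiv_of_finrank_eq (hϖ : 𝔭.asIdeal = Ideal.span {ϖ}) {M N : Type*}
    [AddCommGroup M] [Module K[X] M] [Module K M] [IsScalarTower K K[X] M]
    [AddCommGroup N] [Module K[X] N] [Module K N] [IsScalarTower K K[X] N]
    [Module.Finite K M] [Module.Finite K N]
    (hM : ∀ x : M, ϖ • x = 0) (hN : ∀ x : N, ϖ • x = 0)
    (h : Module.finrank K M = Module.finrank K N) : Nonempty (M ≃ₗ[K[X]] N) := by
  have := 𝔭.isMaximal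
  have hM' : Module.IsTorsionBySet K[X] M (𝔭.asIdeal : Set K[X]) := by
    rintro x ⟨a, ha⟩
    rw [SetLike.mem_coe, hϖ, Ideal.mem_span_singleton'] at ha
    obtain ⟨b, rfl⟩ := ha
    change (b * ϖ) • x = 0
    rw [mul_smul, hM, smul_zero]
  have hN' : Module.IsTorsionBySet K[X] N (𝔭.asIdeal : Set K[X]) := by
    rintro x ⟨a, ha⟩
    rw [SetLike.mem_coe, hϖ, Ideal.mem_span_singleton'] at ha
    obtain ⟨b, rfl⟩ := ha
    change (b * ϖ) • x = 0
    rw [mul_smul, hN, smul_zero]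
  let : Field (K[X] ⧸ 𝔭.asIdeal) := Ideal.Quotient.field _
  let := hM'.module
  let := hN'.module
  have tM : IsScalarTower K[X] (K[X] ⧸ 𝔭.asIdeal) M := hM'.isScalarTower
  have tN : IsScalarTower K[X] (K[X] ⧸ 𝔭.asIdeal) N := hN'.isScalarTower
  have tM' : IsScalarTower K (K[X] ⧸ 𝔭.asIdeal) M := hM'.isScalarTower
  have tN' : IsScalarTower K (K[X] ⧸ 𝔭.asIdeal) N := hN'.isScalarTower
  have fM : Module.Finite (K[X] ⧸ 𝔭.asIdeal) M := Module.Finite.of_restrictScalars_finite K _ _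
  have fN : Module.Finite (K[X] ⧸ 𝔭.asIdeal) N := Module.Finite.of_restrictScalars_finite K _ _
  rw [finrank_eq_mul_finrank 𝔭 hϖ, finrank_eq_mul_finrank 𝔭 hϖ (V := N)] at h
  have h' := Nat.eq_of_mul_eq_mul_right (natDegree_uniformizer_pos hϖ) h
  exact ⟨(LinearEquiv.ofFinrankEq M N h').restrictScalars K[X]⟩

theorem typeVec_ne_zero (hϖ : 𝔭.asIdeal = Ideal.span {ϖ}) (r j : ℕ) (i : Fin r) :
    typeVec r j ϖ i ≠ 0 := by
  rw [typeVec]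
  split_ifs
  · exact one_ne_zero
  · exact uniformizer_ne_zero hϖ

omit 𝔭 in
theorem typeVec_dvd (r j : ℕ) (ϖ : K[X]) (i : Fin r) : typeVec r j ϖ i ∣ ϖ := by
  rw [typeVec]
  split_ifs
  · exact one_dvd _
  · exact dvd_rfl

omit 𝔭 in
theorem card_filter_typeVec {r j : ℕ} (hj : j ≤ r) :
    (Finset.univ.filter fun i : Fin r => ¬ (i : ℕ) < r - j).card = j := by
  have h : (Finset.univ.filter fun i : Fin r => (i : ℕ) < r - j).card = r - j := by
    rw [Fin.card_filter_val_lt]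
    omega
  have := Finset.card_filter_add_card_filter_not (s := (Finset.univ : Finset (Fin r)))
    (fun i : Fin r => (i : ℕ) < r - j)
  rw [h, Finset.card_univ, Fintype.card_fin] at this
  omega

/-- A finite module has type `(1, …, 1, ϖ, …, ϖ)` iff it is killed by `ϖ` and has the right
dimension. -/
theorem nonempty_equiv_typeVec_iff (hϖ : 𝔭.asIdeal = Ideal.span {ϖ}) {r j : ℕ} (hj : j ≤ r)
    {N : Type*} [AddCommGroup N] [Module K[X] N] [Module K N] [IsScalarTower K K[X] N] :
    Nonempty (N ≃ₗ[K[X]] Π i, K[X] ⧸ Ideal.span {typeVec r j ϖ i}) ↔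
      (∀ x : N, ϖ • x = 0) ∧ Module.Finite K N ∧ Module.finrank K N = j * ϖ.natDegree := by
  have hfin (i : Fin r) : Module.Finite K (K[X] ⧸ Ideal.span {typeVec r j ϖ i}) :=
    finite_quotient (typeVec_ne_zero 𝔭 hϖ r j i)
  have hrank : Module.finrank K (Π i, K[X] ⧸ Ideal.span {typeVec r j ϖ i}) = j * ϖ.natDegree := by
    rw [Module.finrank_pi_fintype]
    simp_rw [finrank_quotient_span_eq_natDegree, typeVec]
    simp_rw [apply_ite natDegree, natDegree_one, Finset.sum_ite, Finset.sum_const_zero, zero_add,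
      Finset.sum_const, card_filter_typeVec hj, smul_eq_mul]
  have hkill (x : Π i, K[X] ⧸ Ideal.span {typeVec r j ϖ i}) : ϖ • x = 0 := by
    ext i
    obtain ⟨y, hy⟩ := Ideal.Quotient.mk_surjective (x i)
    rw [Pi.smul_apply, ← hy, Pi.zero_apply]
    change Ideal.Quotient.mk _ (ϖ * y) = 0
    rw [Ideal.Quotient.eq_zero_iff_mem, Ideal.mem_span_singleton]
    exact (typeVec_dvd r j ϖ i).mul_right y
  constructor
  · rintro ⟨f⟩
    refine ⟨fun x => f.injective ?_, Module.Finite.equiv (f.restrictScalars K).symm, ?_⟩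
    · rw [map_smul, hkill, map_zero]
    · rw [(f.restrictScalars K).finrank_eq, hrank]
  · rintro ⟨h1, h2, h3⟩
    exact nonempty_linearEquiv_of_finrank_eq 𝔭 hϖ h1 hkill (h3.trans hrank.symm)

end Types

/-- The submodule is a separate variable equal to the kernel, so that quotients can be formed by the
submodule named in the final statement. -/
theorem exists_quotient_equiv_of_surjective {R M N : Type*} [Ring R] [AddCommGroup M] [Module R M]
    [AddCommGroup N] [Module R N] (f : M →ₗ[R] N) (hf : Function.Surjective f)
    {P : Submodule R M} (hP : LinearMap.ker f = P) :
    ∃ Φ : (M ⧸ P) ≃ₗ[R] N, ∀ z, Φ (Submodule.Quotient.mk z) = f z := by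
  subst hP
  exact ⟨f.quotKerEquivOfSurjective hf, fun z => f.quotKerEquivOfSurjective_apply_mk hf z⟩

/-! ### The 𝔭-torsion points and 𝔭⁻¹L/L -/

section Torsion

open AndersonModule

variable {Fq : Type*} [Field Fq] [Fintype Fq] {n : ℕ} {𝔭 : HeightOneSpectrum Fq[X]} {ϖ : Fq[X]}
  {E : AndersonModule Fq n} {e : Lie Fq n →ₗ[Fq[X]] E.Points}

theorem mem_torsion_iff (hϖ : 𝔭.asIdeal = Ideal.span {ϖ}) {w : E.Points} :
    w ∈ E.torsion 𝔭 ↔ ϖ • w = 0 := by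
  rw [AndersonModule.torsion, hϖ, Submodule.torsionBySet_span_singleton_eq, Submodule.mem_torsionBy_iff]

/-- The torsion points as the kernel of a polynomial map. -/
def torsionEquiv (hϖ : 𝔭.asIdeal = Ideal.span {ϖ}) :
    LinearMap.ker (E.action ϖ).eval ≃ₗ[Fq] E.torsion 𝔭 :=
  E.pt.ofSubmodules _ ((E.torsion 𝔭).restrictScalars Fq) (by
    ext w
    rw [Submodule.restrictScalars_mem, mem_torsion_iff hϖ]
    constructor
    · rintro ⟨z, hz, rfl⟩
      rw [LinearEquiv.coe_coe, E.smul_pt', LinearMap.mem_ker.1 hz, map_zero]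
    · intro hw
      refine ⟨E.pt.symm w, ?_, E.pt.apply_symm_apply w⟩
      rw [SetLike.mem_coe, LinearMap.mem_ker]
      apply E.pt.injective
      rw [← E.smul_pt', LinearEquiv.apply_symm_apply, hw, map_zero])

theorem finite_torsion (hϖ : 𝔭.asIdeal = Ideal.span {ϖ}) {r : ℕ} (hr : E.HasRank r) :
    Module.Finite Fq (E.torsion 𝔭) := by
  have := (HasRank.finrank_ker_action E hr (uniformizer_ne_zero hϖ)).1
  exact Module.Finite.equiv (torsionEquiv hϖ)

theorem finrank_torsion (hϖ : 𝔭.asIdeal = Ideal.span {ϖ}) {r : ℕ} (hr : E.HasRank r) :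
    Module.finrank (Fq[X] ⧸ 𝔭.asIdeal) (E.torsion 𝔭) = r := by
  have h := (HasRank.finrank_ker_action E hr (uniformizer_ne_zero hϖ)).2
  rw [(torsionEquiv hϖ).finrank_eq] at h
  exact Nat.eq_of_mul_eq_mul_right (natDegree_uniformizer_pos hϖ)
    ((finrank_eq_mul_finrank 𝔭 hϖ (V := E.torsion 𝔭)).symm.trans h)

theorem finite_torsion' (hϖ : 𝔭.asIdeal = Ideal.span {ϖ}) {r : ℕ} (hr : E.HasRank r) :
    Module.Finite (Fq[X] ⧸ 𝔭.asIdeal) (E.torsion 𝔭) := by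
  have := finite_torsion hϖ hr
  exact Module.Finite.of_restrictScalars_finite Fq _ _

/-- The cardinal rank also excludes infinite dimension, for which `Module.finrank` would return 0.
-/
theorem rank_torsion (hϖ : 𝔭.asIdeal = Ideal.span {ϖ}) {r : ℕ} (hr : E.HasRank r) :
    Module.rank (Fq[X] ⧸ 𝔭.asIdeal) (E.torsion 𝔭) = r := by
  have := 𝔭.isMaximal
  have := finite_torsion' hϖ hr
  let : Field (Fq[X] ⧸ 𝔭.asIdeal) := Ideal.Quotient.field _
  rw [← finrank_torsion hϖ hr]
  exact (Module.finrank_eq_rank _ _).symm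

theorem mem_divLattice_iff (z : Lie Fq n) :
    z ∈ divLattice 𝔭 (LinearMap.ker e) ↔ e z ∈ E.torsion 𝔭 := by
  change (∀ a ∈ 𝔭.asIdeal, a • z ∈ LinearMap.ker e) ↔ _
  rw [AndersonModule.torsion, Submodule.mem_torsionBySet_iff]
  simp only [LinearMap.mem_ker, map_smul, Subtype.forall]
  rfl

variable (𝔭 e) in
def divLatticeMap : divLattice 𝔭 (LinearMap.ker e) →ₗ[Fq[X]] E.torsion 𝔭 :=
  LinearMap.codRestrict _ (e ∘ₗ (divLattice 𝔭 (LinearMap.ker e)).subtype)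
    fun z => (mem_divLattice_iff z.1).1 z.2

theorem ker_divLatticeMap : LinearMap.ker (divLatticeMap 𝔭 e) =
    (LinearMap.ker e).submoduleOf (divLattice 𝔭 (LinearMap.ker e)) := by
  refine Submodule.ext fun z => ?_
  rw [LinearMap.mem_ker, ← ZeroMemClass.coe_eq_zero]
  rfl

theorem divLatticeMap_surjective (he : Function.Surjective e) :
    Function.Surjective (divLatticeMap 𝔭 e) := by
  rintro ⟨w, hw⟩
  obtain ⟨z, rfl⟩ := he w
  exact ⟨⟨z, (mem_divLattice_iff z).2 hw⟩, rfl⟩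

/-- The exponential map identifies `𝔭⁻¹ L / L` with the torsion points. -/
theorem exists_divLattice_equiv (he : Function.Surjective e) :
    ∃ Φ : (divLattice 𝔭 (LinearMap.ker e) ⧸
          (LinearMap.ker e).submoduleOf (divLattice 𝔭 (LinearMap.ker e)))
          ≃ₗ[Fq[X]] E.torsion 𝔭,
        ∀ z : divLattice 𝔭 (LinearMap.ker e), (Φ (Submodule.Quotient.mk z) : E.Points) = e z := by
  have h1 := divLatticeMap_surjective (𝔭 := 𝔭) he
  have h2 := ker_divLatticeMap (𝔭 := 𝔭) (e := e)
  obtain ⟨Φ, hΦ⟩ := exists_quotient_equiv_of_surjective (R := Fq[X])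
    (M := divLattice 𝔭 (LinearMap.ker e)) (N := E.torsion 𝔭) (divLatticeMap 𝔭 e) h1 h2
  exact ⟨Φ, fun z => congrArg Subtype.val (hΦ z)⟩

end Torsion
end AndersonHecke
end

noncomputable section
namespace AndersonHecke

/-! ### Adapted bases for lattices between ϖM and M -/

section Smith

/-- The quotient of a free module by a submodule with an adapted basis. -/
theorem nonempty_quotient_equiv_of_basis {R M ι : Type*} [CommRing R] [AddCommGroup M] [Module R M]
    [Fintype ι] [DecidableEq ι] {N : Submodule R M} (b : Module.Basis ι R M)
    (c : Module.Basis ι R N) (a : ι → R) (h : ∀ i, (c i : M) = a i • b i) :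
    Nonempty ((M ⧸ N) ≃ₗ[R] Π i, R ⧸ Ideal.span {a i}) := by
  have mem_iff : ∀ x, x ∈ N ↔ ∀ i, a i ∣ b.repr x i := by
    intro x
    have key : ∀ (d : ι → R) (i), b.repr (∑ j : ι, d j • a j • b j) i = a i * d i := by
      intro d i
      simp only [← mul_smul, b.repr_sum_self, mul_comm]
    simp_rw [c.mem_submodule_iff', h]
    constructor
    · rintro ⟨d, rfl⟩ i
      exact ⟨d i, key d i⟩
    · intro ha
      choose d hd using ha
      exact ⟨d, b.ext_elem fun i => (hd i).trans (key d i).symm⟩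
  let f : M →ₗ[R] Π i, R ⧸ Ideal.span {a i} :=
    (LinearMap.pi fun i => (Submodule.mkQ (Ideal.span {a i})) ∘ₗ LinearMap.proj i) ∘ₗ
      b.equivFun.toLinearMap
  have hf : Function.Surjective f := by
    intro y
    choose z hz using fun i => Submodule.mkQ_surjective (Ideal.span {a i}) (y i)
    refine ⟨b.equivFun.symm z, funext fun i => ?_⟩
    change Submodule.mkQ (Ideal.span {a i}) (b.equivFun (b.equivFun.symm z) i) = y i
    rw [LinearEquiv.apply_symm_apply, hz]
  have hker : LinearMap.ker f = N := by
    ext x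
    rw [mem_iff, LinearMap.mem_ker, funext_iff]
    refine forall_congr' fun i => ?_
    change Submodule.Quotient.mk (b.repr x i) = 0 ↔ _
    rw [Submodule.Quotient.mk_eq_zero, Ideal.mem_span_singleton]
  obtain ⟨Φ, -⟩ := exists_quotient_equiv_of_surjective f hf hker
  exact ⟨Φ⟩

variable {K : Type*} [Field K]

/-- Adapted bases for a submodule containing `ϖ M`, with `ϖ` irreducible. -/
theorem exists_adapted_bases {ϖ : K[X]} (hϖ : Irreducible ϖ) {M : Type*} [AddCommGroup M]
    [Module K[X] M] {r : ℕ} (b : Module.Basis (Fin r) K[X] M) (N : Submodule K[X] M)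
    (hN : ∀ x : M, ϖ • x ∈ N) :
    ∃ m ≤ r, ∃ (s' : Module.Basis (Fin r) K[X] M) (s : Module.Basis (Fin r) K[X] N),
      ∀ i, (s i : M) = typeVec r m ϖ i • s' i := by
  classical
  have : Module.Finite K[X] M := .of_basis b
  have : Module.Free K[X] M := .of_basis b
  -- Multiplication by ϖ embeds M into N, so N has full rank and the Smith form is square.
  have hrank : Module.finrank K[X] N = Module.finrank K[X] M := by
    refine le_antisymm (Submodule.finrank_le N) ?_
    refine LinearMap.finrank_le_finrank_of_injective
      (f := (LinearMap.lsmul K[X] M ϖ).codRestrict N hN) fun x y hxy => ?_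
    have h : ϖ • x = ϖ • y := congrArg Subtype.val hxy
    exact smul_right_injective M hϖ.ne_zero h
  obtain ⟨b', a, c, hc⟩ := N.exists_smith_normal_form_of_rank_eq b hrank
  have hdvd (i : Fin r) : a i ∣ ϖ := by
    obtain ⟨d, hd⟩ := c.mem_submodule_iff'.mp (hN (b' i))
    have h := congrArg (fun x => b'.repr x i) hd
    simp only [hc, ← mul_smul, b'.repr_sum_self] at h
    rw [map_smul, Finsupp.smul_apply, Module.Basis.repr_self, Finsupp.single_eq_same, smul_eq_mul,
      mul_one] at h
    exact ⟨d i, h.trans (mul_comm _ _)⟩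
  let m := (Finset.univ.filter fun i => ¬ IsUnit (a i)).card
  have hm : m ≤ r := (Finset.card_le_univ _).trans_eq (Fintype.card_fin r)
  have hcard : Fintype.card {i : Fin r // ¬ (i : ℕ) < r - m} =
      Fintype.card {i : Fin r // ¬ IsUnit (a i)} := by
    rw [Fintype.card_subtype, Fintype.card_subtype, card_filter_typeVec hm]
  -- Each elementary divisor divides the irreducible ϖ, so it is a unit or an associate of ϖ. The
  -- permutation moves the units to the front, and the remaining unit factors are absorbed into the
  -- basis.
  let σ : Equiv.Perm (Fin r) := (Fintype.equivOfCardEq hcard).extendSubtype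
  have hu (i : Fin r) : ∃ u : K[X]ˣ, typeVec r m ϖ i * u = a (σ i) := by
    by_cases hi : (i : ℕ) < r - m
    · have h := Equiv.extendSubtype_not_mem (Fintype.equivOfCardEq hcard) i (not_not.mpr hi)
      rw [not_not] at h
      refine ⟨h.unit, ?_⟩
      rw [typeVec, if_pos hi, one_mul]
      rfl
    · have h := Equiv.extendSubtype_mem (Fintype.equivOfCardEq hcard) i hi
      rw [typeVec, if_neg hi]
      exact (((hϖ.dvd_iff).mp (hdvd (σ i))).resolve_left h).symm.symm
  choose u hu using hu
  refine ⟨m, hm, (b'.reindex σ.symm).unitsSMul u, c.reindex σ.symm, fun i => ?_⟩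
  rw [Module.Basis.reindex_apply, Equiv.symm_symm, hc, ← hu, mul_smul,
    Module.Basis.unitsSMul_apply, Module.Basis.reindex_apply, Equiv.symm_symm]
  rfl

end Smith

/-! ### The double cosets at the finite places -/

section Local

variable {K : Type*} [Field K]

/-- If M = U diag(d) V with d d' = ϖ, then V⁻¹ diag(d') U⁻¹ is the integral matrix ϖM⁻¹. -/
theorem doubleCoset_exists_integral {r : ℕ} (v : HeightOneSpectrum K[X]) {ϖ : K[X]}
    {d d' : Fin r → K[X]} (hd : ∀ i, d i * d' i = ϖ)
    {M : Matrix (Fin r) (Fin r) (v.adicCompletion (RatFunc K))}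
    (hM : M ∈ doubleCoset v (Matrix.diagonal fun i => algebraMap _ _ (d i))) :
    ∃ M' R' : Matrix (Fin r) (Fin r) (v.adicCompletionIntegers (RatFunc K)),
      M = M'.map (algebraMap _ _) ∧ M' * R' = Matrix.scalar _ (algebraMap _ _ ϖ) := by
  obtain ⟨U, V, rfl⟩ := hM
  refine ⟨U.1 * Matrix.diagonal (fun i => algebraMap _ _ (d i)) * V.1,
    V⁻¹.1 * Matrix.diagonal (fun i => algebraMap _ _ (d' i)) * U⁻¹.1, ?_, ?_⟩
  · rw [Matrix.map_mul, Matrix.map_mul, Matrix.diagonal_map (map_zero _)]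
    rfl
  · have h1 : V.1 * V⁻¹.1 = 1 := V.mul_inv
    have h2 : U.1 * U⁻¹.1 = 1 := U.mul_inv
    have h3 : Matrix.diagonal (fun i => algebraMap K[X] (v.adicCompletionIntegers (RatFunc K)) (d i)) *
        Matrix.diagonal (fun i => algebraMap _ _ (d' i)) =
        Matrix.scalar _ (algebraMap _ _ ϖ) := by
      rw [Matrix.diagonal_mul_diagonal, Matrix.scalar_apply]
      congr 1
      funext i
      rw [← map_mul, hd]
    calc _ = U.1 * (Matrix.diagonal (fun i => algebraMap _ _ (d i)) * (V.1 * V⁻¹.1) *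
          Matrix.diagonal (fun i => algebraMap _ _ (d' i))) * U⁻¹.1 := by
            simp only [Matrix.mul_assoc]
      _ = _ := by
        rw [h1, Matrix.mul_one, h3, ← (Matrix.scalar_commute _ (fun r' => Commute.all _ r') U.1).eq,
          Matrix.mul_assoc, h2, Matrix.mul_one]

theorem exists_algebraMap_eq_of_integral {x : RatFunc K}
    (h : ∀ v : HeightOneSpectrum K[X], ∃ y : v.adicCompletionIntegers (RatFunc K),
      algebraMap (RatFunc K) (v.adicCompletion (RatFunc K)) x = algebraMap _ _ y) :
    ∃ a : K[X], algebraMap K[X] (RatFunc K) a = x := by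
  refine HeightOneSpectrum.mem_integers_of_valuation_le_one (RatFunc K) x fun v => ?_
  obtain ⟨y, hy⟩ := h v
  rw [← HeightOneSpectrum.valuedAdicCompletion_eq_valuation']
  have h2 := y.2
  rw [HeightOneSpectrum.mem_adicCompletionIntegers] at h2
  convert h2 using 1
  exact congrArg _ hy

theorem exists_map_eq_of_integral {r : ℕ} {P : Matrix (Fin r) (Fin r) (RatFunc K)}
    (h : ∀ v : HeightOneSpectrum K[X],
      ∃ M : Matrix (Fin r) (Fin r) (v.adicCompletionIntegers (RatFunc K)),
      P.map (algebraMap (RatFunc K) (v.adicCompletion (RatFunc K))) = M.map (algebraMap _ _)) :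
    ∃ Q : Matrix (Fin r) (Fin r) K[X], P = Q.map (algebraMap _ _) := by
  have h' (i k) : ∃ a : K[X], algebraMap K[X] (RatFunc K) a = P i k := by
    refine exists_algebraMap_eq_of_integral fun v => ?_
    obtain ⟨M, hM⟩ := h v
    exact ⟨M i k, congrFun (congrFun hM i) k⟩
  choose Q hQ using h'
  exact ⟨Matrix.of Q, by ext i k; exact (hQ i k).symm⟩

theorem valued_det_unit {r : ℕ} (v : HeightOneSpectrum K[X])
    (U : GL (Fin r) (v.adicCompletionIntegers (RatFunc K))) :
    Valued.v (U.1.map (algebraMap _ (v.adicCompletion (RatFunc K)))).det = 1 := by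
  have h : (U.1.map (algebraMap _ (v.adicCompletion (RatFunc K)))).det =
      algebraMap _ (v.adicCompletion (RatFunc K)) U.1.det := by
    rw [RingHom.map_det]; rfl
  rw [h]
  exact (HeightOneSpectrum.adicCompletionIntegers.isUnit_iff_valued_eq_one).mp
    ((Matrix.isUnit_iff_isUnit_det _).mp U.isUnit)

theorem valued_uniformizer (𝔭 : HeightOneSpectrum K[X]) {ϖ : K[X]}
    (hϖ : 𝔭.asIdeal = Ideal.span {ϖ}) :
    Valued.v (algebraMap K[X] (𝔭.adicCompletion (RatFunc K)) ϖ) = WithZero.exp (-1 : ℤ) := by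
  rw [← HeightOneSpectrum.intValuation_singleton 𝔭 (uniformizer_ne_zero hϖ) hϖ]
  exact (HeightOneSpectrum.valuedAdicCompletion_eq_valuation (K := RatFunc K) 𝔭 ϖ).trans
    (𝔭.valuation_of_algebraMap ϖ)

theorem prod_typeVec {r m : ℕ} (hm : m ≤ r) (ϖ : K[X]) : ∏ i, typeVec r m ϖ i = ϖ ^ m := by
  simp_rw [typeVec]
  rw [Finset.prod_ite, Finset.prod_const_one, one_mul, Finset.prod_const, card_filter_typeVec hm]

/-- Integral invertible matrices have unit determinant, so only the diagonal counts. The exponent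
recovers j from the double coset. -/
theorem valued_det_doubleCoset (𝔭 : HeightOneSpectrum K[X]) {ϖ : K[X]}
    (hϖ : 𝔭.asIdeal = Ideal.span {ϖ}) {r j : ℕ} (hj : j ≤ r)
    {M : Matrix (Fin r) (Fin r) (𝔭.adicCompletion (RatFunc K))}
    (hM : M ∈ doubleCoset 𝔭 (Matrix.diagonal fun i => algebraMap _ _ (typeVec r j ϖ i))) :
    Valued.v M.det = WithZero.exp (-1 : ℤ) ^ j := by
  obtain ⟨U, V, rfl⟩ := hM
  rw [Matrix.det_mul, Matrix.det_mul, map_mul, map_mul, valued_det_unit, valued_det_unit,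
    Matrix.det_diagonal, ← map_prod, prod_typeVec hj, map_pow, map_pow, valued_uniformizer 𝔭 hϖ]
  simp

/-- The diagonal matrix itself lies in the double coset, at every place. -/
theorem diagonal_mem_doubleCoset (v : HeightOneSpectrum K[X]) {r : ℕ} (d : Fin r → K[X])
    (hd : ∀ i, d i ∉ v.asIdeal) :
    Matrix.diagonal (fun i => algebraMap K[X] (v.adicCompletion (RatFunc K)) (d i)) ∈
      doubleCoset v 1 := by
  have hu (i : Fin r) : IsUnit (algebraMap K[X] (v.adicCompletionIntegers (RatFunc K)) (d i)) := by
    rw [HeightOneSpectrum.adicCompletionIntegers.isUnit_iff_valued_eq_one]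
    refine (HeightOneSpectrum.valuedAdicCompletion_eq_valuation v (d i)).trans ?_
    exact (HeightOneSpectrum.valuation_eq_one_iff_notMem (K := RatFunc K) v).mpr (hd i)
  have hU : IsUnit (Matrix.diagonal fun i =>
      algebraMap K[X] (v.adicCompletionIntegers (RatFunc K)) (d i)) := by
    rw [Matrix.isUnit_iff_isUnit_det, Matrix.det_diagonal]
    exact IsUnit.prod_univ_iff.mpr hu
  refine ⟨hU.unit, 1, ?_⟩
  rw [IsUnit.unit_spec, Matrix.diagonal_map (map_zero _)]
  simp only [Units.val_one, Matrix.map_one _ (map_zero _) (map_one _), Matrix.mul_one]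
  rfl

end Local

/-! ### From the Hecke condition to the quotient of lattices and back -/

section Lattices

/-- Invariance of the elementary divisors: two descriptions of `N ⊆ M` have the same determinant up
to units. -/
theorem associated_det_of_bases {R M ι : Type*} [CommRing R] [AddCommGroup M] [Module R M]
    [Fintype ι] [DecidableEq ι] {N : Submodule R M} (b b' : Module.Basis ι R M)
    (c c' : Module.Basis ι R N) (a : ι → R) (h : ∀ i, (c i : M) = a i • b i) :
    Associated (∏ i, a i) (b'.toMatrix fun i => (c' i : M)).det := by
  have h1 : b.toMatrix (fun i => (c' i : M)) = Matrix.diagonal a * c.toMatrix c' := by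
    ext i j
    rw [Matrix.diagonal_mul, Module.Basis.toMatrix_apply, Module.Basis.toMatrix_apply]
    have h2 := congrArg (fun x : N => b.repr (x : M) i) (c.sum_repr (c' j))
    simp only [Submodule.coe_sum, Submodule.coe_smul, h] at h2
    rw [← h2]
    simp only [smul_smul]
    rw [b.repr_sum_self, mul_comm]
  have hu1 : IsUnit (b'.toMatrix b).det :=
    (Matrix.isUnit_iff_isUnit_det _).mp (.of_mul_eq_one _ (b'.toMatrix_mul_toMatrix_flip b))
  have hu2 : IsUnit (c.toMatrix c').det :=
    (Matrix.isUnit_iff_isUnit_det _).mp (.of_mul_eq_one _ (c.toMatrix_mul_toMatrix_flip c'))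
  rw [← b'.toMatrix_mul_toMatrix b (fun i => (c' i : M)), h1, Matrix.det_mul, Matrix.det_mul,
    Matrix.det_diagonal]
  refine ⟨hu1.unit * hu2.unit, ?_⟩
  simp only [Units.val_mul, IsUnit.unit_spec]
  ring

variable {Fq : Type*} [Field Fq] [Fintype Fq] {n r : ℕ} {𝔭 : HeightOneSpectrum Fq[X]} {ϖ : Fq[X]}

/-- Both P and ϖP⁻¹ are integral at every finite place, hence have polynomial entries; they become Q
and S. The valuation of the determinant is what remains of the double coset at 𝔭. -/
theorem HeckeRelated.exists_integral (hϖ : 𝔭.asIdeal = Ideal.span {ϖ}) {j : ℕ} (hj : j ≤ r)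
    {N L : Submodule Fq[X] (Lie Fq n)} (h : HeckeRelated r 𝔭 ϖ j N L) :
    ∃ (b : Module.Basis (Fin r) Fq[X] N) (b' : Module.Basis (Fin r) Fq[X] L)
      (Q S : Matrix (Fin r) (Fin r) Fq[X]),
      (∀ i, (b i : Lie Fq n) = ∑ k, Q k i • (b' k : Lie Fq n)) ∧ Q * S = Matrix.scalar _ ϖ ∧
      𝔭.intValuation Q.det = WithZero.exp (-1 : ℤ) ^ j := by
  classical
  obtain ⟨b, b', P, hP, hv⟩ := h
  have hD (v : HeightOneSpectrum Fq[X]) : ∃ d d' : Fin r → Fq[X], (∀ i, d i * d' i = ϖ) ∧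
      P.map (algebraMap (RatFunc Fq) (v.adicCompletion (RatFunc Fq))) ∈ doubleCoset v
        (Matrix.diagonal fun i => algebraMap _ _ (d i)) := by
    by_cases hvp : v = 𝔭
    · choose d' hd' using fun i => typeVec_dvd r j ϖ i
      refine ⟨typeVec r j ϖ, d', fun i => (hd' i).symm, ?_⟩
      simpa [hvp] using hv v
    -- Away from 𝔭 the double coset is trivial; the factorization ϖ = 1 · ϖ treats it uniformly with
    -- the place 𝔭.
    · refine ⟨fun _ => 1, fun _ => ϖ, fun i => one_mul _, ?_⟩
      simpa [hvp] using hv v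
  have hint (v : HeightOneSpectrum Fq[X]) :
      ∃ M' R' : Matrix (Fin r) (Fin r) (v.adicCompletionIntegers (RatFunc Fq)),
      P.map (algebraMap (RatFunc Fq) (v.adicCompletion (RatFunc Fq))) =
        M'.map (algebraMap _ _) ∧ M' * R' = Matrix.scalar _ (algebraMap _ _ ϖ) := by
    obtain ⟨d, d', hd, hd'⟩ := hD v
    exact doubleCoset_exists_integral v hd hd'
  obtain ⟨Q, rfl⟩ := exists_map_eq_of_integral fun v => (hint v).imp fun M ⟨_, hM, _⟩ => hM
  have hdet : 𝔭.intValuation Q.det = WithZero.exp (-1 : ℤ) ^ j := by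
    have h1 := hv 𝔭
    rw [if_pos rfl] at h1
    have h2 := valued_det_doubleCoset 𝔭 hϖ hj h1
    rw [← h2, ← 𝔭.valuation_of_algebraMap (K := RatFunc Fq),
      ← HeightOneSpectrum.valuedAdicCompletion_eq_valuation']
    congr 1
    rw [← RingHom.mapMatrix_apply, ← RingHom.mapMatrix_apply, ← RingHom.map_det,
      ← RingHom.map_det]
    rfl
  have hQ0 : Q.det ≠ 0 := by
    intro h0
    rw [h0, map_zero] at hdet
    exact (pow_ne_zero j WithZero.exp_ne_zero) hdet.symm
  have hQu : IsUnit (Q.map (algebraMap Fq[X] (RatFunc Fq))) := by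
    rw [Matrix.isUnit_iff_isUnit_det, ← RingHom.mapMatrix_apply, ← RingHom.map_det, isUnit_iff_ne_zero]
    exact (map_ne_zero_iff _ (IsFractionRing.injective Fq[X] (RatFunc Fq))).mpr hQ0
  obtain ⟨u, hu⟩ := hQu
  obtain ⟨S, hS⟩ := exists_map_eq_of_integral
    (P := u⁻¹.1 * Matrix.scalar _ (algebraMap Fq[X] (RatFunc Fq) ϖ)) fun v => by
      obtain ⟨M', R', hM, hR⟩ := hint v
      refine ⟨R', ?_⟩
      have h1 : u.1.map (algebraMap (RatFunc Fq) (v.adicCompletion (RatFunc Fq))) *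
          R'.map (algebraMap _ _) =
          Matrix.scalar _ (algebraMap (RatFunc Fq) (v.adicCompletion (RatFunc Fq))
            (algebraMap _ _ ϖ)) := by
        rw [hu, hM, ← Matrix.map_mul, hR, Matrix.scalar_apply, Matrix.scalar_apply,
          Matrix.diagonal_map (map_zero _)]
        rfl
      have h2 : u⁻¹.1.map (algebraMap (RatFunc Fq) (v.adicCompletion (RatFunc Fq))) *
          u.1.map (algebraMap (RatFunc Fq) (v.adicCompletion (RatFunc Fq))) = 1 := by
        rw [← Matrix.map_mul, u.inv_mul, Matrix.map_one _ (map_zero _) (map_one _)]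
      rw [Matrix.map_mul, Matrix.scalar_apply, Matrix.diagonal_map (map_zero _),
        ← Matrix.one_mul (R'.map _), ← h2, Matrix.mul_assoc, h1, Matrix.scalar_apply]
  refine ⟨b, b', Q, S, fun i => ?_, ?_, hdet⟩
  · rw [hP]
    refine Finset.sum_congr rfl fun k _ => ?_
    rw [Matrix.map_apply, algebraMap_smul]
  · apply Matrix.map_injective (IsFractionRing.injective Fq[X] (RatFunc Fq))
    beta_reduce
    rw [Matrix.map_mul, ← hS, ← hu, ← Matrix.mul_assoc, u.mul_inv, Matrix.one_mul,
      Matrix.scalar_apply, Matrix.scalar_apply, Matrix.diagonal_map (map_zero _)]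

/-- The matrix Q shows N ≤ L and S shows ϖL ≤ N, so adapted bases exist with some number m of
entries ϖ. -/
theorem HeckeRelated.le_and_nonempty_equiv (hϖ : 𝔭.asIdeal = Ideal.span {ϖ}) {j : ℕ} (hj : j ≤ r)
    {N L : Submodule Fq[X] (Lie Fq n)} (h : HeckeRelated r 𝔭 ϖ j N L) :
    N ≤ L ∧ Nonempty ((L ⧸ N.submoduleOf L) ≃ₗ[Fq[X]]
      Π i, Fq[X] ⧸ Ideal.span {typeVec r j ϖ i}) := by
  classical
  obtain ⟨b, b', Q, S, hQ, hS, hdet⟩ := h.exists_integral hϖ hj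
  have hle : N ≤ L := by
    intro x hx
    have h1 := congrArg Subtype.val (b.sum_repr ⟨x, hx⟩)
    rw [Submodule.coe_sum] at h1
    change _ = x at h1
    rw [← h1]
    refine Submodule.sum_mem _ fun i _ => ?_
    rw [Submodule.coe_smul, hQ]
    exact L.smul_mem _ (Submodule.sum_mem _ fun k _ => L.smul_mem _ (b' k).2)
  let c : Module.Basis (Fin r) Fq[X] (N.submoduleOf L) :=
    b.map (Submodule.submoduleOfEquivOfLe hle).symm
  have hc (i) : (c i : L) = ∑ k, Q k i • b' k := by
    apply Subtype.ext
    rw [Submodule.coe_sum]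
    exact hQ i
  have hkill (x : L) : ϖ • x ∈ N.submoduleOf L := by
    have hb (k) : ϖ • b' k ∈ N.submoduleOf L := by
      have h1 : ϖ • b' k = ∑ i, S i k • (c i : L) := by
        simp_rw [hc, Finset.smul_sum, smul_smul]
        rw [Finset.sum_comm]
        simp_rw [← Finset.sum_smul]
        have h2 (l) : ∑ i, S i k * Q l i = if l = k then ϖ else 0 := by
          have h3 := congrFun (congrFun hS l) k
          rw [Matrix.mul_apply, Matrix.scalar_apply, Matrix.diagonal_apply] at h3
          rw [← h3]
          exact Finset.sum_congr rfl fun i _ => mul_comm _ _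
        simp_rw [h2, ite_smul, zero_smul]
        rw [Finset.sum_ite_eq' Finset.univ k, if_pos (Finset.mem_univ _)]
      rw [h1]
      exact Submodule.sum_mem _ fun i _ => Submodule.smul_mem _ _ (c i).2
    rw [← b'.sum_repr x, Finset.smul_sum]
    refine Submodule.sum_mem _ fun k _ => ?_
    rw [smul_comm]
    exact Submodule.smul_mem _ _ (hb k)
  obtain ⟨m, hm, s', s, hs⟩ := exists_adapted_bases (irreducible_uniformizer hϖ) b'
    (N.submoduleOf L) hkill
  -- The determinant of the inclusion is well defined up to units: it is ϖ^m in the adapted bases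
  -- and det Q, of valuation j, in the given ones.
  have hmj : m = j := by
    have h1 := associated_det_of_bases s' b' s c _ hs
    have h2 : b'.toMatrix (fun i => (c i : L)) = Q := by
      ext i k
      rw [Module.Basis.toMatrix_apply, hc, b'.repr_sum_self]
    rw [h2, prod_typeVec hm] at h1
    obtain ⟨u, hu⟩ := h1
    have hu1 : 𝔭.intValuation (u : Fq[X]) = 1 := by
      rw [HeightOneSpectrum.intValuation_eq_one_iff]
      exact fun h => 𝔭.isPrime.ne_top (Ideal.eq_top_of_isUnit_mem _ h u.isUnit)
    rw [← hu, map_mul, hu1, mul_one, map_pow,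
      HeightOneSpectrum.intValuation_singleton 𝔭 (uniformizer_ne_zero hϖ) hϖ,
      ← WithZero.exp_nsmul, ← WithZero.exp_nsmul] at hdet
    have h3 := WithZero.exp_injective hdet
    simpa using h3
  subst hmj
  exact ⟨hle, nonempty_quotient_equiv_of_basis s' s _ hs⟩

/-- Adapted bases make the transition matrix equal to the diagonal matrix itself. It lies in its own
double coset at 𝔭 and is invertible at the other places. -/
theorem heckeRelated_of_equiv (hϖ : 𝔭.asIdeal = Ideal.span {ϖ}) {j : ℕ} (hj : j ≤ r)
    {N L : Submodule Fq[X] (Lie Fq n)} [Module.Finite Fq[X] L] [Module.Free Fq[X] L]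
    (hL : Module.finrank Fq[X] L = r) (hle : N ≤ L)
    (h : Nonempty ((L ⧸ N.submoduleOf L) ≃ₗ[Fq[X]] Π i, Fq[X] ⧸ Ideal.span {typeVec r j ϖ i})) :
    HeckeRelated r 𝔭 ϖ j N L := by
  classical
  obtain ⟨h1, h2, h3⟩ := (nonempty_equiv_typeVec_iff 𝔭 hϖ hj).mp h
  have hkill (x : L) : ϖ • x ∈ N.submoduleOf L := by
    rw [← Submodule.Quotient.mk_eq_zero, Submodule.Quotient.mk_smul]
    exact h1 _
  obtain ⟨m, hm, s', s, hs⟩ := exists_adapted_bases (irreducible_uniformizer hϖ)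
    (Module.finBasisOfFinrankEq Fq[X] L hL) (N.submoduleOf L) hkill
  obtain ⟨-, -, h4⟩ := (nonempty_equiv_typeVec_iff 𝔭 hϖ hm).mp
    (nonempty_quotient_equiv_of_basis s' s _ hs)
  have hmj : m = j := Nat.eq_of_mul_eq_mul_right (natDegree_uniformizer_pos hϖ) (h4.symm.trans h3)
  subst hmj
  refine ⟨s.map (Submodule.submoduleOfEquivOfLe hle), s',
    Matrix.diagonal fun i => algebraMap _ _ (typeVec r m ϖ i), fun i => ?_, fun v => ?_⟩
  · have h5 : ((s.map (Submodule.submoduleOfEquivOfLe hle)) i : Lie Fq n) = ((s i : L) : Lie Fq n) :=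
      rfl
    rw [h5, hs, Finset.sum_eq_single i]
    · rw [Matrix.diagonal_apply_eq, algebraMap_smul]
      rfl
    · intro k _ hk
      rw [Matrix.diagonal_apply_ne _ hk, zero_smul]
    · intro hi
      exact absurd (Finset.mem_univ i) hi
  · have h6 : (Matrix.diagonal fun i => algebraMap Fq[X] (RatFunc Fq) (typeVec r m ϖ i)).map
        (algebraMap (RatFunc Fq) (v.adicCompletion (RatFunc Fq))) =
        Matrix.diagonal fun i => algebraMap Fq[X] (v.adicCompletion (RatFunc Fq))
          (typeVec r m ϖ i) := by
      rw [Matrix.diagonal_map (map_zero _)]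
      rfl
    rw [h6]
    split_ifs with hvp
    · exact ⟨1, 1, by
        simp only [Units.val_one, Matrix.map_one _ (map_zero _) (map_one _), Matrix.mul_one,
          Matrix.one_mul]⟩
    · refine diagonal_mem_doubleCoset v _ fun i hi => ?_
      have h7 : ϖ ∈ v.asIdeal := Ideal.mem_of_dvd _ (typeVec_dvd r m ϖ i) hi
      apply hvp
      have h8 : 𝔭.asIdeal ≤ v.asIdeal := by
        rw [hϖ, Ideal.span_singleton_le_iff_mem]
        exact h7
      exact HeightOneSpectrum.ext (𝔭.isMaximal.eq_of_le v.isPrime.ne_top h8).symm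

end Lattices
end AndersonHecke
end

noncomputable section
namespace AndersonHecke

/-! ### Factoring morphisms and quotients of Anderson modules -/

section Homs

open AndersonModule

variable {Fq : Type*} [Field Fq] [Fintype Fq] {n : ℕ} {E E₁ E₂ : AndersonModule Fq n}

/-- Composition of morphisms. -/
def Hom.comp (β : Hom E₁ E₂) (α : Hom E E₁) : Hom E E₂ :=
  ⟨TauPoly.comp β.poly α.poly, fun z => by
    rw [TauPoly.eval_comp, TauPoly.eval_comp, α.comm, β.comm]⟩

theorem Hom.comp_onPoints (β : Hom E₁ E₂) (α : Hom E E₁) (w : E.Points) :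
    (β.comp α).onPoints w = β.onPoints (α.onPoints w) := by
  rw [Hom.onPoints_apply, Hom.onPoints_apply, Hom.onPoints_apply, LinearEquiv.symm_apply_apply]
  exact congrArg E₂.pt (TauPoly.eval_comp _ _ _)

theorem Hom.comp_differential (β : Hom E₁ E₂) (α : Hom E E₁) (z : Lie Fq n) :
    (β.comp α).differential z = β.differential (α.differential z) := by
  rw [Hom.differential_apply, Hom.differential_apply, Hom.differential_apply,
    Matrix.mulVec_mulVec]
  exact congrArg (· *ᵥ z) (TauPoly.comp_apply_zero _ _)

/-- Multiplication by `a` as an endomorphism of `E`. -/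
def AndersonModule.mulHom (E : AndersonModule Fq n) (a : Fq[X]) : Hom E E :=
  ⟨E.action a, fun z => by
    rw [eval_action, ← Module.End.mul_apply, ← Module.End.mul_apply]
    have h := congrArg (aeval E.T) (mul_comm a X)
    rw [map_mul, map_mul, aeval_X] at h
    rw [h]⟩

theorem AndersonModule.mulHom_onPoints (E : AndersonModule Fq n) (a : Fq[X]) (w : E.Points) :
    (E.mulHom a).onPoints w = a • w := by
  rw [Hom.onPoints_apply]
  refine (smul_pt' E a _).symm.trans ?_
  rw [LinearEquiv.apply_symm_apply]

theorem AndersonModule.mulHom_differential (E : AndersonModule Fq n) (a : Fq[X]) (z : Lie Fq n) :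
    (E.mulHom a).differential z = a • z := by
  rw [Hom.differential_apply, ← algebraMap_smul_lie]
  change E.action a 0 *ᵥ z = _
  rw [action_zero, Matrix.scalar_apply, ← Matrix.smul_one_eq_diagonal, Matrix.smul_mulVec,
    Matrix.one_mulVec]

theorem Hom.isUnit_poly_zero {α : Hom E E₁} {ι : Lie Fq n ≃ₗ[CInfty Fq] Lie Fq n}
    (h : ∀ z, α.differential z = ι z) : IsUnit (α.poly 0) := by
  rw [← Matrix.mulVec_injective_iff_isUnit]
  intro x y hxy
  refine ι.injective ?_
  rw [← h, ← h]
  exact hxy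

/-- A morphism that vanishes on the kernel of a separable isogeny factors through it. -/
theorem Hom.exists_factor (α : Hom E E₁) (hα : IsUnit (α.poly 0))
    (hs : Function.Surjective α.onPoints) (β : Hom E E₂)
    (h : LinearMap.ker α.onPoints ≤ LinearMap.ker β.onPoints) :
    ∃ γ : Hom E₁ E₂, (∀ w, γ.onPoints (α.onPoints w) = β.onPoints w) ∧
      ∀ z, γ.differential (α.differential z) = β.differential z := by
  obtain ⟨g, hg⟩ := exists_tauPoly_factor α.poly hα β.poly fun z hz => by
    have h1 : E.pt z ∈ LinearMap.ker β.onPoints := h (by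
      rw [LinearMap.mem_ker, Hom.onPoints_pt, hz, map_zero])
    rw [LinearMap.mem_ker, Hom.onPoints_pt] at h1
    exact (map_eq_zero_iff _ E₂.pt.injective).1 h1
  -- Equivariance is checked on images under α, which are all points because α is surjective.
  let γ : Hom E₁ E₂ := ⟨g, fun z => by
    obtain ⟨w, hw⟩ := hs (E₁.pt z)
    rw [Hom.onPoints_apply] at hw
    have hw' := E₁.pt.injective hw
    rw [← hw', ← α.comm, ← hg, ← hg, β.comm]⟩
  have h1 (w : E.Points) : γ.onPoints (α.onPoints w) = β.onPoints w := by
    rw [Hom.onPoints_apply, Hom.onPoints_apply, Hom.onPoints_apply, LinearEquiv.symm_apply_apply]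
    exact congrArg E₂.pt (hg _).symm
  refine ⟨γ, h1, fun z => ?_⟩
  rw [← Hom.comp_differential]
  exact LinearMap.congr_fun (Hom.differential_eq_of_onPoints_eq
    (LinearMap.ext fun w => (Hom.comp_onPoints _ _ _).trans (h1 w))) z

/-- Two separable isogenies with the same kernel differ by an isomorphism. -/
theorem Hom.exists_isIso_of_ker_eq (α : Hom E E₁) (hα : IsUnit (α.poly 0))
    (hs : Function.Surjective α.onPoints) (β : Hom E E₂) (hβ : IsUnit (β.poly 0))
    (hs' : Function.Surjective β.onPoints)
    (h : LinearMap.ker α.onPoints = LinearMap.ker β.onPoints) :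
    ∃ γ : Hom E₁ E₂, γ.IsIso ∧ ∀ z, γ.differential (α.differential z) = β.differential z := by
  obtain ⟨γ, h1, h2⟩ := α.exists_factor hα hs β h.le
  obtain ⟨γ', h1', -⟩ := β.exists_factor hβ hs' α h.ge
  refine ⟨γ, ⟨γ', fun z => ?_, fun z => ?_⟩, h2⟩
  · obtain ⟨w, rfl⟩ := hs z
    rw [h1, h1']
  · obtain ⟨w, rfl⟩ := hs' z
    rw [h1', h1]

/-- The quotient of an Anderson module by a finite submodule. -/
theorem AndersonModule.exists_quotient (E : AndersonModule Fq n) (W : Submodule Fq[X] E.Points)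
    [hW : Finite W] : ∃ (E' : AndersonModule Fq n) (α : Hom E E'),
      (∀ z, α.differential z = z) ∧ Function.Surjective α.onPoints ∧
      LinearMap.ker α.onPoints = W := by
  let W' : Submodule Fq (Fin n → CInfty Fq) :=
    (W.restrictScalars Fq).comap E.pt.toLinearMap
  have : Finite W' := Finite.of_injective (fun w : W' => (⟨E.pt w.1, w.2⟩ : W)) fun x y hxy =>
    Subtype.ext (E.pt.injective (congrArg Subtype.val hxy))
  obtain ⟨π, hπ0, hker, hsurj⟩ := exists_tauPoly_ker_eq W'
  -- As W is stable under φ_T, the map π φ_T kills ker π and equals g π. This g is the action on the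
  -- quotient, and its constant term is θ because that of π is 1.
  obtain ⟨g, hg⟩ := exists_tauPoly_factor π (by rw [hπ0]; exact isUnit_one)
    (TauPoly.comp π E.phi) fun z hz => by
      have hz' : z ∈ W' := by rw [← hker]; exact hz
      have h2 : E.T z ∈ W' := by
        have h3 : (X : Fq[X]) • E.pt z ∈ W := W.smul_mem _ hz'
        rwa [Module.AEval'.X_smul_of] at h3
      rw [← hker] at h2
      rw [TauPoly.eval_comp]
      exact h2
  have hg0 : g 0 = Matrix.scalar (Fin n) (theta Fq) := by
    have h1 : TauPoly.comp π E.phi 0 = TauPoly.comp g π 0 :=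
      TauPoly.apply_zero_eq_of_eval_eq fun z => by rw [hg, TauPoly.eval_comp]
    rw [TauPoly.comp_apply_zero, TauPoly.comp_apply_zero, hπ0, Matrix.one_mul, Matrix.mul_one,
      E.phi_zero] at h1
    exact h1.symm
  let E' : AndersonModule Fq n := ⟨g, hg0⟩
  let α : Hom E E' := ⟨π, fun z => (TauPoly.eval_comp π E.phi z).symm.trans (hg z)⟩
  refine ⟨E', α, fun z => ?_, fun w => ?_, ?_⟩
  · rw [Hom.differential_apply]
    change π 0 *ᵥ z = z
    rw [hπ0, Matrix.one_mulVec]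
  · obtain ⟨z, hz⟩ := hsurj (E'.pt.symm w)
    exact ⟨E.pt z, by rw [Hom.onPoints_pt]; exact (congrArg E'.pt hz).trans (by simp)⟩
  · ext w
    obtain ⟨z, rfl⟩ := E.pt.surjective w
    rw [LinearMap.mem_ker, Hom.onPoints_pt, map_eq_zero_iff _ E'.pt.injective]
    change π.eval z = 0 ↔ z ∈ W'
    rw [← hker, LinearMap.mem_ker]

end Homs

/-! ### Invariance of the rank -/

section Pullback

open AndersonModule

variable {Fq : Type*} [Field Fq] [Fintype Fq] {n : ℕ} {E E' : AndersonModule Fq n}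

/-- Pullback of motives. -/
def Hom.pullback (α : Hom E E') : E'.Motive →ₗ[(CInfty Fq)[X]] E.Motive :=
  LinearMap.ofAEval _ ((Motive.toFun E).symm.toLinearMap ∘ₗ
    (LinearMap.funLeft (CInfty Fq) (CInfty Fq) α.poly.eval).restrict
      fun _ hf => α.poly.comp_mem_motiveSpace hf) fun f => by
    refine Eq.trans ?_ (Module.AEval'.X_smul_of _ _).symm
    refine congrArg (Motive.toFun E).symm (Subtype.ext (funext fun z => ?_))
    exact congrArg f.1 (α.comm z).symm

theorem Hom.toFun_pullback (α : Hom E E') (μ : E'.Motive) (z : Fin n → CInfty Fq) :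
    (Motive.toFun E (α.pullback μ)).1 z = (Motive.toFun E' μ).1 (α.poly.eval z) := rfl

theorem Hom.pullback_injective {α : Hom E E'} (hs : Function.Surjective α.onPoints) :
    Function.Injective α.pullback := by
  intro μ ν h
  refine (Motive.toFun E').injective (Subtype.ext (funext fun z => ?_))
  obtain ⟨w, hw⟩ := hs (E'.pt z)
  rw [Hom.onPoints_apply] at hw
  rw [← E'.pt.injective hw, ← Hom.toFun_pullback, h, Hom.toFun_pullback]

/-- A submodule of a finite free module over a PID is finite and torsion-free, hence free; the two
embeddings bound the ranks in both directions. -/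
theorem free_of_injective_of_injective {R M N : Type*} [CommRing R] [IsDomain R]
    [IsPrincipalIdealRing R] [AddCommGroup M] [Module R M] [AddCommGroup N] [Module R N]
    [Module.Finite R M] [Module.Free R M] {f : N →ₗ[R] M} (hf : Function.Injective f)
    {g : M →ₗ[R] N} (hg : Function.Injective g) :
    Module.Finite R N ∧ Module.Free R N ∧ Module.finrank R N = Module.finrank R M := by
  have hfin : Module.Finite R N := Module.Finite.of_injective _ hf
  have htf : Module.IsTorsionFree R N := hf.moduleIsTorsionFree _ fun c x => map_smul f c x
  exact ⟨hfin, Module.free_of_finite_type_torsion_free',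
    le_antisymm (LinearMap.finrank_le_finrank_of_injective hf)
      (LinearMap.finrank_le_finrank_of_injective hg)⟩

/-- The rank is an isogeny invariant. -/
theorem AndersonModule.HasRank.of_surjective {r : ℕ} (hr : E.HasRank r) {α : Hom E E'}
    {β : Hom E' E} (hα : Function.Surjective α.onPoints) (hβ : Function.Surjective β.onPoints) :
    E'.HasRank r := by
  have := hr.finite
  have := hr.free
  obtain ⟨h1, h2, h3⟩ := free_of_injective_of_injective (M := E.Motive) (N := E'.Motive)
    (Hom.pullback_injective hα) (Hom.pullback_injective hβ)
  exact ⟨h1, h2, h3.trans hr.finrank_eq⟩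

end Pullback

/-! ### Transport of the exponential along an isogeny -/

section Uniformization

open AndersonModule

variable {Fq : Type*} [Field Fq] [Fintype Fq] {n : ℕ} {E E' : AndersonModule Fq n}
  {e : Lie Fq n →ₗ[Fq[X]] E.Points}

theorem continuous_frob (j : ℕ) : Continuous (frob Fq (n := n) j) := by
  refine continuous_pi fun k => ?_
  simp_rw [frob_apply]
  exact (continuous_apply k).pow _

/-- The coefficient of τ^k is the sum over j ≤ k of P_j B_{k-j} D, with B_{k-j} twisted by q^j and D
by q^k. It serves to make α ∘ exp ∘ ι⁻¹ a convergent series in τ. -/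
theorem frob_series_comp {B : ℕ → Matrix (Fin n) (Fin n) (CInfty Fq)}
    {D : Matrix (Fin n) (Fin n) (CInfty Fq)} (P : TauPoly Fq n n) {y : Lie Fq n → Lie Fq n}
    (h : ∀ z, HasSum (fun i => B i *ᵥ frob Fq i z) (y z)) :
    ∃ B' : ℕ → Matrix (Fin n) (Fin n) (CInfty Fq), B' 0 = P 0 * B 0 * D ∧
      ∀ z, HasSum (fun i => B' i *ᵥ frob Fq i z) (P.eval (y (D *ᵥ z))) := by
  let pw (j : ℕ) (A : Matrix (Fin n) (Fin n) (CInfty Fq)) := A.map (· ^ (Fintype.card Fq ^ j))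
  let c (j k : ℕ) : Matrix (Fin n) (Fin n) (CInfty Fq) :=
    if j ≤ k then P j * pw j (B (k - j)) * pw k D else 0
  refine ⟨fun k => ∑ j ∈ P.support, c j k, ?_, fun z => ?_⟩
  · have hpw (A : Matrix (Fin n) (Fin n) (CInfty Fq)) : pw 0 A = A := by
      ext; simp [pw]
    have h0 : c 0 0 = P 0 * B 0 * D := by
      simp only [c, le_refl, if_true, hpw, Nat.sub_zero]
    rw [← h0]
    refine Finset.sum_eq_single 0 (fun j _ hj => ?_) fun h => ?_
    · simp only [c]
      rw [if_neg (by omega)]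
    · rw [Finsupp.notMem_support_iff] at h
      rw [h0, h, Matrix.zero_mul, Matrix.zero_mul]
  · rw [TauPoly.eval_apply]
    simp_rw [Matrix.sum_mulVec]
    refine hasSum_sum fun j _ => ?_
    have h1 := ((h (D *ᵥ z)).map (frob Fq j) (continuous_frob j)).map (P j).mulVecLin
      (Continuous.matrix_mulVec continuous_const continuous_id)
    rw [Matrix.mulVecLin_apply] at h1
    refine ((add_left_injective j).hasSum_iff ?_).mp (h1.congr_fun ?_)
    · intro k hk
      have : ¬ j ≤ k := fun hjk => hk ⟨k - j, Nat.sub_add_cancel hjk⟩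
      simp only [c]
      rw [if_neg this, Matrix.zero_mulVec]
    · intro i
      simp only [Function.comp_apply, c]
      rw [if_pos (Nat.le_add_left j i), Nat.add_sub_cancel, Matrix.mulVecLin_apply,
        TauPoly.frob_mulVec, TauPoly.frob_frob, TauPoly.frob_mulVec, add_comm j i,
        Matrix.mulVec_mulVec, Matrix.mulVec_mulVec]

/-- The target of a separable isogeny from a uniformizable module is uniformizable. -/
theorem AndersonModule.IsUniformization.exists_of_hom (he : E.IsUniformization e) {α : Hom E E'}
    {ι : Lie Fq n ≃ₗ[CInfty Fq] Lie Fq n} (hι : ∀ z, α.differential z = ι z)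
    (hs : Function.Surjective α.onPoints) :
    ∃ e' : Lie Fq n →ₗ[Fq[X]] E'.Points, E'.IsUniformization e' := by
  let e' : Lie Fq n →ₗ[Fq[X]] E'.Points :=
    α.onPoints ∘ₗ e ∘ₗ ι.symm.toLinearMap.restrictScalars Fq[X]
  have he' (z) : e' z = α.onPoints (e (ι.symm z)) := rfl
  refine ⟨e', ?_, fun w => ?_⟩
  · obtain ⟨B, hB0, hB⟩ := he.isExponential
    obtain ⟨B', hB0', hB'⟩ := frob_series_comp (D := LinearMap.toMatrix' ι.symm.toLinearMap)
      α.poly hB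
    refine ⟨B', ?_, fun z => ?_⟩
    -- The leading coefficient is dα · 1 · ι⁻¹, which is the identity since dα = ι.
    · rw [hB0', hB0, Matrix.mul_one]
      have h1 : α.poly 0 = LinearMap.toMatrix' ι.toLinearMap := by
        rw [← LinearMap.toMatrix'_toLin' (α.poly 0)]
        exact congrArg _ (LinearMap.ext hι)
      rw [h1, ← LinearMap.toMatrix'_comp, LinearEquiv.comp_symm, LinearMap.toMatrix'_id]
    · have h2 := hB' z
      rw [LinearMap.toMatrix'_mulVec] at h2
      exact h2
  · obtain ⟨v, rfl⟩ := hs w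
    obtain ⟨z, rfl⟩ := he.surjective v
    exact ⟨ι z, by rw [he', LinearEquiv.symm_apply_apply]⟩

theorem AndersonModule.IsUniformization.smul_surjective (he : E.IsUniformization e) {a : Fq[X]}
    (ha : a ≠ 0) (w : E.Points) : ∃ w', a • w' = w := by
  obtain ⟨z, rfl⟩ := he.surjective w
  exact ⟨e ((algebraMap Fq[X] (CInfty Fq) a)⁻¹ • z), by rw [← map_smul, smul_inv_smul_lie ha]⟩

end Uniformization

end AndersonHecke
end

noncomputable section
namespace AndersonHecke

/-! ### Hecke points are isogenies of the prescribed type -/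

section Points

open AndersonModule

variable {Fq : Type*} [Field Fq] [Fintype Fq] {n r : ℕ} {𝔭 : HeightOneSpectrum Fq[X]} {ϖ : Fq[X]}
  {E E' : AndersonModule Fq n} {e : Lie Fq n →ₗ[Fq[X]] E.Points} {e' : Lie Fq n →ₗ[Fq[X]] E'.Points}
  {ι : Lie Fq n ≃ₗ[CInfty Fq] Lie Fq n}

/-- The kernel of an isogeny is the quotient of the period lattices. -/
theorem Hom.exists_quotient_equiv_ker (he : Function.Surjective e) (α : Hom E E')
    (h : ∀ z, α.onPoints (e z) = e' (ι z)) :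
    Nonempty ((LinearMap.ker e' ⧸ ((LinearMap.ker e).map
      (ι.toLinearMap.restrictScalars Fq[X])).submoduleOf (LinearMap.ker e')) ≃ₗ[Fq[X]]
        LinearMap.ker α.onPoints) := by
  -- A period z of E' goes to exp(ι⁻¹ z), which α sends to exp'(z) = 0.
  let f : LinearMap.ker e' →ₗ[Fq[X]] LinearMap.ker α.onPoints :=
    ((e ∘ₗ ι.symm.toLinearMap.restrictScalars Fq[X]) ∘ₗ (LinearMap.ker e').subtype).codRestrict _
      fun z => by
        rw [LinearMap.mem_ker]
        refine (h (ι.symm z)).trans ?_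
        rw [LinearEquiv.apply_symm_apply]
        exact z.2
  have hf : Function.Surjective f := by
    rintro ⟨w, hw⟩
    obtain ⟨z, rfl⟩ := he w
    rw [LinearMap.mem_ker, h] at hw
    refine ⟨⟨ι z, hw⟩, Subtype.ext ?_⟩
    change e (ι.symm (ι z)) = e z
    rw [LinearEquiv.symm_apply_apply]
  have hker : LinearMap.ker f = ((LinearMap.ker e).map
      (ι.toLinearMap.restrictScalars Fq[X])).submoduleOf (LinearMap.ker e') := by
    ext z
    have h1 : z ∈ LinearMap.ker f ↔ e (ι.symm z) = 0 :=
      ⟨fun hz => congrArg Subtype.val (LinearMap.mem_ker.mp hz),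
        fun hz => LinearMap.mem_ker.mpr (Subtype.ext hz)⟩
    rw [h1, Submodule.submoduleOf, Submodule.mem_comap, Submodule.mem_map]
    constructor
    · intro hz
      exact ⟨ι.symm z, hz, ι.apply_symm_apply _⟩
    · rintro ⟨y, hy, hyz⟩
      have h2 : ι y = z := hyz
      rw [← h2, LinearEquiv.symm_apply_apply]
      exact hy
  obtain ⟨Φ, -⟩ := exists_quotient_equiv_of_surjective (M := LinearMap.ker e')
    (N := LinearMap.ker α.onPoints) f hf hker
  exact ⟨Φ⟩

theorem finite_of_equiv_typeVec (hϖ : 𝔭.asIdeal = Ideal.span {ϖ}) {j : ℕ} (hj : j ≤ r)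
    {α : Hom E E'} (h : α.HasType (typeVec r j ϖ)) : Finite (LinearMap.ker α.onPoints) := by
  obtain ⟨-, h2, -⟩ := (nonempty_equiv_typeVec_iff 𝔭 hϖ hj
    (N := LinearMap.ker α.onPoints)).mp h
  exact Module.finite_of_finite Fq

/-- Only a multiple cι is known to come from an isogeny β. Integrality ι(L) ⊆ L' forces β to vanish
on E[c], so β is divisible by φ_c, and the quotient has differential ι. -/
theorem IsHeckePoint.exists_isogeny (hϖ : 𝔭.asIdeal = Ideal.span {ϖ}) {j : ℕ} (hj : j ≤ r)
    (h : IsHeckePoint r 𝔭 ϖ j E E' ι) : ∃ α : Hom E E', α.IsIsogeny ∧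
      α.HasType (typeVec r j ϖ) ∧ α.differential = ι.toLinearMap := by
  obtain ⟨⟨c, β, hc, hβ, hβι⟩, e, e', he, he', hH⟩ := h
  obtain ⟨hle, ⟨Φ⟩⟩ := hH.le_and_nonempty_equiv hϖ hj
  obtain ⟨α, hα, hαd⟩ := (E.mulHom c).exists_factor (isUnit_action_zero E hc)
    (fun w => by
      obtain ⟨w', hw'⟩ := he.smul_surjective hc w
      exact ⟨w', (E.mulHom_onPoints c w').trans hw'⟩) β fun w hw => by
        rw [LinearMap.mem_ker, mulHom_onPoints] at hw
        obtain ⟨z, rfl⟩ := he.surjective w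
        rw [← map_smul] at hw
        rw [LinearMap.mem_ker, β.onPoints_exp he.isExponential he'.isExponential, hβι]
        have h1 : ι (c • z) ∈ LinearMap.ker e' := hle ⟨c • z, hw, rfl⟩
        have h2 : ι (c • z) = c • ι z := map_smul (ι.toLinearMap.restrictScalars Fq[X]) c z
        rw [← h2]
        exact h1
  have hαι (z) : α.differential z = ι z := by
    have h1 := hαd ((algebraMap Fq[X] (CInfty Fq) c)⁻¹ • z)
    rw [mulHom_differential, hβι, smul_inv_smul_lie hc, map_smul, smul_inv_smul_lie hc] at h1
    exact h1
  have hexp (z) : α.onPoints (e z) = e' (ι z) := by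
    rw [α.onPoints_exp he.isExponential he'.isExponential, hαι]
  obtain ⟨Θ⟩ := α.exists_quotient_equiv_ker he.surjective hexp
  have hT : α.HasType (typeVec r j ϖ) := ⟨Θ.symm.trans Φ⟩
  refine ⟨α, ⟨fun w => ?_, finite_of_equiv_typeVec hϖ hj hT⟩, hT, LinearMap.ext hαι⟩
  obtain ⟨z, rfl⟩ := he'.surjective w
  exact ⟨e (ι.symm z), by rw [hexp, LinearEquiv.apply_symm_apply]⟩

/-- Here c = 1, E' inherits an exponential through α, and L'/ι(L) ≅ ker α turns the type of α into
the relative position of the lattices. -/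
theorem Hom.isHeckePoint (hϖ : 𝔭.asIdeal = Ideal.span {ϖ}) {j : ℕ} (hj : j ≤ r)
    (he : E.IsUniformization e) (hr' : E'.HasRank r) {α : Hom E E'} (hα : α.IsIsogeny)
    (hT : α.HasType (typeVec r j ϖ)) (hd : α.differential = ι.toLinearMap) :
    IsHeckePoint r 𝔭 ϖ j E E' ι := by
  have hι (z) : α.differential z = ι z := by rw [hd]; rfl
  obtain ⟨e', he'⟩ := he.exists_of_hom hι hα.surjective
  have hexp (z) : α.onPoints (e z) = e' (ι z) := by
    rw [α.onPoints_exp he.isExponential he'.isExponential, hι]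
  refine ⟨⟨1, α, one_ne_zero, hα, fun z => by rw [hι, one_smul]⟩, e, e', he, he', ?_⟩
  obtain ⟨h1, h2, h3⟩ := hr'.periodLattice he'
  obtain ⟨Φ⟩ := hT
  obtain ⟨Θ⟩ := α.exists_quotient_equiv_ker he.surjective hexp
  refine heckeRelated_of_equiv hϖ hj h3 ?_ ⟨Θ.trans Φ⟩
  rintro _ ⟨z, hz, rfl⟩
  have h4 : e z = 0 := hz
  rw [LinearMap.mem_ker]
  refine (hexp z).symm.trans ?_
  rw [h4, map_zero]

theorem isHeckePoint_iff (hϖ : 𝔭.asIdeal = Ideal.span {ϖ}) {j : ℕ} (hj : j ≤ r)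
    (he : E.IsUniformization e) (hr' : E'.HasRank r) :
    IsHeckePoint r 𝔭 ϖ j E E' ι ↔ ∃ α : Hom E E', α.IsIsogeny ∧
      α.HasType (typeVec r j ϖ) ∧ α.differential = ι.toLinearMap :=
  ⟨fun h => h.exists_isogeny hϖ hj, fun ⟨_, h1, h2, h3⟩ => Hom.isHeckePoint hϖ hj he hr' h1 h2 h3⟩

theorem exists_isHeckePoint_iff (hϖ : 𝔭.asIdeal = Ideal.span {ϖ}) {j : ℕ} (hj : j ≤ r)
    (he : E.IsUniformization e) (hr' : E'.HasRank r) :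
    (∃ ι, IsHeckePoint r 𝔭 ϖ j E E' ι) ↔
      ∃ α : Hom E E', α.IsIsogeny ∧ α.HasType (typeVec r j ϖ) := by
  constructor
  · rintro ⟨ι, h⟩
    obtain ⟨α, h1, h2, -⟩ := h.exists_isogeny hϖ hj
    exact ⟨α, h1, h2⟩
  · rintro ⟨α, h1, h2⟩
    -- An isogeny with no prescribed marking supplies its own: its differential is injective, hence
    -- bijective on C_∞^n.
    exact ⟨LinearEquiv.ofInjectiveEndo α.differential (h1.differential_injective he.isExponential),
      Hom.isHeckePoint hϖ hj he hr' h1 h2 (by ext; rfl)⟩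

end Points

/-! ### Subspaces of the torsion as submodules of the points -/

section Subspaces

open AndersonModule

variable {Fq : Type*} [Field Fq] [Fintype Fq] {n r : ℕ} {𝔭 : HeightOneSpectrum Fq[X]} {ϖ : Fq[X]}
  {E : AndersonModule Fq n}

/-- A subspace of the torsion as a submodule of the points. -/
def torsionImage (W : Submodule (Fq[X] ⧸ 𝔭.asIdeal) (E.torsion 𝔭)) : Submodule Fq[X] E.Points :=
  (W.restrictScalars Fq[X]).map (E.torsion 𝔭).subtype

theorem mem_torsionImage {W : Submodule (Fq[X] ⧸ 𝔭.asIdeal) (E.torsion 𝔭)} (w : E.torsion 𝔭) :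
    (w : E.Points) ∈ torsionImage W ↔ w ∈ W :=
  ⟨fun ⟨v, hv, hvw⟩ => by
    have h : v = w := Subtype.ext hvw
    exact h ▸ hv, fun h => ⟨w, h, rfl⟩⟩

theorem torsionImage_le_iff {W W' : Submodule (Fq[X] ⧸ 𝔭.asIdeal) (E.torsion 𝔭)} :
    torsionImage W ≤ torsionImage W' ↔ W ≤ W' := by
  refine ⟨fun h w hw => (mem_torsionImage w).mp (h ((mem_torsionImage w).mpr hw)), fun h => ?_⟩
  rintro _ ⟨w, hw, rfl⟩
  exact (mem_torsionImage w).mpr (h hw)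

theorem torsionImage_injective :
    Function.Injective (torsionImage (𝔭 := 𝔭) (E := E)) := fun _ _ h =>
  le_antisymm (torsionImage_le_iff.mp h.le) (torsionImage_le_iff.mp h.ge)

theorem smul_eq_zero_of_mem_torsionImage (hϖ : 𝔭.asIdeal = Ideal.span {ϖ})
    {W : Submodule (Fq[X] ⧸ 𝔭.asIdeal) (E.torsion 𝔭)} {w : E.Points} (hw : w ∈ torsionImage W) :
    ϖ • w = 0 := by
  obtain ⟨w, -, rfl⟩ := hw
  exact (mem_torsion_iff hϖ).mp w.2

theorem exists_torsionImage_eq (hϖ : 𝔭.asIdeal = Ideal.span {ϖ}) {P : Submodule Fq[X] E.Points}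
    (hP : ∀ w ∈ P, ϖ • w = 0) :
    ∃ W : Submodule (Fq[X] ⧸ 𝔭.asIdeal) (E.torsion 𝔭), torsionImage W = P := by
  let W : Submodule (Fq[X] ⧸ 𝔭.asIdeal) (E.torsion 𝔭) :=
    { (P.comap (E.torsion 𝔭).subtype).toAddSubmonoid with
      smul_mem' := fun c x hx => by
        obtain ⟨c, rfl⟩ := Ideal.Quotient.mk_surjective c
        exact P.smul_mem c hx }
  refine ⟨W, le_antisymm ?_ fun w hw => ⟨⟨w, (mem_torsion_iff hϖ).mpr (hP w hw)⟩, hw, rfl⟩⟩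
  rintro _ ⟨w, hw, rfl⟩
  exact hw

/-- A module killed by ϖ is determined by its F_q-dimension, which is deg ϖ times the dimension over
A/𝔭. -/
theorem finrank_eq_iff_torsionImage (hϖ : 𝔭.asIdeal = Ideal.span {ϖ}) (hr : E.HasRank r) {j : ℕ}
    (hj : j ≤ r) (W : Submodule (Fq[X] ⧸ 𝔭.asIdeal) (E.torsion 𝔭)) :
    Module.finrank (Fq[X] ⧸ 𝔭.asIdeal) W = j ↔
      Nonempty (torsionImage W ≃ₗ[Fq[X]] Π i, Fq[X] ⧸ Ideal.span {typeVec r j ϖ i}) := by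
  have := finite_torsion hϖ hr
  have : Finite (E.torsion 𝔭) := Module.finite_of_finite Fq
  let φ : W.restrictScalars Fq ≃ₗ[Fq] torsionImage W :=
    ((Submodule.equivMapOfInjective (E.torsion 𝔭).subtype (Submodule.subtype_injective _)
      (W.restrictScalars Fq[X])).restrictScalars Fq)
  have h1 : Module.finrank Fq W = Module.finrank (Fq[X] ⧸ 𝔭.asIdeal) W * ϖ.natDegree :=
    finrank_eq_mul_finrank 𝔭 hϖ
  have h2 : Module.finrank Fq W = Module.finrank Fq (torsionImage W) := φ.finrank_eq
  have h3 : Module.Finite Fq (torsionImage W) := Module.Finite.equiv φ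
  rw [nonempty_equiv_typeVec_iff 𝔭 hϖ hj (N := torsionImage W)]
  constructor
  · rintro rfl
    exact ⟨fun x => Subtype.ext (smul_eq_zero_of_mem_torsionImage hϖ x.2), h3, h2.symm.trans h1⟩
  · rintro ⟨-, -, h4⟩
    exact Nat.eq_of_mul_eq_mul_right (natDegree_uniformizer_pos hϖ)
      (h1.symm.trans (h2.trans h4))

/-- Subspaces of the same finite dimension that are comparable are equal. -/
theorem eq_of_torsionImage_le (hϖ : 𝔭.asIdeal = Ideal.span {ϖ}) (hr : E.HasRank r)
    {W W' : Submodule (Fq[X] ⧸ 𝔭.asIdeal) (E.torsion 𝔭)} (h : torsionImage W ≤ torsionImage W')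
    (hd : Module.finrank (Fq[X] ⧸ 𝔭.asIdeal) W = Module.finrank (Fq[X] ⧸ 𝔭.asIdeal) W') :
    W = W' := by
  have := 𝔭.isMaximal
  have := finite_torsion' hϖ hr
  let : Field (Fq[X] ⧸ 𝔭.asIdeal) := Ideal.Quotient.field _
  exact Submodule.eq_of_le_of_finrank_eq (torsionImage_le_iff.mp h) hd

end Subspaces

/-! ### The fibre of the Hecke correspondence and kernels -/

section Fibre

open AndersonModule

variable {Fq : Type*} [Field Fq] [Fintype Fq] {n r : ℕ} {𝔭 : HeightOneSpectrum Fq[X]} {ϖ : Fq[X]}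
  {E : AndersonModule Fq n} {e : Lie Fq n →ₗ[Fq[X]] E.Points} {j : ℕ}

/-- `α` is the isogeny of the point `x`. -/
structure HeckePoint.IsIsogenyOf (x : HeckePoint r 𝔭 ϖ j E) (α : Hom E x.target) : Prop where
  isIsogeny : α.IsIsogeny
  hasType : α.HasType (typeVec r j ϖ)
  differential_eq : α.differential = x.marking.toLinearMap

namespace HeckePoint

theorem exists_isIsogenyOf (hϖ : 𝔭.asIdeal = Ideal.span {ϖ}) (hj : j ≤ r)
    (x : HeckePoint r 𝔭 ϖ j E) : ∃ α : Hom E x.target, x.IsIsogenyOf α := by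
  obtain ⟨α, h1, h2, h3⟩ := x.isHeckePoint.exists_isogeny hϖ hj
  exact ⟨α, h1, h2, h3⟩

variable {x y : HeckePoint r 𝔭 ϖ j E} {α : Hom E x.target} {β : Hom E y.target}

theorem IsIsogenyOf.differential_apply (hα : x.IsIsogenyOf α) (z : Lie Fq n) :
    α.differential z = x.marking z := by rw [hα.differential_eq]; rfl

theorem IsIsogenyOf.isUnit_poly_zero (hα : x.IsIsogenyOf α) : IsUnit (α.poly 0) :=
  Hom.isUnit_poly_zero hα.differential_apply

theorem IsIsogenyOf.smul_eq_zero (hϖ : 𝔭.asIdeal = Ideal.span {ϖ}) (hj : j ≤ r)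
    (hα : x.IsIsogenyOf α) {w : E.Points} (hw : w ∈ LinearMap.ker α.onPoints) : ϖ • w = 0 := by
  obtain ⟨h, -, -⟩ := (nonempty_equiv_typeVec_iff 𝔭 hϖ hj (N := LinearMap.ker α.onPoints)).mp
    hα.hasType
  exact congrArg Subtype.val (h ⟨w, hw⟩)

/-- Equivalent points have the same kernel. -/
theorem IsIsogenyOf.ker_eq_of_differential (he : E.IsUniformization e) (hα : x.IsIsogenyOf α)
    (hβ : y.IsIsogenyOf β) {γ : Hom x.target y.target} (hγ : γ.IsIso)
    (h : ∀ z, γ.differential (x.marking z) = y.marking z) :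
    LinearMap.ker α.onPoints = LinearMap.ker β.onPoints := by
  -- γα and β have the same differential, so rigidity makes them equal on points.
  have h1 : (γ.comp α).onPoints = β.onPoints :=
    Hom.onPoints_eq_of_differential_eq he (LinearMap.ext fun z => by
      rw [Hom.comp_differential, hα.differential_apply, h, hβ.differential_apply])
  obtain ⟨δ, hδ, -⟩ := hγ
  ext w
  rw [LinearMap.mem_ker, LinearMap.mem_ker, ← h1, Hom.comp_onPoints]
  constructor
  · intro hw
    rw [hw, map_zero]
  · intro hw
    rw [← hδ (α.onPoints w), hw, map_zero]

theorem IsIsogenyOf.equiv_of_ker_eq (hα : x.IsIsogenyOf α) (hβ : y.IsIsogenyOf β)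
    (h : LinearMap.ker α.onPoints = LinearMap.ker β.onPoints) : x.Equiv y := by
  obtain ⟨γ, h1, h2⟩ := α.exists_isIso_of_ker_eq hα.isUnit_poly_zero hα.isIsogeny.surjective β
    hβ.isUnit_poly_zero hβ.isIsogeny.surjective h
  refine ⟨γ, h1, fun z => ?_⟩
  rw [← hα.differential_apply, h2, hβ.differential_apply]

/-- The subspace of the torsion attached to a point: the kernel of its isogeny. -/
theorem exists_subspace (hϖ : 𝔭.asIdeal = Ideal.span {ϖ}) (hr : E.HasRank r) (hj : j ≤ r)
    (he : E.IsUniformization e) (x : HeckePoint r 𝔭 ϖ j E) :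
    ∃ W : {W : Submodule (Fq[X] ⧸ 𝔭.asIdeal) (E.torsion 𝔭) //
        Module.finrank (Fq[X] ⧸ 𝔭.asIdeal) W = j},
      ∀ α : Hom E x.target, x.IsIsogenyOf α → torsionImage W.1 = LinearMap.ker α.onPoints := by
  obtain ⟨α, hα⟩ := x.exists_isIsogenyOf hϖ hj
  obtain ⟨W, hW⟩ := exists_torsionImage_eq hϖ fun w hw => hα.smul_eq_zero hϖ hj hw
  refine ⟨⟨W, (finrank_eq_iff_torsionImage hϖ hr hj W).mpr ?_⟩, fun β hβ => hW.trans ?_⟩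
  · rw [hW]
    exact hα.hasType
  · rw [Hom.onPoints_eq_of_differential_eq (β := β) he
      (hα.differential_eq.trans hβ.differential_eq.symm)]

/-- Every subspace is the kernel of the isogeny of a point. -/
theorem exists_of_subspace (hϖ : 𝔭.asIdeal = Ideal.span {ϖ}) (hr : E.HasRank r) (hj : j ≤ r)
    (he : E.IsUniformization e) (W : Submodule (Fq[X] ⧸ 𝔭.asIdeal) (E.torsion 𝔭))
    (hW : Module.finrank (Fq[X] ⧸ 𝔭.asIdeal) W = j) :
    ∃ (x : HeckePoint r 𝔭 ϖ j E) (α : Hom E x.target), x.IsIsogenyOf α ∧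
      LinearMap.ker α.onPoints = torsionImage W := by
  have hT := (finrank_eq_iff_torsionImage hϖ hr hj W).mp hW
  have := finite_torsion hϖ hr
  have : Finite (E.torsion 𝔭) := Module.finite_of_finite Fq
  have : Finite (torsionImage W) := Finite.of_surjective
    (fun w : W => (⟨w.1, (mem_torsionImage w.1).mpr w.2⟩ : torsionImage W)) fun ⟨w, hw⟩ => by
      obtain ⟨v, hv, rfl⟩ := hw
      exact ⟨⟨v, hv⟩, rfl⟩
  obtain ⟨E', α, hd, hs, hker⟩ := E.exists_quotient (torsionImage W)
  have hisog : α.IsIsogeny := ⟨hs, by rw [hker]; infer_instance⟩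
  have htype : α.HasType (typeVec r j ϖ) := by
    rw [Hom.HasType, hker]
    exact hT
  have hd' : α.differential = (LinearEquiv.refl (CInfty Fq) (Lie Fq n)).toLinearMap :=
    LinearMap.ext hd
  -- Multiplication by ϖ kills W and factors as βα. Its surjectivity passes to β, so motives embed
  -- both ways and the quotient has rank r.
  obtain ⟨β, hβ, -⟩ := α.exists_factor
    (Hom.isUnit_poly_zero (ι := LinearEquiv.refl (CInfty Fq) (Lie Fq n)) hd) hs (E.mulHom ϖ)
    fun w hw => by
      rw [hker] at hw
      rw [LinearMap.mem_ker, mulHom_onPoints]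
      exact smul_eq_zero_of_mem_torsionImage hϖ hw
  have hr' : E'.HasRank r := hr.of_surjective hs (β := β) fun w => by
    obtain ⟨w', rfl⟩ := he.smul_surjective (uniformizer_ne_zero hϖ) w
    exact ⟨α.onPoints w', by rw [hβ, mulHom_onPoints]⟩
  exact ⟨⟨E', hr', LinearEquiv.refl _ _, Hom.isHeckePoint hϖ hj he hr' hisog htype hd'⟩, α,
    ⟨hisog, htype, hd'⟩, hker⟩

/-- The bijection between the fibre of the Hecke correspondence and the subspaces of the torsion. -/
theorem exists_equiv_subspaces (hϖ : 𝔭.asIdeal = Ideal.span {ϖ}) (hr : E.HasRank r) (hj : j ≤ r)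
    (he : E.IsUniformization e) :
    ∃ Ψ : HeckeFibre r 𝔭 ϖ j E ≃ {W : Submodule (Fq[X] ⧸ 𝔭.asIdeal) (E.torsion 𝔭) //
        Module.finrank (Fq[X] ⧸ 𝔭.asIdeal) W = j},
      ∀ (x : HeckePoint r 𝔭 ϖ j E) (α : Hom E x.target), x.IsIsogenyOf α →
        torsionImage (Ψ (Quot.mk _ x)).1 = LinearMap.ker α.onPoints := by
  choose f hf using exists_subspace (𝔭 := 𝔭) (j := j) hϖ hr hj he
  have hresp (x y : HeckePoint r 𝔭 ϖ j E) (h : x.Equiv y) : f x = f y := by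
    obtain ⟨α, hα⟩ := x.exists_isIsogenyOf hϖ hj
    obtain ⟨β, hβ⟩ := y.exists_isIsogenyOf hϖ hj
    obtain ⟨γ, h1, h2⟩ := h
    exact Subtype.ext (torsionImage_injective
      ((hf x α hα).trans ((hα.ker_eq_of_differential he hβ h1 h2).trans (hf y β hβ).symm)))
  let g : HeckeFibre r 𝔭 ϖ j E → {W : Submodule (Fq[X] ⧸ 𝔭.asIdeal) (E.torsion 𝔭) //
      Module.finrank (Fq[X] ⧸ 𝔭.asIdeal) W = j} := Quot.lift f hresp
  have hg : Function.Bijective g := by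
    constructor
    · rintro ⟨x⟩ ⟨y⟩ hxy
      have hxy' : f x = f y := hxy
      obtain ⟨α, hα⟩ := x.exists_isIsogenyOf hϖ hj
      obtain ⟨β, hβ⟩ := y.exists_isIsogenyOf hϖ hj
      refine Quot.sound (hα.equiv_of_ker_eq hβ ?_)
      rw [← hf x α hα, hxy', hf y β hβ]
    · rintro ⟨W, hW⟩
      obtain ⟨x, α, hα, hker⟩ := exists_of_subspace hϖ hr hj he W hW
      exact ⟨Quot.mk _ x, Subtype.ext (torsionImage_injective ((hf x α hα).trans hker))⟩
  exact ⟨Equiv.ofBijective g hg, hf⟩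

/-- If all endomorphisms of `E` are scalars, an isomorphism of targets forces the kernels to be
comparable. -/
theorem IsIsogenyOf.ker_le_or_ker_le (hϖ : 𝔭.asIdeal = Ideal.span {ϖ}) (hj : j ≤ r)
    (he : E.IsUniformization e) (hE : ∀ f : Hom E E, ∃ a : Fq[X], ∀ z, f.onPoints z = a • z)
    (hα : x.IsIsogenyOf α) (hβ : y.IsIsogenyOf β) {γ : Hom x.target y.target} (hγ : γ.IsIso) :
    LinearMap.ker α.onPoints ≤ LinearMap.ker β.onPoints ∨
      LinearMap.ker β.onPoints ≤ LinearMap.ker α.onPoints := by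
  -- The dual isogeny δ, with δβ = ϖ, and then also βδ = ϖ since β is surjective.
  obtain ⟨δ, hδ, -⟩ := β.exists_factor hβ.isUnit_poly_zero hβ.isIsogeny.surjective (E.mulHom ϖ)
    fun w hw => by
      rw [LinearMap.mem_ker, mulHom_onPoints]
      exact hβ.smul_eq_zero hϖ hj hw
  have hβδ (v : y.target.Points) : β.onPoints (δ.onPoints v) = ϖ • v := by
    obtain ⟨w, rfl⟩ := hβ.isIsogeny.surjective v
    rw [hδ, mulHom_onPoints, map_smul]
  obtain ⟨a, ha⟩ := hE (δ.comp (γ.comp α))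
  -- Apply β to the endomorphism δγα = a.
  have key (w : E.Points) : a • β.onPoints w = ϖ • γ.onPoints (α.onPoints w) := by
    rw [← map_smul, ← ha, Hom.comp_onPoints, Hom.comp_onPoints, hβδ]
  -- If a = ϖb, then divisibility of E lets ϖ be cancelled: γα = bβ, so ker β ⊆ ker α. Otherwise β
  -- maps ker α to points killed by the coprime elements a and ϖ, hence to 0.
  by_cases hdvd : ϖ ∣ a
  · obtain ⟨b, rfl⟩ := hdvd
    refine Or.inr fun w hw => ?_
    obtain ⟨w', rfl⟩ := he.smul_surjective (uniformizer_ne_zero hϖ) w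
    have h1 : γ.onPoints (α.onPoints (ϖ • w')) = b • β.onPoints (ϖ • w') := by
      rw [map_smul, map_smul, ← key, map_smul, ← mul_smul, mul_comm]
    rw [LinearMap.mem_ker] at hw
    obtain ⟨γ', hγ', -⟩ := hγ
    rw [hw, smul_zero] at h1
    rw [LinearMap.mem_ker, ← hγ' (α.onPoints (ϖ • w')), h1, map_zero]
  · refine Or.inl fun w hw => ?_
    obtain ⟨u, v, huv⟩ := ((irreducible_uniformizer hϖ).coprime_iff_not_dvd).mpr hdvd
    have hw0 := hα.smul_eq_zero hϖ hj hw
    have h1 : ϖ • β.onPoints w = 0 := by rw [← map_smul, hw0, map_zero]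
    have h2 : a • β.onPoints w = 0 := by
      rw [key, ← map_smul, ← map_smul, hw0, map_zero, map_zero]
    rw [LinearMap.mem_ker, ← one_smul Fq[X] (β.onPoints w), ← huv, add_smul, mul_smul, mul_smul,
      h1, h2, smul_zero, smul_zero, add_zero]

end HeckePoint

end Fibre

end AndersonHecke
end

/-! ### The main theorem -/

theorem theorem2p3p3 (Fq : Type*) [Field Fq] [Fintype Fq] (n r : ℕ)
    (𝔭 : HeightOneSpectrum Fq[X]) (ϖ : Fq[X]) (hϖ : 𝔭.asIdeal = Ideal.span {ϖ})
    (E : AndersonHecke.AndersonModule Fq n) (hr : E.HasRank r)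
    (e : AndersonHecke.Lie Fq n →ₗ[Fq[X]] E.Points) (he : E.IsUniformization e) :
    -- the period lattice is free of rank `r`
    (Module.Finite Fq[X] (LinearMap.ker e) ∧ Module.Free Fq[X] (LinearMap.ker e) ∧
      Module.finrank Fq[X] (LinearMap.ker e) = r) ∧
    -- the torsion is `𝔭⁻¹ L / L`, of dimension `r`
    (∃ Φ : (AndersonHecke.divLattice 𝔭 (LinearMap.ker e) ⧸
          (LinearMap.ker e).submoduleOf (AndersonHecke.divLattice 𝔭 (LinearMap.ker e)))
          ≃ₗ[Fq[X]] E.torsion 𝔭,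
        ∀ z : AndersonHecke.divLattice 𝔭 (LinearMap.ker e),
          (Φ (Submodule.Quotient.mk z) : E.Points) = e z) ∧
    Module.rank (Fq[X] ⧸ 𝔭.asIdeal) (E.torsion 𝔭) = r ∧
    ∀ j ≤ r,
      -- points of the Hecke correspondence and isogenies of type `(1, …, 1, 𝔭, …, 𝔭)`
      (∀ E' : AndersonHecke.AndersonModule Fq n, E'.HasRank r →
        ((∀ ι : AndersonHecke.Lie Fq n ≃ₗ[AndersonHecke.CInfty Fq] AndersonHecke.Lie Fq n,
          AndersonHecke.IsHeckePoint r 𝔭 ϖ j E E' ι ↔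
            ∃ α : AndersonHecke.Hom E E', α.IsIsogeny ∧
              α.HasType (AndersonHecke.typeVec r j ϖ) ∧ α.differential = ι.toLinearMap) ∧
        ((∃ ι, AndersonHecke.IsHeckePoint r 𝔭 ϖ j E E' ι) ↔
            ∃ α : AndersonHecke.Hom E E', α.IsIsogeny ∧
              α.HasType (AndersonHecke.typeVec r j ϖ)))) ∧
      -- the bijection with the `j`-dimensional subspaces of the torsion, given by the kernel
      (∃ Ψ : AndersonHecke.HeckeFibre r 𝔭 ϖ j E ≃
          {W : Submodule (Fq[X] ⧸ 𝔭.asIdeal) (E.torsion 𝔭) //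
            Module.finrank (Fq[X] ⧸ 𝔭.asIdeal) W = j},
        ∀ (x : AndersonHecke.HeckePoint r 𝔭 ϖ j E) (α : AndersonHecke.Hom E x.target),
          α.IsIsogeny → α.HasType (AndersonHecke.typeVec r j ϖ) →
          α.differential = x.marking.toLinearMap →
          ((Ψ (Quot.mk _ x)).1.restrictScalars Fq[X]).map (E.torsion 𝔭).subtype =
            LinearMap.ker α.onPoints) ∧
      -- if `End(E) = F_q[θ]`, different points have non-isomorphic targets
      ((∀ f : AndersonHecke.Hom E E, ∃ a : Fq[X], ∀ z, f.onPoints z = a • z) →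
        ∀ x y : AndersonHecke.HeckePoint r 𝔭 ϖ j E,
          (∃ β : AndersonHecke.Hom x.target y.target, β.IsIso) →
          (Quot.mk _ x : AndersonHecke.HeckeFibre r 𝔭 ϖ j E) = Quot.mk _ y) := by
  refine ⟨hr.periodLattice he, AndersonHecke.exists_divLattice_equiv he.surjective,
    AndersonHecke.rank_torsion hϖ hr, fun j hj => ⟨fun E' hr' => ⟨fun ι =>
      AndersonHecke.isHeckePoint_iff hϖ hj he hr',
      AndersonHecke.exists_isHeckePoint_iff hϖ hj he hr'⟩, ?_⟩⟩
  obtain ⟨Ψ, hΨ⟩ := AndersonHecke.HeckePoint.exists_equiv_subspaces hϖ hr hj he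
  refine ⟨⟨Ψ, fun x α h1 h2 h3 => hΨ x α ⟨h1, h2, h3⟩⟩, fun hE x y ⟨γ, hγ⟩ => Ψ.injective ?_⟩
  obtain ⟨α, hα⟩ := x.exists_isIsogenyOf hϖ hj
  obtain ⟨β, hβ⟩ := y.exists_isIsogenyOf hϖ hj
  have hx := (Ψ (Quot.mk _ x)).2
  have hy := (Ψ (Quot.mk _ y)).2
  refine Subtype.ext ?_
  -- Either inclusion is an equality, because both kernels have dimension j over A/𝔭.
  rcases hα.ker_le_or_ker_le hϖ hj he hE hβ hγ with h | h
  · rw [← hΨ x α hα, ← hΨ y β hβ] at h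
    exact AndersonHecke.eq_of_torsionImage_le hϖ hr h (hx.trans hy.symm)
  · rw [← hΨ x α hα, ← hΨ y β hβ] at h
    exact (AndersonHecke.eq_of_torsionImage_le hϖ hr h (hy.trans hx.symm)).symm
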